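/- Let $G$ be a connected non-compact simple Lie group with Lie algebra $\mathfrak g$ and Killing form $B$, and let $K$ be a maximal compact subgroup of $G$ whose Lie algebra $\mathfrak k$ yields a Cartan decomposition $\mathfrak g=\mathfrak p\oplus\mathfrak k$, where $\mathfrak p$ is the $B$-orthogonal complement of $\mathfrak k$ (so $[\mathfrak p,\mathfrak p]\subset\mathfrak k$, $B$ is negative definite on $\mathfrak k$ and positive definite on $\mathfrak p$; this is automatic if $G$ has finite centre). Left-invariant $(0,2)$-tensor fields on $G$ are identified with bilinear forms on $\mathfrak g$. Put $Q=B|_{\mathfrak p}-B|_{\mathfrak k}$. Let $\mathfrak k_1,\dots,\mathfrak k_r$ be the simple ideals of $[\mathfrak k,\mathfrak k]$; if the centre of $\mathfrak k$ is trivial let $s=0$, otherwise let $s=1$ and let $\mathfrak k_{r+1}$ be the centre, so that $\mathfrak k=\mathfrak k_1\oplus\cdots\oplus\mathfrak k_{r+s}$. Let $n=\dim\mathfrak p$, $d_i=\dim\mathfrak k_i$, and let $\kappa_i$ be the constant such that the Killing form of $\mathfrak k_i$ equals $\kappa_iB|_{\mathfrak k_i}$. Let $\mathcal M_K$ be the set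 of left-invariant Riemannian metrics on $G$ that are naturally reductive with respect to the action $(x,k)y=xyk^{-1}$ of $G\times K$ on $G$ and some reductive decomposition of the Lie algebra of $G\times K$. Let $$T=-T_{\mathfrak p}Q|_{\mathfrak p}+T_1Q|_{\mathfrak k_1}+\cdots+T_{r+s}Q|_{\mathfrak k_{r+s}},\qquad T_{\mathfrak p},T_1,\dots,T_{r+s}>0 .$$ Consider the inequalities $$\text{(A)}\quad \sum_{i=1}^{r+s}\frac{n^2\kappa_iT_{\mathfrak p}^2-d_i^2(1-\kappa_i)T_i^2}{nT_{\mathfrak p}T_i}-2n<0,\qquad\qquad \text{(B)}\quad \frac{\kappa_m\operatorname{tr}_QT}{T_m}<\dim\mathfrak k+d_m(1-\kappa_m)-3n,$$ where in (B) $m\in\{1,\dots,r\}$ is an index with $\kappa_m/T_m=\max_{1\le i\le r}\kappa_i/T_i$. 1. If (A) holds, then there is at least one pair $(g,c)\in\mathcal M_K\times(0,\infty)$ with $\operatorname{Ric}(g)=cT$. 2. If (A) and (B) hold, then there are at least two pairs $(g_1,c_1),(g_2,c_2)\in\mathcal M_K\times(0,\infty)$ with $\operatorname{Ric}(g_j)=c_jT$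 such that $g_1$ and $g_2$ are not homothetic, i.e. $g_1\ne\lambda g_2$ for every $\lambda>0$. 3. Suppose $r+s=2$, and set $$a=nd_2(1-\kappa_2)T_{\mathfrak p},\qquad b=d_1^2(1-\kappa_1)T_1-d_2^2(1-\kappa_2)T_2+2n^2T_{\mathfrak p}-\frac{n^2\kappa_1T_{\mathfrak p}^2}{T_1},$$ $$c=-2nd_2T_2+\frac{2nd_2\kappa_1T_{\mathfrak p}T_2}{T_1}-nd_2\kappa_2T_{\mathfrak p},\qquad d=-\frac{d_2^2\kappa_1T_2^2}{T_1}+\kappa_2d_2^2T_2,$$ $$D=18abcd-4b^3d+b^2c^2-4ac^3-27a^2d^2,$$ $$R_t=-\frac b{3a},\qquad R_d=\frac{9ad-bc}{2(b^2-3ac)},\qquad R_s=\frac{4abc-9a^2d-b^3}{a(b^2-3ac)},\qquad \tau=\frac{d_2T_2}{nT_{\mathfrak p}}.$$ If $D=0$ and one of the conditions (i) $b^2=3ac$ and $\tau<R_t$; (ii) $b^2\ne3ac$ and $R_s\le\tau<R_d$; (iii) $b^2\ne3ac$ and $\tau<R_s<R_d$; (iv) $b^2\ne3ac$ and $\tau<R_d<R_s$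 holds, then there is at least one pair $(g,c')\in\mathcal M_K\times(0,\infty)$ with $\operatorname{Ric}(g)=c'T$. -/

import Mathlib

open scoped Manifold ContDiff

noncomputable section

namespace PrescribedRicci

section LieAlgebra

variable {𝔤 : Type*} [LieRing 𝔤] [LieAlgebra ℝ 𝔤]

/-! ### Left-invariant metrics and their Ricci curvature

Left-invariant `(0,2)`-tensor fields on a Lie group are identified with the bilinear forms that they
induce on its Lie algebra; in particular a left-invariant metric is an inner product on the Lie
algebra. -/

/-- A left-invariant Riemannian metric, given by the inner product it induces on the Lie algebra. -/
structure LeftInvariantMetric (𝔤 : Type*) [LieRing 𝔤] [LieAlgebra ℝ 𝔤] where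
  /-- the inner product on the Lie algebra -/
  form : LinearMap.BilinForm ℝ 𝔤
  symm : ∀ X Y, form X Y = form Y X
  pos : ∀ X, X ≠ 0 → 0 < form X X

theorem LeftInvariantMetric.nondegenerate (g : LeftInvariantMetric 𝔤) : g.form.Nondegenerate := by
  refine ⟨fun X hX => ?_, fun X hX => ?_⟩
  · by_contra h
    exact (g.pos X h).ne' (hX X)
  · by_contra h
    exact (g.pos X h).ne' (hX X)

/-- The right-hand side of the Koszul formula on left-invariant vector fields `X, Y`, as a function
of the left-invariant vector field `Z`:
`g([X,Y],Z) - g([Y,Z],X) + g([Z,X],Y)`, divided by `2`. -/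
def LeftInvariantMetric.koszul (g : LeftInvariantMetric 𝔤) (X Y : 𝔤) : Module.Dual ℝ 𝔤 where
  toFun Z := (g.form ⁅X, Y⁆ Z - g.form ⁅Y, Z⁆ X + g.form ⁅Z, X⁆ Y) / 2
  map_add' Z W := by simp; ring
  map_smul' a Z := by simp; ring

/-- The Levi-Civita connection on left-invariant vector fields: `∇_X Y` is the left-invariant field
determined by the Koszul formula
`2 g(∇_X Y, Z) = g([X,Y],Z) - g([Y,Z],X) + g([Z,X],Y)`. -/
def LeftInvariantMetric.nabla [FiniteDimensional ℝ 𝔤] (g : LeftInvariantMetric 𝔤) :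
    𝔤 →ₗ[ℝ] 𝔤 →ₗ[ℝ] 𝔤 :=
  LinearMap.mk₂ ℝ (fun X Y => (g.form.toDual g.nondegenerate).symm (g.koszul X Y))
    (fun X X' Y => by
      rw [← map_add]; congr 1; ext Z; simp [LeftInvariantMetric.koszul]; ring)
    (fun a X Y => by
      rw [← map_smul]; congr 1; ext Z; simp [LeftInvariantMetric.koszul]; ring)
    (fun X Y Y' => by
      rw [← map_add]; congr 1; ext Z; simp [LeftInvariantMetric.koszul]; ring)
    (fun a X Y => by
      rw [← map_smul]; congr 1; ext Z; simp [LeftInvariantMetric.koszul]; ring)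

theorem LeftInvariantMetric.form_nabla [FiniteDimensional ℝ 𝔤] (g : LeftInvariantMetric 𝔤)
    (X Y Z : 𝔤) : 2 * g.form (g.nabla X Y) Z
      = g.form ⁅X, Y⁆ Z - g.form ⁅Y, Z⁆ X + g.form ⁅Z, X⁆ Y := by
  simp only [LeftInvariantMetric.nabla, LinearMap.mk₂_apply,
    LinearMap.BilinForm.apply_toDual_symm_apply]
  simp [LeftInvariantMetric.koszul]
  ring

/-- The map `X ↦ R(X,Y)Z`, where
`R(X,Y)Z = ∇_X ∇_Y Z - ∇_Y ∇_X Z - ∇_{[X,Y]} Z` is the Riemann curvature tensor. -/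
def LeftInvariantMetric.curvature [FiniteDimensional ℝ 𝔤] (g : LeftInvariantMetric 𝔤) (Y Z : 𝔤) :
    𝔤 →ₗ[ℝ] 𝔤 where
  toFun X := g.nabla X (g.nabla Y Z) - g.nabla Y (g.nabla X Z) - g.nabla ⁅X, Y⁆ Z
  map_add' X X' := by simp; abel
  map_smul' a X := by simp [smul_sub]

/-- The Ricci curvature `Ric(g)(Y,Z) = tr (X ↦ R(X,Y)Z)`. -/
def LeftInvariantMetric.ricci [FiniteDimensional ℝ 𝔤] (g : LeftInvariantMetric 𝔤) :
    LinearMap.BilinForm ℝ 𝔤 :=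
  LinearMap.mk₂ ℝ (fun Y Z => LinearMap.trace ℝ 𝔤 (g.curvature Y Z))
    (fun Y Y' Z => by
      rw [← map_add]; congr 1; ext X; simp [LeftInvariantMetric.curvature]; abel)
    (fun a Y Z => by
      rw [← map_smul]; congr 1; ext X; simp [LeftInvariantMetric.curvature, smul_sub])
    (fun Y Z Z' => by
      rw [← map_add]; congr 1; ext X; simp [LeftInvariantMetric.curvature]; abel)
    (fun a Y Z => by
      rw [← map_smul]; congr 1; ext X; simp [LeftInvariantMetric.curvature, smul_sub])

/-- Two metrics are homothetic if they are equal up to scaling. -/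
def Homothetic (g₁ g₂ : LeftInvariantMetric 𝔤) : Prop :=
  ∃ a : ℝ, 0 < a ∧ g₁.form = a • g₂.form

open Classical in
/-- The trace `tr_h T` of a bilinear form `T` with respect to a nondegenerate bilinear form `h`: the
trace of the endomorphism `A` with `h (A X) Y = T X Y`. -/
def traceWith [FiniteDimensional ℝ 𝔤] (h T : LinearMap.BilinForm ℝ 𝔤) : ℝ :=
  if hh : h.Nondegenerate then LinearMap.trace ℝ 𝔤 (T.symmCompOfNondegenerate h hh) else 0

/-! ### Cartan decompositions -/

/-- A Cartan decomposition `𝔤 = 𝔭 ⊕ 𝔨`: a subalgebra `𝔨` such that, with `𝔭` the orthogonal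
complement of `𝔨` for the Killing form `B`, one has `[𝔭,𝔭] ⊆ 𝔨`, and `B` is negative definite on `𝔨`
and positive definite on `𝔭`. (The inclusion `[𝔨,𝔭] ⊆ 𝔭` is automatic.) -/
structure CartanDecomposition (𝔤 : Type*) [LieRing 𝔤] [LieAlgebra ℝ 𝔤] where
  /-- the compact part -/
  𝔨 : LieSubalgebra ℝ 𝔤
  isCompl : IsCompl 𝔨.toSubmodule ((killingForm ℝ 𝔤).orthogonal 𝔨.toSubmodule)
  lie_mem : ∀ X ∈ (killingForm ℝ 𝔤).orthogonal 𝔨.toSubmodule,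
    ∀ Y ∈ (killingForm ℝ 𝔤).orthogonal 𝔨.toSubmodule, ⁅X, Y⁆ ∈ 𝔨
  neg : ∀ X ∈ 𝔨, X ≠ 0 → killingForm ℝ 𝔤 X X < 0
  pos : ∀ X ∈ (killingForm ℝ 𝔤).orthogonal 𝔨.toSubmodule, X ≠ 0 → 0 < killingForm ℝ 𝔤 X X

namespace CartanDecomposition

variable (C : CartanDecomposition 𝔤)

/-- The noncompact part: the orthogonal complement of `𝔨` for the Killing form. -/
def 𝔭 : Submodule ℝ 𝔤 := (killingForm ℝ 𝔤).orthogonal C.𝔨.toSubmodule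

/-- The projection onto `𝔨` along `𝔭`. -/
def proj𝔨 : 𝔤 →ₗ[ℝ] 𝔤 :=
  Submodule.projection _ _ C.isCompl

/-- The projection onto `𝔭` along `𝔨`. -/
def proj𝔭 : 𝔤 →ₗ[ℝ] 𝔤 :=
  Submodule.projection _ _ C.isCompl.symm

/-- The inner product `Q = B|_𝔭 - B|_𝔨`. -/
def Q : LinearMap.BilinForm ℝ 𝔤 :=
  (killingForm ℝ 𝔤).compl₁₂ C.proj𝔭 C.proj𝔭 - (killingForm ℝ 𝔤).compl₁₂ C.proj𝔨 C.proj𝔨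

end CartanDecomposition

/-! ### The decomposition of `𝔨` into ideals -/

/-- The derived algebra `[𝔨,𝔨]`, as a subalgebra of `𝔤`. -/
def derivedAlgebra (𝔨 : LieSubalgebra ℝ 𝔤) : LieSubalgebra ℝ 𝔤 :=
  (LieIdeal.toLieSubalgebra ℝ 𝔨 ⁅(⊤ : LieIdeal ℝ 𝔨), (⊤ : LieIdeal ℝ 𝔨)⁆).map 𝔨.incl

/-- The centre of `𝔨`, as a subalgebra of `𝔤`. -/
def centre (𝔨 : LieSubalgebra ℝ 𝔤) : LieSubalgebra ℝ 𝔤 :=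
  (LieIdeal.toLieSubalgebra ℝ 𝔨 (LieAlgebra.center ℝ 𝔨)).map 𝔨.incl

/-- `J` is a simple ideal of the subalgebra `L`: an ideal of `L` that is simple as a Lie algebra. -/
def IsSimpleIdeal (L J : LieSubalgebra ℝ 𝔤) : Prop :=
  J ≤ L ∧ (∀ X ∈ L, ∀ Y ∈ J, ⁅X, Y⁆ ∈ J) ∧ LieAlgebra.IsSimple ℝ J

/-- `𝔨ᵢ`, `i < r + s`, is the list of ideals of `𝔨` used in the decomposition
`𝔨 = 𝔨₁ ⊕ ⋯ ⊕ 𝔨ᵣ₊ₛ`: the first `r` terms list the simple ideals of `[𝔨,𝔨]` without repetition; if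
the centre of `𝔨` is trivial then `s = 0`, and otherwise `s = 1` and the last term is the centre. -/
structure IsIdealList (𝔨 : LieSubalgebra ℝ 𝔤) (r s : ℕ) (𝔨ᵢ : Fin (r + s) → LieSubalgebra ℝ 𝔤) :
    Prop where
  injective : Function.Injective fun i : Fin r => 𝔨ᵢ (Fin.castAdd s i)
  isSimpleIdeal_iff : ∀ J : LieSubalgebra ℝ 𝔤,
    IsSimpleIdeal (derivedAlgebra 𝔨) J ↔ ∃ i : Fin r, 𝔨ᵢ (Fin.castAdd s i) = J
  s_eq_zero : centre 𝔨 = ⊥ → s = 0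
  s_eq_one : centre 𝔨 ≠ ⊥ → s = 1
  eq_centre : ∀ j : Fin s, 𝔨ᵢ (Fin.natAdd r j) = centre 𝔨

/-- The constant `κ` with `B_J = κ B|_J`, where `B_J` and `B` are the Killing forms of the
subalgebra `J` and of `𝔤`. -/
def kappa (J : LieSubalgebra ℝ 𝔤) : ℝ :=
  Classical.epsilon fun κ : ℝ =>
    ∀ X Y : J, killingForm ℝ J X Y = κ * killingForm ℝ 𝔤 (X : 𝔤) (Y : 𝔤)

/-- `h = γ Q|_𝔭 + γ₁ Q|_𝔨₁ + ⋯ + γₘ Q|_𝔨ₘ`. -/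
structure IsDiagonal (C : CartanDecomposition 𝔤) {m : ℕ} (𝔨ᵢ : Fin m → LieSubalgebra ℝ 𝔤)
    (h : LinearMap.BilinForm ℝ 𝔤) (γ : ℝ) (γᵢ : Fin m → ℝ) : Prop where
  on_𝔭 : ∀ X ∈ C.𝔭, ∀ Y ∈ C.𝔭, h X Y = γ * C.Q X Y
  on_𝔨 : ∀ i, ∀ X ∈ 𝔨ᵢ i, ∀ Y ∈ 𝔨ᵢ i, h X Y = γᵢ i * C.Q X Y
  𝔭_𝔨 : ∀ i, ∀ X ∈ C.𝔭, ∀ Y ∈ 𝔨ᵢ i, h X Y = 0 ∧ h Y X = 0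
  𝔨_𝔨 : ∀ i j, i ≠ j → ∀ X ∈ 𝔨ᵢ i, ∀ Y ∈ 𝔨ᵢ j, h X Y = 0

/-! ### Naturally reductive metrics -/

/-- The diagonal `{(Z,Z) | Z ∈ 𝔨}` in `𝔤 × 𝔨`: the isotropy algebra at the identity of the action
`(x,k) y = x y k⁻¹` of `G × K` on `G`. -/
def isotropy (𝔨 : LieSubalgebra ℝ 𝔤) : Submodule ℝ (𝔤 × 𝔨) :=
  LinearMap.range ((𝔨.toSubmodule.subtype).prod LinearMap.id)

/-- The differential at the identity of the orbit map `(x,k) ↦ x k⁻¹` of `G × K` on `G`. -/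
def orbitMap (𝔨 : LieSubalgebra ℝ 𝔤) : (𝔤 × 𝔨) →ₗ[ℝ] 𝔤 :=
  LinearMap.fst ℝ 𝔤 𝔨 - 𝔨.toSubmodule.subtype ∘ₗ LinearMap.snd ℝ 𝔤 𝔨

/-- The set `𝓜_K` of the left-invariant metrics on `G` that are naturally reductive with respect to
`G × K` and some decomposition of its Lie algebra, for a connected subgroup `K` with Lie algebra
`𝔨`. That is, the metric is `G × K`-invariant (it is `ad(𝔨)`-invariant on `𝔤`), and there is a
reductive complement `𝔪` of the isotropy algebra in `𝔤 × 𝔨` with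
`⟨[u,v]_𝔪, w⟩ + ⟨v, [u,w]_𝔪⟩ = 0` for all `u, v, w ∈ 𝔪`. The inner product on `𝔪` comes from the
identification of `𝔪` with `𝔤` through the orbit map; as this map kills the isotropy algebra, it takes
the same value on `[u,v]` as on its `𝔪`-component `[u,v]_𝔪`. -/
def naturallyReductiveMetrics (𝔨 : LieSubalgebra ℝ 𝔤) : Set (LeftInvariantMetric 𝔤) :=
  {g | (∀ Z ∈ 𝔨, ∀ X Y : 𝔤, g.form ⁅Z, X⁆ Y + g.form X ⁅Z, Y⁆ = 0) ∧
    ∃ 𝔪 : Submodule ℝ (𝔤 × 𝔨), IsCompl (isotropy 𝔨) 𝔪 ∧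
      (∀ z ∈ isotropy 𝔨, ∀ u ∈ 𝔪, ⁅z, u⁆ ∈ 𝔪) ∧
      ∀ u ∈ 𝔪, ∀ v ∈ 𝔪, ∀ w ∈ 𝔪,
        g.form (orbitMap 𝔨 ⁅u, v⁆) (orbitMap 𝔨 w)
          + g.form (orbitMap 𝔨 v) (orbitMap 𝔨 ⁅u, w⁆) = 0}

end LieAlgebra

/-! ### Lie groups -/

section LieGroup

variable {E : Type*} [NormedAddCommGroup E] [NormedSpace ℝ E]
  {G : Type*} [TopologicalSpace G] [ChartedSpace E G]

instance instFiniteDimensionalTangentSpace [FiniteDimensional ℝ E] (x : G) :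
    FiniteDimensional ℝ (TangentSpace 𝓘(ℝ, E) x) :=
  inferInstanceAs (FiniteDimensional ℝ E)

variable [Group G] [LieGroup 𝓘(ℝ, E) (minSmoothness ℝ 3) G]

/-- `𝔨` is the Lie algebra of the subgroup `K` of `G`: it consists of the initial velocities of the
one-parameter subgroups of `G` that lie in `K`. -/
def IsLieAlgebraOf [CompleteSpace E] (K : Subgroup G)
    (𝔨 : LieSubalgebra ℝ (GroupLieAlgebra 𝓘(ℝ, E) G)) : Prop :=
  ∀ X : GroupLieAlgebra 𝓘(ℝ, E) G, X ∈ 𝔨 ↔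
    ∃ γ : ℝ → G, ContMDiff 𝓘(ℝ, ℝ) 𝓘(ℝ, E) 1 γ ∧ (∀ t u, γ (t + u) = γ t * γ u) ∧
      (∀ t, γ t ∈ K) ∧ mfderiv 𝓘(ℝ, ℝ) 𝓘(ℝ, E) γ 0 (1 : ℝ) = X

end LieGroup

/-! ### The cubic polynomial `P(x) = a x³ + b x² + c x + d` -/

section Cubic

/-- The discriminant of `a x³ + b x² + c x + d`. -/
def cubicD (a b c d : ℝ) : ℝ :=
  18 * a * b * c * d - 4 * b ^ 3 * d + b ^ 2 * c ^ 2 - 4 * a * c ^ 3 - 27 * a ^ 2 * d ^ 2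

/-- The number `R_t` (the triple root if `D = 0` and `b² = 3ac`). -/
def cubicRt (a b : ℝ) : ℝ := -b / (3 * a)

/-- The number `R_d` (the double root if `D = 0` and `b² ≠ 3ac`). -/
def cubicRd (a b c d : ℝ) : ℝ := (9 * a * d - b * c) / (2 * (b ^ 2 - 3 * a * c))

/-- The number `R_s` (the simple root if `D = 0` and `b² ≠ 3ac`). -/
def cubicRs (a b c d : ℝ) : ℝ :=
  (4 * a * b * c - 9 * a ^ 2 * d - b ^ 3) / (a * (b ^ 2 - 3 * a * c))

/-- One of the four discriminant conditions holds, for the cubic with coefficients `a, b, c, d` and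
the threshold `τ`. -/
def CubicCondition (a b c d τ : ℝ) : Prop :=
  (cubicD a b c d = 0 ∧ b ^ 2 = 3 * a * c ∧ τ < cubicRt a b) ∨
  (cubicD a b c d = 0 ∧ b ^ 2 ≠ 3 * a * c ∧ cubicRs a b c d ≤ τ ∧ τ < cubicRd a b c d) ∨
  (cubicD a b c d = 0 ∧ b ^ 2 ≠ 3 * a * c ∧
    τ < cubicRs a b c d ∧ cubicRs a b c d < cubicRd a b c d) ∨
  (cubicD a b c d = 0 ∧ b ^ 2 ≠ 3 * a * c ∧
    τ < cubicRd a b c d ∧ cubicRd a b c d < cubicRs a b c d)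

/-- The discriminant conditions for the tensor field `T = -T_𝔭 Q|_𝔭 + T₁ Q|_𝔨₁ + T₂ Q|_𝔨₂`, in terms
of `n = dim 𝔭`, `dᵢ = dim 𝔨ᵢ`, `κᵢ` and the coefficients of `T`. -/
def TensorCubicCondition (n d₁ d₂ κ₁ κ₂ T𝔭 T₁ T₂ : ℝ) : Prop :=
  CubicCondition
    (n * d₂ * (1 - κ₂) * T𝔭)
    (d₁ ^ 2 * (1 - κ₁) * T₁ - d₂ ^ 2 * (1 - κ₂) * T₂ + 2 * n ^ 2 * T𝔭 - n ^ 2 * κ₁ * T𝔭 ^ 2 / T₁)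
    (-2 * n * d₂ * T₂ + 2 * n * d₂ * κ₁ * T𝔭 * T₂ / T₁ - n * d₂ * κ₂ * T𝔭)
    (-(d₂ ^ 2 * κ₁ * T₂ ^ 2 / T₁) + κ₂ * d₂ ^ 2 * T₂)
    (d₂ * T₂ / (n * T𝔭))

end Cubic

end PrescribedRicci

end

/-! The search is confined to metrics Q|_𝔭 + x₁Q|_𝔨₁ + ⋯ with all xᵢ > 0. They are naturally
reductive (`metric_mem`), and since Ricci curvature does not change under scaling, fixing the
coefficient 1 on 𝔭 loses no solutions among diagonal metrics.

Their Ricci curvature is again diagonal (`ricci_isDiagonal`): it is (κᵢ + (1-κᵢ)xᵢ²)/4 on 𝔨ᵢ and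
-(1/2 + ∑ xᵢdᵢ(1-κᵢ)/(2n)) on 𝔭. Behind these numbers lie Schur's lemma, for the simple 𝔨ᵢ and for
𝔭, which is 𝔨-irreducible because 𝔤 is simple, and a double count that computes the Casimir constant
of 𝔨ᵢ on 𝔭 (`finrank_mul_casimir`).

The equations on the 𝔨ᵢ determine xᵢ = `ratio` as a function of c, so that only the equation on 𝔭
remains, `defect` = 0 in the single unknown c. The defect tends to -∞ as c grows, because the xᵢ are
of order √c (`exists_defect_neg`). Inequality (A) produces a c₀ where it is positive
(`exists_defect_pos`), and the intermediate value theorem gives a solution c ≥ c₀. Under (B) the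
defect is also negative at c = κₘ/(4Tₘ), the left end of the range where all xᵢ are defined
(`defect_neg_of_max`). There is then a root on each side of c₀, and different constants c force
non-homothetic metrics.

With two summands, solutions are sought with tr_g T = 0. Taking the trace of Ric = cT shows that the
scalar curvature must then vanish too. On the curve tr_g T = 0, parametrized by x = x₂, the scalar
curvature is -P(x)/4 up to a positive denominator, P being the cubic of the statement. A double root
of P beyond the threshold τ is a critical point at which the scalar curvature is zero, and the
Lagrange condition there is the Ricci equation (`TensorCubicCondition.exists_solution`). -/

namespace PrescribedRicci

open CartanDecomposition

/-! ### Symmetric bilinear forms: orthonormal bases, Schur's lemma, traces of adjoints. -/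

section LinearAlgebra

variable {V : Type*} [AddCommGroup V] [Module ℝ V]

/-- The inner product structure given by a positive definite symmetric bilinear form. -/
abbrev innerCoreOfForm (h : LinearMap.BilinForm ℝ V) (symm : ∀ X Y, h X Y = h Y X)
    (pos : ∀ X, X ≠ 0 → 0 < h X X) : InnerProductSpace.Core ℝ V where
  inner X Y := h X Y
  conj_inner_symm X Y := by simpa using symm Y X
  re_inner_nonneg X := by
    by_cases hX : X = 0
    · simp [hX]
    · simpa using (pos X hX).le
  add_left X Y Z := by simp
  smul_left X Y r := by simp
  definite X hX := by
    by_contra h0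
    exact (pos X h0).ne' hX

variable [FiniteDimensional ℝ V]

theorem exists_orthonormal_basis (h : LinearMap.BilinForm ℝ V) (symm : ∀ X Y, h X Y = h Y X)
    (pos : ∀ X, X ≠ 0 → 0 < h X X) :
    ∃ b : Module.Basis (Fin (Module.finrank ℝ V)) ℝ V,
      (∀ X i, b.repr X i = h (b i) X) := by
  let := (innerCoreOfForm h symm pos).toNormedAddCommGroup
  let := InnerProductSpace.ofCore (innerCoreOfForm h symm pos).toCore
  refine ⟨(stdOrthonormalBasis ℝ V).toBasis, fun X i => ?_⟩
  have := (stdOrthonormalBasis ℝ V).repr_apply_apply X i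
  rw [OrthonormalBasis.coe_toBasis_repr_apply, OrthonormalBasis.coe_toBasis, this]
  rfl

/-- The operator representing `f` with respect to `h` is self-adjoint for the inner product `h`, so
the spectral theorem supplies a real eigenvalue. -/
theorem exists_eigenvector_form [Nontrivial V] (h f : LinearMap.BilinForm ℝ V)
    (symm : ∀ X Y, h X Y = h Y X) (pos : ∀ X, X ≠ 0 → 0 < h X X)
    (fsymm : ∀ X Y, f X Y = f Y X) :
    ∃ μ : ℝ, ∃ v, v ≠ 0 ∧ ∀ w, f v w = μ * h v w := by
  let := (innerCoreOfForm h symm pos).toNormedAddCommGroup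
  let := InnerProductSpace.ofCore (innerCoreOfForm h symm pos).toCore
  have hnd : h.Nondegenerate := by
    refine ⟨fun X hX => ?_, fun X hX => ?_⟩ <;>
    · by_contra h0
      exact (pos X h0).ne' (hX X)
  have hA (v w : V) : h (f.symmCompOfNondegenerate h hnd v) w = f v w :=
    LinearMap.BilinForm.symmCompOfNondegenerate_left_apply f hnd w v
  have hsym : (f.symmCompOfNondegenerate h hnd).IsSymmetric := by
    intro v w
    change h _ _ = h _ _
    rw [hA, symm, hA, fsymm]
  obtain ⟨μ, hμ⟩ : ∃ μ : ℝ, Module.End.HasEigenvalue (f.symmCompOfNondegenerate h hnd) μ :=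
    ⟨_, hsym.hasEigenvalue_iSup_of_finiteDimensional⟩
  obtain ⟨v, hv⟩ := hμ.exists_hasEigenvector
  refine ⟨μ, v, hv.2, fun w => ?_⟩
  rw [← hA, hv.apply_eq_smul]
  simp

/-- Schur's lemma: two symmetric forms, the first one positive definite on the subspace `W`, are
proportional on `W` if `W` has no proper subspace invariant under a set of maps that are
skew for both forms. -/
theorem proportional_of_irreducible (W : Submodule ℝ V) (S : Set (Module.End ℝ V))
    (h f : LinearMap.BilinForm ℝ V)
    (stable : ∀ A ∈ S, ∀ X ∈ W, A X ∈ W)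
    (irr : ∀ U ≤ W, (∀ A ∈ S, ∀ X ∈ U, A X ∈ U) → U ≠ ⊥ → U = W)
    (symm : ∀ X Y, h X Y = h Y X) (pos : ∀ X ∈ W, X ≠ 0 → 0 < h X X)
    (fsymm : ∀ X Y, f X Y = f Y X)
    (hinv : ∀ A ∈ S, ∀ X ∈ W, ∀ Y ∈ W, h (A X) Y = - h X (A Y))
    (finv : ∀ A ∈ S, ∀ X ∈ W, ∀ Y ∈ W, f (A X) Y = - f X (A Y)) :
    ∃ μ : ℝ, ∀ X ∈ W, ∀ Y ∈ W, f X Y = μ * h X Y := by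
  by_cases hW : W = ⊥
  · refine ⟨0, fun X hX Y hY => ?_⟩
    rw [hW, Submodule.mem_bot] at hX
    simp [hX]
  have : Nontrivial W := Submodule.nontrivial_iff_ne_bot.2 hW
  obtain ⟨μ, v, hv, hvw⟩ := exists_eigenvector_form (h.restrict W) (f.restrict W)
    (fun X Y => symm _ _) (fun X hX => pos X X.2 (by simpa using hX)) (fun X Y => fsymm _ _)
  refine ⟨μ, ?_⟩
  -- The μ-eigenspace of `f` relative to `h` inside `W`. Skewness for both forms makes it stable
  -- under `S`, so by irreducibility it fills `W`.
  let U : Submodule ℝ V := W ⊓ ⨅ w : W, LinearMap.ker ((f.flip - μ • h.flip) w)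
  have memU (X : V) : X ∈ U ↔ X ∈ W ∧ ∀ w ∈ W, f X w = μ * h X w := by
    simp [U, sub_eq_zero]
  have hU : U = W := by
    refine irr U inf_le_left (fun A hA X hX => ?_) ?_
    · rw [memU] at hX ⊢
      refine ⟨stable A hA X hX.1, fun w hw => ?_⟩
      rw [finv A hA X hX.1 w hw, hinv A hA X hX.1 w hw, hX.2 _ (stable A hA w hw)]
      ring
    · refine (Submodule.ne_bot_iff _).2 ⟨v, ?_, by simpa using hv⟩
      rw [memU]
      exact ⟨v.2, fun w hw => hvw ⟨w, hw⟩⟩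
  intro X hX Y hY
  rw [← hU, memU] at hX
  exact hX.2 Y hY

/-- Maps that are adjoint to each other for a nondegenerate form have the same trace. -/
theorem trace_eq_of_adjoint (h : LinearMap.BilinForm ℝ V) (hnd : h.Nondegenerate)
    (A A' : Module.End ℝ V) (hA : ∀ X Y, h (A X) Y = h X (A' Y)) :
    LinearMap.trace ℝ V A = LinearMap.trace ℝ V A' := by
  have : (h.toDual hnd).conj A = Module.Dual.transpose A' := by
    ext φ Y
    rw [LinearEquiv.conj_apply_apply, LinearMap.BilinForm.toDual_def, hA,
      LinearMap.BilinForm.apply_toDual_symm_apply]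
    rfl
  rw [← LinearMap.trace_transpose' A', ← this, LinearMap.trace_conj']

end LinearAlgebra

/-! ### Trace forms weighted by an endomorphism. -/

section WeightedKillingForm

variable {𝔤 : Type*} [LieRing 𝔤] [LieAlgebra ℝ 𝔤]

theorem killing_symm (X Y : 𝔤) : killingForm ℝ 𝔤 X Y = killingForm ℝ 𝔤 Y X :=
  LieModule.traceForm_comm ℝ 𝔤 𝔤 X Y

theorem killing_lie (X Y Z : 𝔤) : killingForm ℝ 𝔤 ⁅X, Y⁆ Z = killingForm ℝ 𝔤 X ⁅Y, Z⁆ :=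
  LieModule.traceForm_apply_lie_apply ℝ 𝔤 𝔤 X Y Z

theorem killing_lie' (X Y Z : 𝔤) : killingForm ℝ 𝔤 ⁅X, Y⁆ Z = - killingForm ℝ 𝔤 Y ⁅X, Z⁆ :=
  LieModule.traceForm_apply_lie_apply' ℝ 𝔤 𝔤 X Y Z

/-- The bilinear form `(X, Y) ↦ tr (P ∘ ad X ∘ ad Y)`. -/
noncomputable def weightedKilling (P : Module.End ℝ 𝔤) : LinearMap.BilinForm ℝ 𝔤 :=
  LinearMap.mk₂ ℝ
    (fun X Y => LinearMap.trace ℝ 𝔤 (P * (LieAlgebra.ad ℝ 𝔤 X * LieAlgebra.ad ℝ 𝔤 Y)))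
    (fun X X' Y => by simp [mul_add, add_mul])
    (fun a X Y => by simp)
    (fun X Y Y' => by simp [mul_add])
    (fun a X Y => by simp)

theorem weightedKilling_apply (P : Module.End ℝ 𝔤) (X Y : 𝔤) : weightedKilling P X Y
    = LinearMap.trace ℝ 𝔤 (P * (LieAlgebra.ad ℝ 𝔤 X * LieAlgebra.ad ℝ 𝔤 Y)) := rfl

theorem weightedKilling_one : weightedKilling (1 : Module.End ℝ 𝔤) = killingForm ℝ 𝔤 := by
  ext X Y
  rw [weightedKilling_apply, one_mul]
  rfl

theorem weightedKilling_add (P P' : Module.End ℝ 𝔤) :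
    weightedKilling (P + P') = weightedKilling P + weightedKilling P' := by
  ext X Y
  simp [weightedKilling_apply, add_mul]

theorem weightedKilling_sum_smul {ι : Type*} (s : Finset ι) (x : ι → ℝ)
    (P : ι → Module.End ℝ 𝔤) :
    weightedKilling (∑ i ∈ s, x i • P i) = ∑ i ∈ s, x i • weightedKilling (P i) := by
  ext X Y
  simp [weightedKilling_apply, Finset.sum_mul, LinearMap.sum_apply]

theorem weightedKilling_sum {ι : Type*} (s : Finset ι) (P : ι → Module.End ℝ 𝔤) :
    weightedKilling (∑ i ∈ s, P i) = ∑ i ∈ s, weightedKilling (P i) := by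
  simpa using weightedKilling_sum_smul s 1 P

/-- The form `tr (P ∘ ad X ∘ ad Y)` is invariant under elements whose adjoint map commutes
with `P`. -/
theorem weightedKilling_lie (P : Module.End ℝ 𝔤) (Z X Y : 𝔤)
    (h : Commute P (LieAlgebra.ad ℝ 𝔤 Z)) :
    weightedKilling P ⁅Z, X⁆ Y = - weightedKilling P X ⁅Z, Y⁆ := by
  simp only [weightedKilling_apply, LieHom.map_lie, Ring.lie_def]
  set z := LieAlgebra.ad ℝ 𝔤 Z
  set x := LieAlgebra.ad ℝ 𝔤 X
  set y := LieAlgebra.ad ℝ 𝔤 Y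
  have h1 : P * ((z * x - x * z) * y) = z * (P * (x * y)) - P * (x * z * y) := by
    rw [← mul_assoc z, ← h.eq]; noncomm_ring
  have h2 : P * (x * (z * y - y * z)) = P * (x * z * y) - (P * (x * y)) * z := by
    noncomm_ring
  rw [h1, h2, map_sub, map_sub, LinearMap.trace_mul_comm ℝ z]
  ring

end WeightedKillingForm

/-! ### Cartan decompositions and orthogonal projections. -/

section Cartan

variable {𝔤 : Type*} [LieRing 𝔤] [LieAlgebra ℝ 𝔤]

namespace CartanDecomposition

variable (C : CartanDecomposition 𝔤)

theorem lie_𝔭_𝔭 {X Y : 𝔤} (hX : X ∈ C.𝔭) (hY : Y ∈ C.𝔭) : ⁅X, Y⁆ ∈ C.𝔨 :=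
  C.lie_mem X hX Y hY

theorem lie_𝔨_𝔨 {X Y : 𝔤} (hX : X ∈ C.𝔨) (hY : Y ∈ C.𝔨) : ⁅X, Y⁆ ∈ C.𝔨 :=
  C.𝔨.lie_mem hX hY

theorem lie_𝔨_𝔭 {X Y : 𝔤} (hX : X ∈ C.𝔨) (hY : Y ∈ C.𝔭) : ⁅X, Y⁆ ∈ C.𝔭 := by
  intro Z hZ
  have h := killing_lie Z X Y
  rw [hY _ (C.lie_𝔨_𝔨 hZ hX)] at h
  exact h.symm

theorem lie_𝔭_𝔨 {X Y : 𝔤} (hX : X ∈ C.𝔭) (hY : Y ∈ C.𝔨) : ⁅X, Y⁆ ∈ C.𝔭 := by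
  rw [← lie_skew]
  exact C.𝔭.neg_mem (C.lie_𝔨_𝔭 hY hX)

theorem killing_𝔨_𝔭 {X Y : 𝔤} (hX : X ∈ C.𝔨) (hY : Y ∈ C.𝔭) : killingForm ℝ 𝔤 X Y = 0 :=
  hY X hX

theorem killing_𝔭_𝔨 {X Y : 𝔤} (hX : X ∈ C.𝔭) (hY : Y ∈ C.𝔨) : killingForm ℝ 𝔤 X Y = 0 := by
  rw [killing_symm]
  exact hX Y hY

theorem proj𝔭_mem (X : 𝔤) : C.proj𝔭 X ∈ C.𝔭 := Submodule.projection_apply_mem _ X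

theorem proj𝔨_mem (X : 𝔤) : C.proj𝔨 X ∈ C.𝔨 := Submodule.projection_apply_mem C.isCompl X

theorem proj𝔭_of_mem {X : 𝔤} (hX : X ∈ C.𝔭) : C.proj𝔭 X = X :=
  Submodule.projection_apply_of_mem_left C.isCompl.symm hX

theorem proj𝔨_of_mem {X : 𝔤} (hX : X ∈ C.𝔨) : C.proj𝔨 X = X :=
  Submodule.projection_apply_of_mem_left C.isCompl hX

theorem proj𝔭_of_mem_𝔨 {X : 𝔤} (hX : X ∈ C.𝔨) : C.proj𝔭 X = 0 :=
  Submodule.projection_apply_of_mem_right C.isCompl.symm hX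

theorem proj𝔨_of_mem_𝔭 {X : 𝔤} (hX : X ∈ C.𝔭) : C.proj𝔨 X = 0 :=
  Submodule.projection_apply_of_mem_right C.isCompl hX

theorem proj_add_proj (X : 𝔤) : C.proj𝔭 X + C.proj𝔨 X = X := by
  rw [add_comm]
  exact Submodule.projection_add_projection_eq_self C.isCompl X

theorem proj_add_proj_eq_one : C.proj𝔭 + C.proj𝔨 = (1 : Module.End ℝ 𝔤) :=
  LinearMap.ext C.proj_add_proj

theorem eq_zero_of_killing_𝔨 {X : 𝔤} (hX : X ∈ C.𝔨) (h : killingForm ℝ 𝔤 X X = 0) : X = 0 := by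
  by_contra h0
  exact (C.neg X hX h0).ne h

theorem eq_zero_of_killing_𝔭 {X : 𝔤} (hX : X ∈ C.𝔭) (h : killingForm ℝ 𝔤 X X = 0) : X = 0 := by
  by_contra h0
  exact (C.pos X hX h0).ne' h

theorem eq_zero_of_forall_killing (C : CartanDecomposition 𝔤) {X : 𝔤}
    (h : ∀ Y, killingForm ℝ 𝔤 X Y = 0) : X = 0 := by
  have hp : C.proj𝔭 X = 0 := by
    refine C.eq_zero_of_killing_𝔭 (C.proj𝔭_mem X) ?_
    have := h (C.proj𝔭 X)
    nth_rw 1 [← C.proj_add_proj X] at this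
    rwa [map_add, LinearMap.add_apply, C.killing_𝔨_𝔭 (C.proj𝔨_mem X) (C.proj𝔭_mem X),
      add_zero] at this
  have hk : C.proj𝔨 X = 0 := by
    refine C.eq_zero_of_killing_𝔨 (C.proj𝔨_mem X) ?_
    have := h (C.proj𝔨 X)
    nth_rw 1 [← C.proj_add_proj X] at this
    rwa [map_add, LinearMap.add_apply, C.killing_𝔭_𝔨 (C.proj𝔭_mem X) (C.proj𝔨_mem X),
      zero_add] at this
  rw [← C.proj_add_proj X, hp, hk, add_zero]

theorem killing_nondegenerate (C : CartanDecomposition 𝔤) :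
    (killingForm ℝ 𝔤).Nondegenerate :=
  ⟨fun _ h => C.eq_zero_of_forall_killing h,
    fun X h => C.eq_zero_of_forall_killing fun Y => by rw [killing_symm]; exact h Y⟩

theorem eq_of_forall_killing (C : CartanDecomposition 𝔤) {X X' : 𝔤}
    (h : ∀ Y, killingForm ℝ 𝔤 X Y = killingForm ℝ 𝔤 X' Y) :
    X = X' := by
  rw [← sub_eq_zero]
  exact C.eq_zero_of_forall_killing fun Y => by simp [h Y]

theorem Q_apply (X Y : 𝔤) : C.Q X Y
    = killingForm ℝ 𝔤 (C.proj𝔭 X) (C.proj𝔭 Y) - killingForm ℝ 𝔤 (C.proj𝔨 X) (C.proj𝔨 Y) := rfl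

theorem Q_𝔭 {X : 𝔤} (hX : X ∈ C.𝔭) (Y : 𝔤) : C.Q X Y = killingForm ℝ 𝔤 X Y := by
  rw [Q_apply, C.proj𝔭_of_mem hX, C.proj𝔨_of_mem_𝔭 hX]
  conv_rhs => rw [← C.proj_add_proj Y]
  rw [map_add, C.killing_𝔭_𝔨 hX (C.proj𝔨_mem Y)]
  simp

theorem Q_𝔨 {X : 𝔤} (hX : X ∈ C.𝔨) (Y : 𝔤) : C.Q X Y = - killingForm ℝ 𝔤 X Y := by
  rw [Q_apply, C.proj𝔨_of_mem hX, C.proj𝔭_of_mem_𝔨 hX]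
  conv_rhs => rw [← C.proj_add_proj Y]
  rw [map_add, C.killing_𝔨_𝔭 hX (C.proj𝔭_mem Y)]
  simp

theorem Q_symm (X Y : 𝔤) : C.Q X Y = C.Q Y X := by
  simp only [Q_apply]
  rw [killing_symm (C.proj𝔭 X), killing_symm (C.proj𝔨 X)]

theorem Q_pos (X : 𝔤) (hX : X ≠ 0) : 0 < C.Q X X := by
  rw [Q_apply]
  have hk : killingForm ℝ 𝔤 (C.proj𝔨 X) (C.proj𝔨 X) ≤ 0 := by
    by_cases h : C.proj𝔨 X = 0
    · simp [h]
    · exact (C.neg _ (C.proj𝔨_mem X) h).le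
  by_cases h : C.proj𝔭 X = 0
  · have : C.proj𝔨 X ≠ 0 := fun h' => hX (by rw [← C.proj_add_proj X, h, h', add_zero])
    have := C.neg _ (C.proj𝔨_mem X) this
    simp only [h, map_zero]
    linarith
  · have := C.pos _ (C.proj𝔭_mem X) h
    linarith

theorem Q_nondegenerate : C.Q.Nondegenerate := by
  refine ⟨fun X hX => ?_, fun X hX => ?_⟩ <;>
  · by_contra h
    exact (C.Q_pos X h).ne' (hX X)

theorem Q_self_nonneg (X : 𝔤) : 0 ≤ C.Q X X := by
  by_cases h : X = 0
  · simp [h]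
  · exact (C.Q_pos X h).le

theorem Q_lie {Z : 𝔤} (hZ : Z ∈ C.𝔨) (X Y : 𝔤) : C.Q ⁅Z, X⁆ Y = - C.Q X ⁅Z, Y⁆ := by
  rw [← C.proj_add_proj X]
  simp only [lie_add, map_add, LinearMap.add_apply]
  rw [C.Q_𝔭 (C.lie_𝔨_𝔭 hZ (C.proj𝔭_mem X)), C.Q_𝔨 (C.lie_𝔨_𝔨 hZ (C.proj𝔨_mem X)),
    C.Q_𝔭 (C.proj𝔭_mem X), C.Q_𝔨 (C.proj𝔨_mem X), killing_lie', killing_lie' Z]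
  ring

/-- `P` is the projection onto `J` orthogonal for the Killing form. -/
structure IsOrthProj (J : Submodule ℝ 𝔤) (P : Module.End ℝ 𝔤) : Prop where
  isProj : LinearMap.IsProj J P
  symm : ∀ X Y, killingForm ℝ 𝔤 (P X) Y = killingForm ℝ 𝔤 X (P Y)

theorem isOrthProj_proj𝔭 : IsOrthProj C.𝔭 C.proj𝔭 where
  isProj := ⟨C.proj𝔭_mem, fun _ => C.proj𝔭_of_mem⟩
  symm X Y := by
    nth_rw 1 [← C.proj_add_proj Y]
    nth_rw 2 [← C.proj_add_proj X]
    simp only [map_add, LinearMap.add_apply]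
    rw [C.killing_𝔭_𝔨 (C.proj𝔭_mem X) (C.proj𝔨_mem Y),
      C.killing_𝔨_𝔭 (C.proj𝔨_mem X) (C.proj𝔭_mem Y)]

theorem isOrthProj_proj𝔨 : IsOrthProj C.𝔨.toSubmodule C.proj𝔨 where
  isProj := ⟨C.proj𝔨_mem, fun _ => C.proj𝔨_of_mem⟩
  symm X Y := by
    nth_rw 1 [← C.proj_add_proj Y]
    nth_rw 2 [← C.proj_add_proj X]
    simp only [map_add, LinearMap.add_apply]
    rw [C.killing_𝔭_𝔨 (C.proj𝔭_mem X) (C.proj𝔨_mem Y),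
      C.killing_𝔨_𝔭 (C.proj𝔨_mem X) (C.proj𝔭_mem Y)]

theorem IsOrthProj.apply_eq_zero {J : Submodule ℝ 𝔤} {P : Module.End ℝ 𝔤} (hP : IsOrthProj J P)
    (C : CartanDecomposition 𝔤) {X : 𝔤} (hX : ∀ Y ∈ J, killingForm ℝ 𝔤 X Y = 0) : P X = 0 :=
  C.eq_zero_of_forall_killing fun Y => by rw [hP.symm, hX _ (hP.isProj.1 Y)]

/-- An orthogonal projection commutes with the adjoint maps that preserve its range. -/
theorem IsOrthProj.commute {J : Submodule ℝ 𝔤} {P : Module.End ℝ 𝔤} (hP : IsOrthProj J P)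
    (C : CartanDecomposition 𝔤) {Z : 𝔤} (hZ : ∀ X ∈ J, ⁅Z, X⁆ ∈ J) :
    Commute P (LieAlgebra.ad ℝ 𝔤 Z) := by
  refine LinearMap.ext fun X => C.eq_of_forall_killing fun Y => ?_
  simp only [Module.End.mul_apply, LieAlgebra.ad_apply]
  have h (W : 𝔤) : P ⁅Z, P W⁆ = ⁅Z, P W⁆ := hP.isProj.2 _ (hZ _ (hP.isProj.1 W))
  rw [hP.symm, killing_lie', ← h Y, ← hP.symm, ← neg_eq_iff_eq_neg.2 (killing_lie' Z _ _),
    neg_neg, ← hP.symm, h]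

variable [FiniteDimensional ℝ 𝔤]

/-- Negative definiteness of B on 𝔨 makes every subspace of 𝔨 meet its B-orthogonal trivially. -/
theorem isCompl_orthogonal {J : Submodule ℝ 𝔤} (hJ : J ≤ C.𝔨.toSubmodule) :
    IsCompl J ((killingForm ℝ 𝔤).orthogonal J) := by
  rw [LinearMap.BilinForm.isCompl_orthogonal_iff_disjoint
    (fun X Y h => by rw [killing_symm]; exact h), Submodule.disjoint_def]
  intro X hX hX'
  exact C.eq_zero_of_killing_𝔨 (hJ hX) (hX' X hX)

theorem exists_isOrthProj {J : Submodule ℝ 𝔤} (hJ : J ≤ C.𝔨.toSubmodule) :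
    ∃ P, IsOrthProj J P := by
  have hc := C.isCompl_orthogonal hJ
  have hm (X : 𝔤) : Submodule.projection _ _ hc X ∈ J := Submodule.projection_apply_mem hc X
  have hm' (X : 𝔤) : Submodule.projection _ _ hc.symm X ∈ (killingForm ℝ 𝔤).orthogonal J :=
    Submodule.projection_apply_mem hc.symm X
  refine ⟨Submodule.projection _ _ hc, ⟨hm,
    fun X hX => Submodule.projection_apply_of_mem_left hc hX⟩, fun X Y => ?_⟩
  nth_rw 1 [← Submodule.projection_add_projection_eq_self hc Y]
  nth_rw 2 [← Submodule.projection_add_projection_eq_self hc X]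
  rw [map_add, map_add, LinearMap.add_apply, hm' Y _ (hm X),
    killing_symm (Submodule.projection _ _ hc.symm X), hm' X _ (hm Y)]

end CartanDecomposition

end Cartan

/-! ### The splitting of 𝔨 into orthogonal ideals. -/

section Ideals

variable {𝔤 : Type*} [LieRing 𝔤] [LieAlgebra ℝ 𝔤]

theorem mem_centre {𝔨 : LieSubalgebra ℝ 𝔤} {X : 𝔤} :
    X ∈ centre 𝔨 ↔ X ∈ 𝔨 ∧ ∀ Y ∈ 𝔨, ⁅Y, X⁆ = 0 := by
  constructor
  · rintro ⟨Z, hZ, rfl⟩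
    refine ⟨Z.2, fun Y hY => ?_⟩
    have := (LieModule.mem_maxTrivSubmodule ℝ 𝔨 𝔨 Z).1 hZ ⟨Y, hY⟩
    exact congrArg Subtype.val this
  · rintro ⟨hX, h⟩
    refine ⟨⟨X, hX⟩, ?_, rfl⟩
    exact (LieModule.mem_maxTrivSubmodule ℝ 𝔨 𝔨 _).2 fun Y => Subtype.ext (h Y Y.2)

theorem derivedAlgebra_le (𝔨 : LieSubalgebra ℝ 𝔤) : derivedAlgebra 𝔨 ≤ 𝔨 := by
  rintro _ ⟨Z, _, rfl⟩
  exact Z.2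

theorem lie_mem_derivedAlgebra {𝔨 : LieSubalgebra ℝ 𝔤} {X Y : 𝔤} (hX : X ∈ 𝔨) (hY : Y ∈ 𝔨) :
    ⁅X, Y⁆ ∈ derivedAlgebra 𝔨 :=
  ⟨⁅(⟨X, hX⟩ : 𝔨), (⟨Y, hY⟩ : 𝔨)⁆,
    LieSubmodule.lie_mem_lie (LieSubmodule.mem_top _) (LieSubmodule.mem_top _), rfl⟩

theorem eq_of_isSimple {J : LieSubalgebra ℝ 𝔤} (hJ : LieAlgebra.IsSimple ℝ J)
    {U : Submodule ℝ 𝔤} (hU : U ≤ J.toSubmodule) (h : ∀ X ∈ J, ∀ Y ∈ U, ⁅X, Y⁆ ∈ U)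
    (h0 : U ≠ ⊥) : U = J.toSubmodule := by
  let I : LieIdeal ℝ J :=
    { U.comap J.toSubmodule.subtype with
      lie_mem := fun {X Y} hY => h X X.2 Y hY }
  have memI (X : J) : X ∈ I ↔ (X : 𝔤) ∈ U := Iff.rfl
  rcases hJ.eq_bot_or_eq_top I with hI | hI
  · refine absurd ?_ h0
    rw [Submodule.eq_bot_iff]
    intro X hX
    have : (⟨X, hU hX⟩ : J) ∈ I := hX
    rw [hI, LieSubmodule.mem_bot] at this
    exact congrArg Subtype.val this
  · refine le_antisymm hU fun X hX => ?_
    have : (⟨X, hX⟩ : J) ∈ I := hI ▸ LieSubmodule.mem_top _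
    exact this

theorem ne_bot_of_isSimple {J : LieSubalgebra ℝ 𝔤} (hJ : LieAlgebra.IsSimple ℝ J) :
    J.toSubmodule ≠ ⊥ := by
  intro h
  refine hJ.non_abelian ⟨fun X Y => Subtype.ext ?_⟩
  have : ∀ Z ∈ J.toSubmodule, Z = 0 := (Submodule.eq_bot_iff _).1 h
  exact this _ (⁅X, Y⁆ : J).2

/-- Simple algebras are perfect: the span of the brackets is a nonzero ideal of `J`, hence `J`
itself. Linear statements about `J` may therefore be tested on brackets. -/
theorem le_of_isSimple_of_lie_mem {J : LieSubalgebra ℝ 𝔤} (hJ : LieAlgebra.IsSimple ℝ J)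
    {N : Submodule ℝ 𝔤} (h : ∀ X ∈ J, ∀ Y ∈ J, ⁅X, Y⁆ ∈ N) : J.toSubmodule ≤ N := by
  let S : Set 𝔤 := {Z | ∃ X ∈ J, ∃ Y ∈ J, ⁅X, Y⁆ = Z}
  have hSJ : Submodule.span ℝ S ≤ J.toSubmodule := by
    rw [Submodule.span_le]
    rintro _ ⟨X, hX, Y, hY, rfl⟩
    exact J.lie_mem hX hY
  have hSN : Submodule.span ℝ S ≤ N := by
    rw [Submodule.span_le]
    rintro _ ⟨X, hX, Y, hY, rfl⟩
    exact h X hX Y hY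
  rw [← eq_of_isSimple hJ hSJ (fun X hX Y hY => Submodule.subset_span ⟨X, hX, Y, hSJ hY, rfl⟩) ?_]
  · exact hSN
  · intro h0
    refine hJ.non_abelian ⟨fun X Y => Subtype.ext ?_⟩
    exact (Submodule.eq_bot_iff _).1 h0 _ (Submodule.subset_span ⟨X, X.2, Y, Y.2, rfl⟩)

/-- A simple ideal of the derived algebra of `𝔨` is an ideal of `𝔨`. -/
theorem IsSimpleIdeal.lie_mem {𝔨 J : LieSubalgebra ℝ 𝔤} (hJ : IsSimpleIdeal (derivedAlgebra 𝔨) J)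
    {X Y : 𝔤} (hX : X ∈ 𝔨) (hY : Y ∈ J) : ⁅X, Y⁆ ∈ J := by
  have hle : J ≤ 𝔨 := hJ.1.trans (derivedAlgebra_le 𝔨)
  have : J.toSubmodule ≤ J.toSubmodule.comap (LieAlgebra.ad ℝ 𝔤 X) := by
    refine le_of_isSimple_of_lie_mem hJ.2.2 fun a ha b hb => ?_
    change ⁅X, ⁅a, b⁆⁆ ∈ J
    -- Since J = [J,J], it suffices to treat brackets. By Leibniz only [X,a] and [X,b] act, and
    -- these lie in the derived algebra, of which `J` is an ideal.
    rw [leibniz_lie]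
    refine J.add_mem (hJ.2.1 _ (lie_mem_derivedAlgebra hX (hle ha)) _ hb) ?_
    rw [← lie_skew]
    exact J.neg_mem (hJ.2.1 _ (lie_mem_derivedAlgebra hX (hle hb)) _ ha)
  exact this hY

/-- The bracket lies in J ∩ J', an ideal of both algebras. If it were nonzero it would equal both of
them. -/
theorem IsSimpleIdeal.lie_eq_zero {L J J' : LieSubalgebra ℝ 𝔤} (hJ : IsSimpleIdeal L J)
    (hJ' : IsSimpleIdeal L J') (hne : J ≠ J') {X Y : 𝔤} (hX : X ∈ J) (hY : Y ∈ J') :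
    ⁅X, Y⁆ = 0 := by
  have hI : J.toSubmodule ⊓ J'.toSubmodule = ⊥ := by
    by_contra h0
    have h1 := eq_of_isSimple hJ.2.2 inf_le_left (fun A hA B hB =>
      ⟨J.lie_mem hA hB.1, hJ'.2.1 A (hJ.1 hA) B hB.2⟩) h0
    have h2 := eq_of_isSimple hJ'.2.2 inf_le_right (fun A hA B hB =>
      ⟨hJ.2.1 A (hJ'.1 hA) B hB.1, J'.lie_mem hA hB.2⟩) h0
    exact hne (LieSubalgebra.toSubmodule_injective (h1.symm.trans h2))
  have : ⁅X, Y⁆ ∈ J.toSubmodule ⊓ J'.toSubmodule := by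
    refine ⟨?_, hJ'.2.1 X (hJ.1 hX) Y hY⟩
    rw [← lie_skew]
    exact J.neg_mem (hJ.2.1 Y (hJ'.1 hY) X hX)
  rwa [hI, Submodule.mem_bot] at this

/-- A simple algebra is orthogonal to everything that commutes with it. -/
theorem killing_eq_zero_of_isSimple {J : LieSubalgebra ℝ 𝔤} (hJ : LieAlgebra.IsSimple ℝ J)
    {Y : 𝔤} (hY : ∀ X ∈ J, ⁅X, Y⁆ = 0) {X : 𝔤} (hX : X ∈ J) : killingForm ℝ 𝔤 X Y = 0 := by
  have : J.toSubmodule ≤ LinearMap.ker (killingForm ℝ 𝔤 Y) := by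
    refine le_of_isSimple_of_lie_mem hJ fun a ha b hb => ?_
    rw [LinearMap.mem_ker, killing_symm, killing_lie, hY b hb, map_zero]
  rw [killing_symm]
  exact this hX

/-- `𝔨 = 𝔨₁ ⊕ ⋯ ⊕ 𝔨ₘ` is a decomposition into nonzero ideals that are orthogonal for the Killing
form, and the `Pᵢ` are the projections. -/
structure IsIdealDecomposition (C : CartanDecomposition 𝔤) {m : ℕ}
    (𝔨ᵢ : Fin m → LieSubalgebra ℝ 𝔤) (P : Fin m → Module.End ℝ 𝔤) : Prop where
  le : ∀ i, 𝔨ᵢ i ≤ C.𝔨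
  lie_mem : ∀ i, ∀ X ∈ C.𝔨, ∀ Y ∈ 𝔨ᵢ i, ⁅X, Y⁆ ∈ 𝔨ᵢ i
  ne_bot : ∀ i, (𝔨ᵢ i).toSubmodule ≠ ⊥
  orth : ∀ i j, i ≠ j → ∀ X ∈ 𝔨ᵢ i, ∀ Y ∈ 𝔨ᵢ j, killingForm ℝ 𝔤 X Y = 0
  isOrthProj : ∀ i, CartanDecomposition.IsOrthProj (𝔨ᵢ i).toSubmodule (P i)
  sum_eq : ∑ i, P i = C.proj𝔨

variable [FiniteDimensional ℝ 𝔤]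

/-- A nonzero subspace of `𝔨` that is invariant under `𝔨` contains either a nonzero central element
of `𝔨` or a simple ideal of `[𝔨,𝔨]`. -/
theorem exists_centre_or_isSimpleIdeal (C : CartanDecomposition 𝔤) {N : Submodule ℝ 𝔤}
    (hN : N ≤ C.𝔨.toSubmodule) (hinv : ∀ X ∈ C.𝔨, ∀ Y ∈ N, ⁅X, Y⁆ ∈ N) (h0 : N ≠ ⊥) :
    (∃ X ∈ N, X ≠ 0 ∧ X ∈ centre C.𝔨) ∨
      ∃ J, IsSimpleIdeal (derivedAlgebra C.𝔨) J ∧ J.toSubmodule ≤ N := by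
  -- A minimal nonzero 𝔨-invariant subspace `J` of `N` will be central if it is abelian, and a
  -- simple ideal otherwise.
  obtain ⟨J, ⟨hJN, hJinv, hJ0⟩, hmin⟩ := wellFounded_lt.has_min
    {J : Submodule ℝ 𝔤 | J ≤ N ∧ (∀ X ∈ C.𝔨, ∀ Y ∈ J, ⁅X, Y⁆ ∈ J) ∧ J ≠ ⊥} ⟨N, le_rfl, hinv, h0⟩
  have hJk : J ≤ C.𝔨.toSubmodule := hJN.trans hN
  have hmin' (I : Submodule ℝ 𝔤) (hIJ : I ≤ J) (hI : ∀ X ∈ C.𝔨, ∀ Y ∈ I, ⁅X, Y⁆ ∈ I)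
      (hI0 : I ≠ ⊥) : I = J := by
    by_contra hne
    exact hmin I ⟨hIJ.trans hJN, hI, hI0⟩ (lt_of_le_of_ne hIJ hne)
  obtain ⟨P, hP⟩ := C.exists_isOrthProj hJk
  -- Only the `J`-component of `X` acts on `J`: for X' = X - PX ⟂ J one has B([X',Y],[X',Y]) =
  -- B(X',[Y,[X',Y]]) = 0, and B is definite on 𝔨. Hence ideals of `J` are 𝔨-invariant and
  -- minimality applies to them.
  have hcomm (X : 𝔤) (hX : X ∈ C.𝔨) (Y : 𝔤) (hY : Y ∈ J) : ⁅X, Y⁆ = ⁅P X, Y⁆ := by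
    rw [← sub_eq_zero, ← sub_lie]
    have hX' : X - P X ∈ C.𝔨 := C.𝔨.sub_mem hX (hJk (hP.isProj.1 X))
    refine C.eq_zero_of_killing_𝔨 (hJk (hJinv _ hX' Y hY)) ?_
    have hmem : ⁅Y, ⁅X - P X, Y⁆⁆ ∈ J := hJinv Y (hJk hY) _ (hJinv _ hX' Y hY)
    rw [killing_lie]
    generalize ⁅Y, ⁅X - P X, Y⁆⁆ = Z at hmem
    rw [map_sub, LinearMap.sub_apply, hP.symm, hP.isProj.2 Z hmem, sub_self]
  by_cases hab : ∀ X ∈ J, ∀ Y ∈ J, ⁅X, Y⁆ = 0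
  · left
    obtain ⟨X, hX, hX0⟩ := (Submodule.ne_bot_iff _).1 hJ0
    refine ⟨X, hJN hX, hX0, mem_centre.2 ⟨hJk hX, fun Y hY => ?_⟩⟩
    rw [hcomm Y hY X hX, hab _ (hP.isProj.1 Y) X hX]
  · right
    let J' : LieSubalgebra ℝ 𝔤 := { J with lie_mem' := fun {X Y} hX hY => hJinv X (hJk hX) Y hY }
    have memJ' (X : 𝔤) : X ∈ J' ↔ X ∈ J := Iff.rfl
    refine ⟨J', ⟨?_, fun X hX Y hY => hJinv X (derivedAlgebra_le _ hX) Y hY, ?_, ?_⟩, hJN⟩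
    -- [J,J] is 𝔨-invariant and nonzero, so minimality gives [J,J] = J, which places `J` inside the
    -- derived algebra.
    · have hspan : Submodule.span ℝ {Z | ∃ X ∈ J, ∃ Y ∈ J, ⁅X, Y⁆ = Z} = J := by
        have hle : Submodule.span ℝ {Z | ∃ X ∈ J, ∃ Y ∈ J, ⁅X, Y⁆ = Z} ≤ J := by
          rw [Submodule.span_le]
          rintro _ ⟨X, hX, Y, hY, rfl⟩
          exact hJinv X (hJk hX) Y hY
        refine hmin' _ hle (fun X hX Y hY => ?_) fun h => hab fun X hX Y hY => ?_
        · rw [hcomm X hX Y (hle hY)]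
          exact Submodule.subset_span ⟨_, hP.isProj.1 X, Y, hle hY, rfl⟩
        · exact (Submodule.eq_bot_iff _).1 h _ (Submodule.subset_span ⟨X, hX, Y, hY, rfl⟩)
      intro Z hZ
      rw [memJ', ← hspan] at hZ
      have : Submodule.span ℝ {Z | ∃ X ∈ J, ∃ Y ∈ J, ⁅X, Y⁆ = Z}
          ≤ (derivedAlgebra C.𝔨).toSubmodule := by
        rw [Submodule.span_le]
        rintro _ ⟨X, hX, Y, hY, rfl⟩
        exact lie_mem_derivedAlgebra (hJk hX) (hJk hY)
      exact this hZ
    · intro I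
      by_cases hI : I = ⊥
      · exact Or.inl hI
      right
      have hle : I.toSubmodule.map J'.toSubmodule.subtype ≤ J := by
        rintro _ ⟨X, _, rfl⟩
        exact X.2
      have := hmin' _ hle ?_ ?_
      · rw [eq_top_iff]
        intro X _
        have hX : (X : 𝔤) ∈ I.toSubmodule.map J'.toSubmodule.subtype := this ▸ X.2
        obtain ⟨Y, hY, hYX⟩ := hX
        rwa [← Subtype.ext hYX]
      · rintro X hX _ ⟨Y, hY, rfl⟩
        change ⁅X, (Y : 𝔤)⁆ ∈ _
        rw [hcomm X hX Y Y.2]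
        exact ⟨⁅(⟨P X, hP.isProj.1 X⟩ : J'), Y⁆, I.lie_mem hY, rfl⟩
      · intro h
        refine hI ((LieSubmodule.eq_bot_iff _).2 fun X hX => Subtype.ext ?_)
        exact (Submodule.eq_bot_iff _).1 h _ ⟨X, hX, rfl⟩
    · intro h
      refine hab fun X hX Y hY => ?_
      exact congrArg Subtype.val (h.trivial (⟨X, hX⟩ : J') (⟨Y, hY⟩ : J'))

/-- The listed ideals are mutually orthogonal. Their common orthogonal complement in 𝔨 is invariant,
so if nonzero it would contain a central vector or a listed simple ideal. Such vectors would be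
orthogonal to themselves, against definiteness. -/
theorem IsIdealList.exists_isIdealDecomposition {C : CartanDecomposition 𝔤} {r s : ℕ}
    {𝔨ᵢ : Fin (r + s) → LieSubalgebra ℝ 𝔤} (h : IsIdealList C.𝔨 r s 𝔨ᵢ) :
    ∃ P, IsIdealDecomposition C 𝔨ᵢ P := by
  have hsimple (i : Fin r) : IsSimpleIdeal (derivedAlgebra C.𝔨) (𝔨ᵢ (i.castAdd s)) :=
    (h.isSimpleIdeal_iff _).2 ⟨i, rfl⟩
  have hle (i) : 𝔨ᵢ i ≤ C.𝔨 := by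
    refine Fin.addCases (fun i => ?_) (fun j => ?_) i
    · exact (hsimple i).1.trans (derivedAlgebra_le _)
    · rw [h.eq_centre]
      exact fun X hX => (mem_centre.1 hX).1
  have hlie (i) : ∀ X ∈ C.𝔨, ∀ Y ∈ 𝔨ᵢ i, ⁅X, Y⁆ ∈ 𝔨ᵢ i := by
    refine Fin.addCases (fun i => ?_) (fun j => ?_) i
    · exact fun X hX Y hY => (hsimple i).lie_mem hX hY
    · rw [h.eq_centre]
      intro X hX Y hY
      rw [(mem_centre.1 hY).2 X hX]
      exact zero_mem _
  -- This rules out two different indices that both stand for the centre.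
  have hs : s ≤ 1 := by
    by_cases hc : centre C.𝔨 = ⊥
    · simp [h.s_eq_zero hc]
    · exact (h.s_eq_one hc).le
  have horth_sc (i : Fin r) (j : Fin s) (X : 𝔤) (hX : X ∈ 𝔨ᵢ (i.castAdd s)) (Y : 𝔤)
      (hY : Y ∈ 𝔨ᵢ (j.natAdd r)) : killingForm ℝ 𝔤 X Y = 0 := by
    rw [h.eq_centre, mem_centre] at hY
    exact killing_eq_zero_of_isSimple (hsimple i).2.2 (fun Z hZ => hY.2 Z (hle _ hZ)) hX
  have horth (i j) : i ≠ j → ∀ X ∈ 𝔨ᵢ i, ∀ Y ∈ 𝔨ᵢ j, killingForm ℝ 𝔤 X Y = 0 := by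
    refine Fin.addCases (fun i => ?_) (fun i => ?_) i <;>
      refine Fin.addCases (fun j => ?_) (fun j => ?_) j
    · intro hij X hX Y hY
      refine killing_eq_zero_of_isSimple (hsimple i).2.2 (fun Z hZ => ?_) hX
      refine (hsimple i).lie_eq_zero (hsimple j) (fun he => hij ?_) hZ hY
      rw [h.injective he]
    · exact fun _ => horth_sc i j
    · intro _ X hX Y hY
      rw [killing_symm]
      exact horth_sc j i Y hY X hX
    · intro hij
      have : i = j := by
        have := i.2
        have := j.2
        exact Fin.ext (by omega)
      exact absurd (congrArg _ this) hij
  choose P hP using fun i => C.exists_isOrthProj (J := (𝔨ᵢ i).toSubmodule) (hle i)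
  refine ⟨P, hle, hlie, fun i => ?_, horth, hP, ?_⟩
  · refine Fin.addCases (fun i => ?_) (fun j => ?_) i
    · exact ne_bot_of_isSimple (hsimple i).2.2
    · rw [h.eq_centre]
      intro h0
      have := h.s_eq_zero (LieSubalgebra.toSubmodule_injective h0)
      exact absurd j.2 (by omega)
  · let N : Submodule ℝ 𝔤 := C.𝔨.toSubmodule ⊓ ⨅ i, (killingForm ℝ 𝔤).orthogonal (𝔨ᵢ i).toSubmodule
    have memN (X : 𝔤) : X ∈ N ↔ X ∈ C.𝔨 ∧ ∀ i, ∀ Y ∈ 𝔨ᵢ i, killingForm ℝ 𝔤 Y X = 0 := by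
      simp only [N, Submodule.mem_inf, Submodule.mem_iInf]
      rfl
    have hN : N = ⊥ := by
      by_contra hN0
      have hcases := exists_centre_or_isSimpleIdeal C (N := N) inf_le_left ?_ hN0
      · rcases hcases with ⟨X, hXN, hX0, hXc⟩ | ⟨J, hJ, hJN⟩
        · have hs1 : s = 1 := h.s_eq_one fun hc => hX0 (by simpa [hc] using hXc)
          let j : Fin s := ⟨0, by omega⟩
          rw [memN] at hXN
          refine hX0 (C.eq_zero_of_killing_𝔨 hXN.1 (hXN.2 (j.natAdd r) X ?_))
          rwa [h.eq_centre]
        · obtain ⟨i, rfl⟩ := (h.isSimpleIdeal_iff J).1 hJ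
          refine ne_bot_of_isSimple hJ.2.2 ((Submodule.eq_bot_iff _).2 fun X hX => ?_)
          have := (memN X).1 (hJN hX)
          exact C.eq_zero_of_killing_𝔨 this.1 (this.2 _ X hX)
      · intro X hX Y hY
        rw [memN] at hY ⊢
        refine ⟨C.lie_𝔨_𝔨 hX hY.1, fun i Z hZ => ?_⟩
        rw [← killing_lie, ← lie_skew, map_neg, LinearMap.neg_apply,
          hY.2 i _ (hlie i X hX Z hZ), neg_zero]
    refine LinearMap.ext fun X => ?_
    rw [LinearMap.sum_apply, eq_comm, ← sub_eq_zero, ← Submodule.mem_bot ℝ, ← hN, memN]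
    refine ⟨C.𝔨.sub_mem (C.proj𝔨_mem X)
      (sum_mem fun i _ => hle i ((hP i).isProj.1 X)), fun i Y hY => ?_⟩
    rw [map_sub, map_sum, Finset.sum_eq_single i, ← C.isOrthProj_proj𝔨.symm,
      C.proj𝔨_of_mem (hle i hY), ← (hP i).symm, (hP i).isProj.2 Y hY, sub_self]
    · exact fun j _ hji => horth i j hji.symm Y hY _ ((hP j).isProj.1 X)
    · simp

end Ideals

/-! ### Weighted trace forms on 𝔭 and on the ideals 𝔨ᵢ. -/

section Invariants

variable {𝔤 : Type*} [LieRing 𝔤] [LieAlgebra ℝ 𝔤]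

/-- The B-adjoint of P ∘ ad X ∘ ad Y is ad Y ∘ ad X ∘ P, and the trace is cyclic. -/
theorem weightedKilling_symm [FiniteDimensional ℝ 𝔤] (C : CartanDecomposition 𝔤) {P : Module.End ℝ 𝔤}
    (hP : ∀ X Y, killingForm ℝ 𝔤 (P X) Y = killingForm ℝ 𝔤 X (P Y)) (X Y : 𝔤) :
    weightedKilling P X Y = weightedKilling P Y X := by
  rw [weightedKilling_apply, weightedKilling_apply, trace_eq_of_adjoint (killingForm ℝ 𝔤)
    C.killing_nondegenerate _ ((LieAlgebra.ad ℝ 𝔤 Y * LieAlgebra.ad ℝ 𝔤 X) * P),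
    LinearMap.trace_mul_comm]
  intro Z W
  simp only [Module.End.mul_apply, LieAlgebra.ad_apply]
  rw [hP, killing_lie', killing_lie', neg_neg]

/-- The adjoint maps have no trace on the range of an orthogonal projection. -/
theorem trace_proj_mul_ad [FiniteDimensional ℝ 𝔤] (C : CartanDecomposition 𝔤) {P : Module.End ℝ 𝔤}
    (hP : ∀ X Y, killingForm ℝ 𝔤 (P X) Y = killingForm ℝ 𝔤 X (P Y)) (X : 𝔤) :
    LinearMap.trace ℝ 𝔤 (P * LieAlgebra.ad ℝ 𝔤 X) = 0 := by
  have h := trace_eq_of_adjoint (killingForm ℝ 𝔤) C.killing_nondegenerate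
    (P * LieAlgebra.ad ℝ 𝔤 X) (-(LieAlgebra.ad ℝ 𝔤 X * P)) fun Z W => by
      simp only [Module.End.mul_apply, LieAlgebra.ad_apply, LinearMap.neg_apply, map_neg, hP,
        killing_lie']
  rw [map_neg, LinearMap.trace_mul_comm ℝ (LieAlgebra.ad ℝ 𝔤 X)] at h
  linarith

theorem trace_eq_sum (C : CartanDecomposition 𝔤) {ι : Type*} [Fintype ι] [DecidableEq ι]
    {b : Module.Basis ι ℝ 𝔤} (hb : ∀ X i, b.repr X i = C.Q (b i) X) (A : Module.End ℝ 𝔤) :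
    LinearMap.trace ℝ 𝔤 A = ∑ i, C.Q (b i) (A (b i)) := by
  rw [LinearMap.trace_eq_matrix_trace ℝ b, Matrix.trace]
  simp [LinearMap.toMatrix_apply, hb]

/-- As `P` is idempotent and Q-symmetric, projecting the vectors of any orthonormal basis replaces a
choice of basis adapted to `J`. -/
theorem weightedKilling_eq_sum (C : CartanDecomposition 𝔤) {ι : Type*} [Fintype ι]
    [DecidableEq ι] {b : Module.Basis ι ℝ 𝔤} (hb : ∀ X i, b.repr X i = C.Q (b i) X)
    {J : Submodule ℝ 𝔤} {P : Module.End ℝ 𝔤} (hP : IsOrthProj J P)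
    (hQ : ∀ X Y, C.Q (P X) Y = C.Q X (P Y)) (X : 𝔤) :
    weightedKilling P X X = ∑ i, C.Q (P (b i)) ⁅X, ⁅X, P (b i)⁆⁆ := by
  have hPP : P * P = P := LinearMap.ext fun Y => hP.isProj.2 _ (hP.isProj.1 Y)
  have h : LinearMap.trace ℝ 𝔤 (P * (LieAlgebra.ad ℝ 𝔤 X * LieAlgebra.ad ℝ 𝔤 X))
      = LinearMap.trace ℝ 𝔤 (P * (LieAlgebra.ad ℝ 𝔤 X * LieAlgebra.ad ℝ 𝔤 X) * P) := by
    rw [LinearMap.trace_mul_comm _ _ P, ← mul_assoc P P, hPP]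
  rw [weightedKilling_apply, h, trace_eq_sum C hb]
  simp [hQ]

theorem trace_orthProj_eq_sum [FiniteDimensional ℝ 𝔤] (C : CartanDecomposition 𝔤) {ι : Type*} [Fintype ι]
    [DecidableEq ι] {b : Module.Basis ι ℝ 𝔤} (hb : ∀ X i, b.repr X i = C.Q (b i) X)
    {J : Submodule ℝ 𝔤} {P : Module.End ℝ 𝔤} (hP : IsOrthProj J P)
    (hQ : ∀ X Y, C.Q (P X) Y = C.Q X (P Y)) :
    (Module.finrank ℝ J : ℝ) = ∑ i, C.Q (P (b i)) (P (b i)) := by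
  have hPP : P * P = P := LinearMap.ext fun Y => hP.isProj.2 _ (hP.isProj.1 Y)
  rw [← hP.isProj.trace, trace_eq_sum C hb]
  refine Finset.sum_congr rfl fun i _ => ?_
  rw [hQ, ← Module.End.mul_apply, hPP]

theorem CartanDecomposition.Q_proj𝔭 (C : CartanDecomposition 𝔤) (X Y : 𝔤) :
    C.Q (C.proj𝔭 X) Y = C.Q X (C.proj𝔭 Y) := by
  rw [C.Q_𝔭 (C.proj𝔭_mem X), C.Q_symm, C.Q_𝔭 (C.proj𝔭_mem Y), C.isOrthProj_proj𝔭.symm,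
    killing_symm]

theorem CartanDecomposition.Q_isOrthProj (C : CartanDecomposition 𝔤) {J : Submodule ℝ 𝔤}
    (hJ : J ≤ C.𝔨.toSubmodule) {P : Module.End ℝ 𝔤} (hP : IsOrthProj J P) (X Y : 𝔤) :
    C.Q (P X) Y = C.Q X (P Y) := by
  rw [C.Q_𝔨 (hJ (hP.isProj.1 X)), C.Q_symm, C.Q_𝔨 (hJ (hP.isProj.1 Y)), hP.symm, killing_symm]

/-- For `X ∈ 𝔨`, `tr (P ∘ (ad X)²) ≤ 0`, with equality only if `ad X` vanishes on the range
of `P`. -/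
theorem weightedKilling_self_nonpos [FiniteDimensional ℝ 𝔤] (C : CartanDecomposition 𝔤) {J : Submodule ℝ 𝔤}
    {P : Module.End ℝ 𝔤} (hP : IsOrthProj J P) (hQ : ∀ X Y, C.Q (P X) Y = C.Q X (P Y))
    {X : 𝔤} (hX : X ∈ C.𝔨) :
    weightedKilling P X X ≤ 0 ∧ (weightedKilling P X X = 0 → ∀ Y ∈ J, ⁅X, Y⁆ = 0) := by
  obtain ⟨b, hb⟩ := exists_orthonormal_basis C.Q C.Q_symm C.Q_pos
  have hsum : weightedKilling P X X = - ∑ i, C.Q ⁅X, P (b i)⁆ ⁅X, P (b i)⁆ := by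
    rw [weightedKilling_eq_sum C hb hP hQ, ← Finset.sum_neg_distrib]
    exact Finset.sum_congr rfl fun i _ => by rw [C.Q_lie hX, neg_neg]
  have hnn : 0 ≤ ∑ i, C.Q ⁅X, P (b i)⁆ ⁅X, P (b i)⁆ :=
    Finset.sum_nonneg fun i _ => C.Q_self_nonneg _
  refine ⟨by linarith, fun h Y hY => ?_⟩
  have h0 : ∑ i, C.Q ⁅X, P (b i)⁆ ⁅X, P (b i)⁆ = 0 := by linarith
  rw [Finset.sum_eq_zero_iff_of_nonneg fun i _ => C.Q_self_nonneg _] at h0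
  have h1 (i) : ⁅X, P (b i)⁆ = 0 := by
    by_contra hne
    exact (C.Q_pos _ hne).ne' (h0 i (Finset.mem_univ i))
  have h2 : LieAlgebra.ad ℝ 𝔤 X ∘ₗ P = 0 := b.ext fun i => by simp [h1]
  have := LinearMap.congr_fun h2 Y
  simpa [hP.isProj.2 Y hY] using this

section Simple

variable [LieAlgebra.IsSimple ℝ 𝔤]

/-- `𝔭` is irreducible as a representation of `𝔨`. -/
theorem CartanDecomposition.𝔭_irreducible [FiniteDimensional ℝ 𝔤] (C : CartanDecomposition 𝔤) {U : Submodule ℝ 𝔤}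
    (hU : U ≤ C.𝔭) (hinv : ∀ Z ∈ C.𝔨, ∀ X ∈ U, ⁅Z, X⁆ ∈ U) (h0 : U ≠ ⊥) : U = C.𝔭 := by
  let U' : Submodule ℝ 𝔤 := C.𝔭 ⊓ (killingForm ℝ 𝔤).orthogonal U
  -- The complement U' of `U` in 𝔭 commutes with `U`: [Y,X] ∈ 𝔨 has B-norm -B(Y,[[Y,X],X]), which
  -- vanishes because `U` is 𝔨-invariant. This is what makes U + [U,U] an ideal of 𝔤.
  have hdis (X Y : 𝔤) (hX : X ∈ U) (hY : Y ∈ U') : ⁅Y, X⁆ = 0 := by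
    have hk := C.lie_𝔭_𝔭 hY.1 (hU hX)
    refine C.eq_zero_of_killing_𝔨 hk ?_
    rw [killing_lie, ← lie_skew, map_neg, killing_symm, hY.2 _ (hinv _ hk X hX), neg_zero]
  have hsplit (Y : 𝔤) (hY : Y ∈ C.𝔭) : ∃ A ∈ U, Y - A ∈ U' := by
    have hc : IsCompl U ((killingForm ℝ 𝔤).orthogonal U) := by
      rw [LinearMap.BilinForm.isCompl_orthogonal_iff_disjoint
        (fun X Y h => by rw [killing_symm]; exact h), Submodule.disjoint_def]
      exact fun X hX hX' => C.eq_zero_of_killing_𝔭 (hU hX) (hX' X hX)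
    refine ⟨Submodule.projection _ _ hc Y, Submodule.projection_apply_mem hc Y,
      C.𝔭.sub_mem hY (hU (Submodule.projection_apply_mem hc Y)), ?_⟩
    rw [← Submodule.projection_eq_self_sub_projection hc]
    exact Submodule.projection_apply_mem hc.symm Y
  let S : Set 𝔤 := {Z | ∃ X ∈ U, ∃ Y ∈ U, ⁅X, Y⁆ = Z}
  have hSk : Submodule.span ℝ S ≤ C.𝔨.toSubmodule := by
    rw [Submodule.span_le]
    rintro _ ⟨X, hX, Y, hY, rfl⟩
    exact C.lie_𝔭_𝔭 (hU hX) (hU hY)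
  have hlieS (A X Y : 𝔤) (hX : X ∈ U) (hY : Y ∈ U) : ⁅A, ⁅X, Y⁆⁆ ∈ U ⊔ Submodule.span ℝ S := by
    rw [← C.proj_add_proj A, add_lie]
    refine add_mem ?_ ?_
    · obtain ⟨A', hA', hA''⟩ := hsplit _ (C.proj𝔭_mem A)
      rw [← sub_add_cancel (C.proj𝔭 A) A', add_lie]
      refine add_mem ?_ (Submodule.mem_sup_left ?_)
      · rw [leibniz_lie, hdis X _ hX hA'', hdis Y _ hY hA'']
        simp
      · rw [← lie_skew]
        exact U.neg_mem (hinv _ (C.lie_𝔭_𝔭 (hU hX) (hU hY)) _ hA')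
    · refine Submodule.mem_sup_right ?_
      rw [leibniz_lie]
      exact add_mem (Submodule.subset_span ⟨_, hinv _ (C.proj𝔨_mem A) X hX, Y, hY, rfl⟩)
        (Submodule.subset_span ⟨X, hX, _, hinv _ (C.proj𝔨_mem A) Y hY, rfl⟩)
  have hlieU (A X : 𝔤) (hX : X ∈ U) : ⁅A, X⁆ ∈ U ⊔ Submodule.span ℝ S := by
    rw [← C.proj_add_proj A, add_lie]
    refine add_mem ?_ (Submodule.mem_sup_left (hinv _ (C.proj𝔨_mem A) X hX))
    obtain ⟨A', hA', hA''⟩ := hsplit _ (C.proj𝔭_mem A)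
    rw [← sub_add_cancel (C.proj𝔭 A) A', add_lie, hdis X _ hX hA'', zero_add]
    exact Submodule.mem_sup_right (Submodule.subset_span ⟨A', hA', X, hX, rfl⟩)
  let I : LieIdeal ℝ 𝔤 :=
    { U ⊔ Submodule.span ℝ S with
      lie_mem := by
        intro A X hX
        have : U ⊔ Submodule.span ℝ S
            ≤ (U ⊔ Submodule.span ℝ S).comap (LieAlgebra.ad ℝ 𝔤 A) := by
          refine sup_le (fun X hX => hlieU A X hX) (Submodule.span_le.2 ?_)
          rintro _ ⟨X, hX, Y, hY, rfl⟩
          exact hlieS A X Y hX hY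
        exact this hX }
  have memI (X : 𝔤) : X ∈ I ↔ X ∈ U ⊔ Submodule.span ℝ S := Iff.rfl
  rcases LieAlgebra.IsSimple.eq_bot_or_eq_top I with hI | hI
  · refine absurd ((Submodule.eq_bot_iff _).2 fun X hX => ?_) h0
    rw [← LieSubmodule.mem_bot (R := ℝ) (L := 𝔤), ← hI, memI]
    exact Submodule.mem_sup_left hX
  · refine le_antisymm hU fun X hX => ?_
    have : X ∈ I := hI ▸ LieSubmodule.mem_top X
    obtain ⟨A, hA, Z, hZ, rfl⟩ := Submodule.mem_sup.1 ((memI X).1 this)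
    have hZp : Z ∈ C.𝔭 := by simpa using C.𝔭.sub_mem hX (hU hA)
    have : Z = 0 := C.eq_zero_of_killing_𝔨 (hSk hZ) (C.killing_𝔨_𝔭 (hSk hZ) hZp)
    simpa [this] using hA

/-- The action of `𝔨` on `𝔭` is faithful if `𝔭 ≠ 0`. -/
theorem CartanDecomposition.faithful (C : CartanDecomposition 𝔤) (hp : C.𝔭 ≠ ⊥) {X : 𝔤}
    (hX : X ∈ C.𝔨) (h : ∀ Y ∈ C.𝔭, ⁅X, Y⁆ = 0) : X = 0 := by
  -- The centralizer of 𝔭 in 𝔨 is an ideal of 𝔤; being contained in 𝔨, it cannot be everything when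
  -- 𝔭 ≠ 0.
  let I : LieIdeal ℝ 𝔤 :=
    { carrier := {X | X ∈ C.𝔨 ∧ ∀ Y ∈ C.𝔭, ⁅X, Y⁆ = 0}
      add_mem' := fun {X Y} hX hY =>
        ⟨add_mem hX.1 hY.1, fun Z hZ => by rw [add_lie, hX.2 Z hZ, hY.2 Z hZ, add_zero]⟩
      zero_mem' := ⟨zero_mem _, fun Z _ => zero_lie Z⟩
      smul_mem' := fun a X hX =>
        ⟨C.𝔨.smul_mem a hX.1, fun Z hZ => by rw [smul_lie, hX.2 Z hZ, smul_zero]⟩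
      lie_mem := by
        rintro A X ⟨hX, h⟩
        rw [← C.proj_add_proj A, add_lie]
        have hz : ⁅C.proj𝔭 A, X⁆ = 0 := by
          rw [← lie_skew, h _ (C.proj𝔭_mem A), neg_zero]
        rw [hz, zero_add]
        refine ⟨C.lie_𝔨_𝔨 (C.proj𝔨_mem A) hX, fun Y hY => ?_⟩
        rw [lie_lie, h Y hY, lie_zero, h _ (C.lie_𝔨_𝔭 (C.proj𝔨_mem A) hY), sub_zero] }
  have memI (X : 𝔤) : X ∈ I ↔ X ∈ C.𝔨 ∧ ∀ Y ∈ C.𝔭, ⁅X, Y⁆ = 0 := Iff.rfl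
  rcases LieAlgebra.IsSimple.eq_bot_or_eq_top I with hI | hI
  · rw [← LieSubmodule.mem_bot (R := ℝ) (L := 𝔤), ← hI]
    exact ⟨hX, h⟩
  · refine absurd ((Submodule.eq_bot_iff _).2 fun Y hY => ?_) hp
    have : Y ∈ I := hI ▸ LieSubmodule.mem_top Y
    exact C.eq_zero_of_killing_𝔭 hY (C.killing_𝔨_𝔭 ((memI Y).1 this).1 hY)

end Simple

namespace IsIdealDecomposition

variable {C : CartanDecomposition 𝔤} {m : ℕ} {𝔨ᵢ : Fin m → LieSubalgebra ℝ 𝔤}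
  {P : Fin m → Module.End ℝ 𝔤}

theorem commute (D : IsIdealDecomposition C 𝔨ᵢ P) (i : Fin m) {Z : 𝔤} (hZ : Z ∈ C.𝔨) : Commute (P i) (LieAlgebra.ad ℝ 𝔤 Z) :=
  (D.isOrthProj i).commute C (D.lie_mem i Z hZ)

theorem proj_mem (D : IsIdealDecomposition C 𝔨ᵢ P) (i : Fin m) (X : 𝔤) : P i X ∈ 𝔨ᵢ i := (D.isOrthProj i).isProj.1 X

theorem proj_of_mem (D : IsIdealDecomposition C 𝔨ᵢ P) {i : Fin m} {X : 𝔤} (hX : X ∈ 𝔨ᵢ i) : P i X = X :=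
  (D.isOrthProj i).isProj.2 X hX

theorem proj_of_mem_ne (D : IsIdealDecomposition C 𝔨ᵢ P) {i j : Fin m} (hij : i ≠ j) {X : 𝔤} (hX : X ∈ 𝔨ᵢ j) : P i X = 0 :=
  (D.isOrthProj i).apply_eq_zero C fun Y hY => D.orth j i hij.symm X hX Y hY

theorem proj_of_mem_𝔭 (D : IsIdealDecomposition C 𝔨ᵢ P) (i : Fin m) {X : 𝔤} (hX : X ∈ C.𝔭) : P i X = 0 :=
  (D.isOrthProj i).apply_eq_zero C fun _ hY => C.killing_𝔭_𝔨 hX (D.le i hY)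

theorem lie_eq_zero (D : IsIdealDecomposition C 𝔨ᵢ P) {i j : Fin m} (hij : i ≠ j) {X Y : 𝔤} (hX : X ∈ 𝔨ᵢ i) (hY : Y ∈ 𝔨ᵢ j) :
    ⁅X, Y⁆ = 0 := by
  have hj := D.lie_mem j X (D.le i hX) Y hY
  have hi : ⁅X, Y⁆ ∈ 𝔨ᵢ i := by
    rw [← lie_skew]
    exact (𝔨ᵢ i).neg_mem (D.lie_mem i Y (D.le j hY) X hX)
  exact C.eq_zero_of_killing_𝔨 (D.le i hi) (D.orth i j hij _ hi _ hj)

theorem Q_proj (D : IsIdealDecomposition C 𝔨ᵢ P) (i : Fin m) (X Y : 𝔤) : C.Q (P i X) Y = C.Q X (P i Y) :=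
  C.Q_isOrthProj (D.le i) (D.isOrthProj i) X Y

theorem trace_proj [FiniteDimensional ℝ 𝔤] (D : IsIdealDecomposition C 𝔨ᵢ P) (i : Fin m) :
    LinearMap.trace ℝ 𝔤 (P i) = (Module.finrank ℝ (𝔨ᵢ i) : ℝ) :=
  (D.isOrthProj i).isProj.trace

theorem finrank_𝔨 [FiniteDimensional ℝ 𝔤] (D : IsIdealDecomposition C 𝔨ᵢ P) : (Module.finrank ℝ C.𝔨 : ℝ) = ∑ i, (Module.finrank ℝ (𝔨ᵢ i) : ℝ) := by
  rw [← Finset.sum_congr rfl fun i _ => D.trace_proj i, ← map_sum, D.sum_eq]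
  exact C.isOrthProj_proj𝔨.isProj.trace.symm

theorem finrank_pos [FiniteDimensional ℝ 𝔤] (D : IsIdealDecomposition C 𝔨ᵢ P) (i : Fin m) : (0 : ℝ) < Module.finrank ℝ (𝔨ᵢ i) := by
  have : Nontrivial (𝔨ᵢ i) := Submodule.nontrivial_iff_ne_bot.2 (D.ne_bot i)
  exact_mod_cast Module.finrank_pos (R := ℝ) (M := 𝔨ᵢ i)

/-- The Killing form of `𝔨ᵢ` is the trace form of its action on itself inside `𝔤`. -/
theorem killingForm_eq [FiniteDimensional ℝ 𝔤] (D : IsIdealDecomposition C 𝔨ᵢ P) (i : Fin m) (X Y : 𝔨ᵢ i) :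
    killingForm ℝ (𝔨ᵢ i) X Y = weightedKilling (P i) (X : 𝔤) (Y : 𝔤) := by
  rw [weightedKilling_apply, ← LinearMap.trace_restrict_eq_of_forall_mem (𝔨ᵢ i).toSubmodule _
    (fun Z => by exact D.proj_mem i _), killingForm_apply_apply]
  congr 1
  ext Z
  exact (D.proj_of_mem (⁅X, ⁅Y, Z⁆⁆ : 𝔨ᵢ i).2).symm

theorem weightedKilling_proj_symm [FiniteDimensional ℝ 𝔤] (D : IsIdealDecomposition C 𝔨ᵢ P) (i : Fin m) (X Y : 𝔤) :
    weightedKilling (P i) X Y = weightedKilling (P i) Y X :=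
  weightedKilling_symm C (D.isOrthProj i).symm X Y

theorem weightedKilling_of_ne (D : IsIdealDecomposition C 𝔨ᵢ P) {i j : Fin m} (hij : i ≠ j) (X : 𝔤) {Y : 𝔤} (hY : Y ∈ 𝔨ᵢ j) :
    weightedKilling (P i) X Y = 0 := by
  rw [weightedKilling_apply, LinearMap.trace_mul_comm, mul_assoc]
  have : LieAlgebra.ad ℝ 𝔤 Y * P i = 0 :=
    LinearMap.ext fun Z => D.lie_eq_zero hij.symm hY (D.proj_mem i Z)
  rw [this, mul_zero, map_zero]

theorem weightedKilling_split (D : IsIdealDecomposition C 𝔨ᵢ P) (X Y : 𝔤) :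
    weightedKilling C.proj𝔭 X Y + ∑ i, weightedKilling (P i) X Y = killingForm ℝ 𝔤 X Y := by
  rw [← weightedKilling_one, ← C.proj_add_proj_eq_one, weightedKilling_add, ← D.sum_eq,
    weightedKilling_sum]
  simp

/-- On 𝔨ᵢ, B is the sum of the traces over 𝔭 and over 𝔨ᵢ, the other ideals being annihilated. The
latter trace accounts for the fraction κ. -/
theorem weightedKilling_proj𝔭 (D : IsIdealDecomposition C 𝔨ᵢ P) {i : Fin m} {κ : ℝ}
    (hκ : ∀ X ∈ 𝔨ᵢ i, ∀ Y ∈ 𝔨ᵢ i, weightedKilling (P i) X Y = κ * killingForm ℝ 𝔤 X Y)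
    {X Y : 𝔤} (hX : X ∈ 𝔨ᵢ i) (hY : Y ∈ 𝔨ᵢ i) :
    weightedKilling C.proj𝔭 X Y = (1 - κ) * killingForm ℝ 𝔤 X Y := by
  have h := D.weightedKilling_split X Y
  rw [Finset.sum_eq_single i, hκ X hX Y hY] at h
  · linarith
  · exact fun l _ hl => D.weightedKilling_of_ne hl _ hY
  · simp

end IsIdealDecomposition

end Invariants

/-! ### The constants κᵢ and the Casimir constants of 𝔨ᵢ on 𝔭. -/

section Constants

variable {𝔤 : Type*} [LieRing 𝔤] [LieAlgebra ℝ 𝔤] [FiniteDimensional ℝ 𝔤]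

/-- The constants `κᵢ` are well-defined. -/
theorem IsIdealList.weightedKilling_eq_kappa {C : CartanDecomposition 𝔤} {r s : ℕ}
    {𝔨ᵢ : Fin (r + s) → LieSubalgebra ℝ 𝔤} (h : IsIdealList C.𝔨 r s 𝔨ᵢ)
    {P : Fin (r + s) → Module.End ℝ 𝔤} (D : IsIdealDecomposition C 𝔨ᵢ P) (i : Fin (r + s))
    {X Y : 𝔤} (hX : X ∈ 𝔨ᵢ i) (hY : Y ∈ 𝔨ᵢ i) :
    weightedKilling (P i) X Y = kappa (𝔨ᵢ i) * killingForm ℝ 𝔤 X Y := by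
  -- `kappa` is an epsilon choice, so existence is all that is needed. It follows from Schur's lemma
  -- with the positive form -B if 𝔨ᵢ is simple, and the centre has constant 0.
  have hex : ∃ κ : ℝ, ∀ X Y : 𝔨ᵢ i,
      killingForm ℝ (𝔨ᵢ i) X Y = κ * killingForm ℝ 𝔤 (X : 𝔤) (Y : 𝔤) := by
    simp only [D.killingForm_eq i]
    refine Fin.addCases (fun i => ?_) (fun j => ?_) i
    · have hs : LieAlgebra.IsSimple ℝ (𝔨ᵢ (i.castAdd s)) :=
        ((h.isSimpleIdeal_iff _).2 ⟨i, rfl⟩).2.2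
      suffices hμ : ∃ μ : ℝ, ∀ X ∈ (𝔨ᵢ (i.castAdd s)).toSubmodule,
          ∀ Y ∈ (𝔨ᵢ (i.castAdd s)).toSubmodule,
          weightedKilling (P (i.castAdd s)) X Y = μ * (-killingForm ℝ 𝔤) X Y by
        obtain ⟨μ, hμ⟩ := hμ
        exact ⟨-μ, fun X Y => (hμ X X.2 Y Y.2).trans (by simp)⟩
      refine proportional_of_irreducible (𝔨ᵢ (i.castAdd s)).toSubmodule
        (LieAlgebra.ad ℝ 𝔤 '' {Z | Z ∈ 𝔨ᵢ (i.castAdd s)}) (-killingForm ℝ 𝔤)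
        (weightedKilling (P (i.castAdd s))) ?_ ?_ ?_ ?_ (D.weightedKilling_proj_symm _) ?_ ?_
      · rintro _ ⟨Z, hZ, rfl⟩ X hX
        exact (𝔨ᵢ (i.castAdd s)).lie_mem hZ hX
      · exact fun U hU hinv h0 => eq_of_isSimple hs hU
          (fun X hX Y hY => hinv _ ⟨X, hX, rfl⟩ Y hY) h0
      · intro X Y
        simp [killing_symm X Y]
      · intro X hX hX0
        simpa using C.neg X (D.le _ hX) hX0
      · rintro _ ⟨Z, hZ, rfl⟩ X hX Y hY
        simp only [LinearMap.neg_apply, LieAlgebra.ad_apply]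
        rw [killing_lie']
      · rintro _ ⟨Z, hZ, rfl⟩ X hX Y hY
        exact weightedKilling_lie _ Z X Y (D.commute _ (D.le _ hZ))
    · refine ⟨0, fun X Y => ?_⟩
      rw [← D.killingForm_eq, zero_mul, killingForm_apply_apply]
      have : LieAlgebra.ad ℝ (𝔨ᵢ (j.natAdd r)) Y = 0 := by
        refine LinearMap.ext fun Z => Subtype.ext ?_
        have hZ : (Z : 𝔤) ∈ centre C.𝔨 := h.eq_centre j ▸ Z.2
        exact (mem_centre.1 hZ).2 Y (D.le _ Y.2)
      rw [this, LinearMap.comp_zero, map_zero]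
  have := Classical.epsilon_spec hex ⟨X, hX⟩ ⟨Y, hY⟩
  exact (D.killingForm_eq i _ _).symm.trans this

namespace IsIdealDecomposition

variable {C : CartanDecomposition 𝔤} {m : ℕ} {𝔨ᵢ : Fin m → LieSubalgebra ℝ 𝔤}
  {P : Fin m → Module.End ℝ 𝔤}

theorem weightedKilling_proj𝔭_of_ne (D : IsIdealDecomposition C 𝔨ᵢ P) {i j : Fin m} (hij : i ≠ j)
    {X Y : 𝔤} (hX : X ∈ 𝔨ᵢ i) (hY : Y ∈ 𝔨ᵢ j) : weightedKilling C.proj𝔭 X Y = 0 := by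
  have h := D.weightedKilling_split X Y
  rw [Finset.sum_eq_zero, D.orth i j hij X hX Y hY, add_zero] at h
  · exact h
  · intro l _
    by_cases hl : l = j
    · rw [D.weightedKilling_proj_symm]
      exact D.weightedKilling_of_ne (hl ▸ hij.symm) _ hX
    · exact D.weightedKilling_of_ne hl _ hY

theorem kappa_nonneg (D : IsIdealDecomposition C 𝔨ᵢ P) {i : Fin m} {κ : ℝ}
    (hκ : ∀ X ∈ 𝔨ᵢ i, ∀ Y ∈ 𝔨ᵢ i, weightedKilling (P i) X Y = κ * killingForm ℝ 𝔤 X Y) :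
    0 ≤ κ := by
  obtain ⟨X, hX, hX0⟩ := (Submodule.ne_bot_iff _).1 (D.ne_bot i)
  have h := (weightedKilling_self_nonpos C (D.isOrthProj i) (D.Q_proj i) (D.le i hX)).1
  rw [hκ X hX X hX] at h
  have := C.neg X (D.le i hX) hX0
  by_contra hneg
  have := mul_pos_of_neg_of_neg (not_le.1 hneg) this
  linarith

/-- The remaining fraction 1 - κ measures the trace of (ad X)² over 𝔭, which is strictly negative
for X ≠ 0 because 𝔨 acts faithfully on 𝔭. -/
theorem kappa_lt_one [LieAlgebra.IsSimple ℝ 𝔤] (D : IsIdealDecomposition C 𝔨ᵢ P)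
    (hp : C.𝔭 ≠ ⊥) {i : Fin m} {κ : ℝ}
    (hκ : ∀ X ∈ 𝔨ᵢ i, ∀ Y ∈ 𝔨ᵢ i, weightedKilling (P i) X Y = κ * killingForm ℝ 𝔤 X Y) :
    κ < 1 := by
  obtain ⟨X, hX, hX0⟩ := (Submodule.ne_bot_iff _).1 (D.ne_bot i)
  obtain ⟨h, h'⟩ := weightedKilling_self_nonpos C C.isOrthProj_proj𝔭 C.Q_proj𝔭 (D.le i hX)
  have hlt : weightedKilling C.proj𝔭 X X < 0 :=
    lt_of_le_of_ne h fun h0 => hX0 (C.faithful hp (D.le i hX) (h' h0))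
  rw [D.weightedKilling_proj𝔭 hκ hX hX] at hlt
  have := C.neg X (D.le i hX) hX0
  by_contra hge
  have := mul_nonneg_of_nonpos_of_nonpos (sub_nonpos.2 (not_lt.1 hge)) this.le
  linarith

/-- Double counting: both sides equal the sum of B([e,f],[e,f]) over orthonormal e in 𝔭 and f in 𝔨ᵢ,
summed in the two possible orders. -/
theorem finrank_mul_casimir (D : IsIdealDecomposition C 𝔨ᵢ P) {i : Fin m} {κ μ : ℝ}
    (hκ : ∀ X ∈ 𝔨ᵢ i, ∀ Y ∈ 𝔨ᵢ i, weightedKilling (P i) X Y = κ * killingForm ℝ 𝔤 X Y)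
    (hμ : ∀ X ∈ C.𝔭, ∀ Y ∈ C.𝔭, weightedKilling (P i) X Y = μ * killingForm ℝ 𝔤 X Y) :
    μ * Module.finrank ℝ C.𝔭 = (1 - κ) * Module.finrank ℝ (𝔨ᵢ i) := by
  obtain ⟨b, hb⟩ := exists_orthonormal_basis C.Q C.Q_symm C.Q_pos
  have hL : μ * Module.finrank ℝ C.𝔭
      = ∑ a, ∑ c, killingForm ℝ 𝔤 ⁅C.proj𝔭 (b a), P i (b c)⁆ ⁅C.proj𝔭 (b a), P i (b c)⁆ := by
    rw [trace_orthProj_eq_sum C hb C.isOrthProj_proj𝔭 C.Q_proj𝔭, Finset.mul_sum]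
    refine Finset.sum_congr rfl fun a _ => ?_
    rw [C.Q_𝔭 (C.proj𝔭_mem _), ← hμ _ (C.proj𝔭_mem _) _ (C.proj𝔭_mem _),
      weightedKilling_eq_sum C hb (D.isOrthProj i) (D.Q_proj i)]
    refine Finset.sum_congr rfl fun c _ => ?_
    rw [C.Q_𝔨 (D.le i (D.proj_mem i _)), killing_lie']
  have hR : (1 - κ) * Module.finrank ℝ (𝔨ᵢ i)
      = ∑ c, ∑ a, killingForm ℝ 𝔤 ⁅C.proj𝔭 (b a), P i (b c)⁆ ⁅C.proj𝔭 (b a), P i (b c)⁆ := by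
    have := trace_orthProj_eq_sum C hb (D.isOrthProj i) (D.Q_proj i)
    change (Module.finrank ℝ (𝔨ᵢ i) : ℝ) = _ at this
    rw [this, Finset.mul_sum]
    refine Finset.sum_congr rfl fun c _ => ?_
    rw [C.Q_𝔨 (D.le i (D.proj_mem i _)), mul_neg,
      ← D.weightedKilling_proj𝔭 hκ (D.proj_mem i _) (D.proj_mem i _),
      weightedKilling_eq_sum C hb C.isOrthProj_proj𝔭 C.Q_proj𝔭, ← Finset.sum_neg_distrib]
    refine Finset.sum_congr rfl fun a _ => ?_
    rw [C.Q_𝔭 (C.proj𝔭_mem _), ← lie_skew (C.proj𝔭 (b a)), map_neg, map_neg,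
      LinearMap.neg_apply, neg_neg, killing_lie']
  rw [hL, hR, Finset.sum_comm]

theorem exists_casimir [LieAlgebra.IsSimple ℝ 𝔤] (D : IsIdealDecomposition C 𝔨ᵢ P) (i : Fin m) :
    ∃ μ : ℝ, ∀ X ∈ C.𝔭, ∀ Y ∈ C.𝔭, weightedKilling (P i) X Y = μ * killingForm ℝ 𝔤 X Y := by
  refine proportional_of_irreducible C.𝔭 (LieAlgebra.ad ℝ 𝔤 '' {Z | Z ∈ C.𝔨}) (killingForm ℝ 𝔤)
    (weightedKilling (P i)) ?_ ?_ killing_symm C.pos (D.weightedKilling_proj_symm i) ?_ ?_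
  · rintro _ ⟨Z, hZ, rfl⟩ X hX
    exact C.lie_𝔨_𝔭 hZ hX
  · exact fun U hU hinv h0 => C.𝔭_irreducible hU (fun Z hZ X hX => hinv _ ⟨Z, hZ, rfl⟩ X hX) h0
  · rintro _ ⟨Z, hZ, rfl⟩ X hX Y hY
    exact killing_lie' Z X Y
  · rintro _ ⟨Z, hZ, rfl⟩ X hX Y hY
    exact weightedKilling_lie _ Z X Y (D.commute _ hZ)

/-- `tr (Pᵢ ∘ ad X ∘ ad Y)` on `𝔭` in terms of the dimensions and `κᵢ`. -/
theorem weightedKilling_𝔭 [LieAlgebra.IsSimple ℝ 𝔤] (D : IsIdealDecomposition C 𝔨ᵢ P)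
    {i : Fin m} {κ : ℝ}
    (hκ : ∀ X ∈ 𝔨ᵢ i, ∀ Y ∈ 𝔨ᵢ i, weightedKilling (P i) X Y = κ * killingForm ℝ 𝔤 X Y)
    {X Y : 𝔤} (hX : X ∈ C.𝔭) (hY : Y ∈ C.𝔭) : weightedKilling (P i) X Y
      = (1 - κ) * Module.finrank ℝ (𝔨ᵢ i) / Module.finrank ℝ C.𝔭 * killingForm ℝ 𝔤 X Y := by
  obtain ⟨μ, hμ⟩ := D.exists_casimir i
  by_cases h0 : X = 0
  · simp [h0]
  have : Nontrivial C.𝔭 := ⟨⟨X, hX⟩, 0, by simpa using h0⟩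
  have hn : (0 : ℝ) < Module.finrank ℝ C.𝔭 := by
    exact_mod_cast Module.finrank_pos (R := ℝ) (M := C.𝔭)
  rw [hμ X hX Y hY, ← D.finrank_mul_casimir hκ hμ, mul_div_cancel_right₀ _ hn.ne']

end IsIdealDecomposition

namespace CartanDecomposition

/-- For X ∈ 𝔭, ad X interchanges 𝔭 and 𝔨. By cyclicity and symmetry the two parts of the Killing
trace then agree, so each is half. -/
theorem weightedKilling_proj𝔨_𝔭 (C : CartanDecomposition 𝔤) {X : 𝔤} (hX : X ∈ C.𝔭)
    (Y : 𝔤) : weightedKilling C.proj𝔨 X Y = killingForm ℝ 𝔤 X Y / 2 ∧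
      weightedKilling C.proj𝔭 X Y = killingForm ℝ 𝔤 X Y / 2 := by
  have hsum : weightedKilling C.proj𝔭 X Y + weightedKilling C.proj𝔨 X Y
      = killingForm ℝ 𝔤 X Y := by
    rw [← weightedKilling_one, ← C.proj_add_proj_eq_one, weightedKilling_add]
    rfl
  have hcomm : C.proj𝔭 * LieAlgebra.ad ℝ 𝔤 X = LieAlgebra.ad ℝ 𝔤 X * C.proj𝔨 := by
    refine LinearMap.ext fun Z => ?_
    simp only [Module.End.mul_apply, LieAlgebra.ad_apply]
    nth_rw 1 [← C.proj_add_proj Z]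
    rw [lie_add, map_add, C.proj𝔭_of_mem_𝔨 (C.lie_𝔭_𝔭 hX (C.proj𝔭_mem Z)),
      C.proj𝔭_of_mem (C.lie_𝔭_𝔨 hX (C.proj𝔨_mem Z)), zero_add]
  have heq : weightedKilling C.proj𝔭 X Y = weightedKilling C.proj𝔨 X Y := by
    rw [weightedKilling_symm C C.isOrthProj_proj𝔨.symm, weightedKilling_apply, ← mul_assoc, hcomm,
      mul_assoc, LinearMap.trace_mul_comm, weightedKilling_apply, mul_assoc]
  constructor <;> linarith

end CartanDecomposition

/-- The Casimir constants of the 𝔨ᵢ on 𝔭 add up to 1/2, since together they give the 𝔨-half of B on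
𝔭. This enters the argument for (B). -/
theorem IsIdealDecomposition.sum_casimir [LieAlgebra.IsSimple ℝ 𝔤] {C : CartanDecomposition 𝔤}
    {m : ℕ} {𝔨ᵢ : Fin m → LieSubalgebra ℝ 𝔤} {P : Fin m → Module.End ℝ 𝔤}
    (D : IsIdealDecomposition C 𝔨ᵢ P) (hp : C.𝔭 ≠ ⊥) {κ : Fin m → ℝ}
    (hκ : ∀ i, ∀ X ∈ 𝔨ᵢ i, ∀ Y ∈ 𝔨ᵢ i,
      weightedKilling (P i) X Y = κ i * killingForm ℝ 𝔤 X Y) :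
    ∑ i, (Module.finrank ℝ (𝔨ᵢ i) : ℝ) * (1 - κ i) = Module.finrank ℝ C.𝔭 / 2 := by
  obtain ⟨X, hX, hX0⟩ := (Submodule.ne_bot_iff _).1 hp
  have : Nontrivial C.𝔭 := Submodule.nontrivial_iff_ne_bot.2 hp
  have hn : (0 : ℝ) < Module.finrank ℝ C.𝔭 := by
    exact_mod_cast Module.finrank_pos (R := ℝ) (M := C.𝔭)
  have h := (C.weightedKilling_proj𝔨_𝔭 hX X).1
  have hB := C.pos X hX hX0
  rw [← D.sum_eq, weightedKilling_sum, LinearMap.sum_apply, LinearMap.sum_apply,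
    Finset.sum_congr rfl fun i _ => D.weightedKilling_𝔭 (hκ i) hX hX, ← Finset.sum_mul,
    ← Finset.sum_div, div_eq_mul_inv (killingForm ℝ 𝔤 X X), mul_comm (killingForm ℝ 𝔤 X X)] at h
  have h' := mul_right_cancel₀ hB.ne' h
  rw [div_eq_iff hn.ne'] at h'
  rw [Finset.sum_congr rfl fun i _ => mul_comm _ (1 - κ i), h']
  ring

end Constants

/-! ### Diagonal metrics and their natural reductivity. -/

section DiagonalMetric

variable {𝔤 : Type*} [LieRing 𝔤] [LieAlgebra ℝ 𝔤]

/-- The endomorphism `x₁ P₁ + ⋯ + xₘ Pₘ`. -/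
def multiplier {m : ℕ} (P : Fin m → Module.End ℝ 𝔤) (x : Fin m → ℝ) : Module.End ℝ 𝔤 :=
  ∑ i, x i • P i

theorem multiplier_apply {m : ℕ} (P : Fin m → Module.End ℝ 𝔤) (x : Fin m → ℝ) (X : 𝔤) :
    multiplier P x X = ∑ i, x i • P i X := by
  simp [multiplier, LinearMap.sum_apply]

namespace IsIdealDecomposition

variable {C : CartanDecomposition 𝔤} {m : ℕ} {𝔨ᵢ : Fin m → LieSubalgebra ℝ 𝔤}
  {P : Fin m → Module.End ℝ 𝔤}

theorem multiplier_mem (D : IsIdealDecomposition C 𝔨ᵢ P) (x : Fin m → ℝ) (X : 𝔤) :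
    multiplier P x X ∈ C.𝔨 := by
  rw [multiplier_apply]
  exact sum_mem fun i _ => C.𝔨.smul_mem _ (D.le i (D.proj_mem i X))

theorem multiplier_𝔭 (D : IsIdealDecomposition C 𝔨ᵢ P) (x : Fin m → ℝ) {X : 𝔤} (hX : X ∈ C.𝔭) :
    multiplier P x X = 0 := by
  rw [multiplier_apply]
  exact Finset.sum_eq_zero fun i _ => by rw [D.proj_of_mem_𝔭 i hX, smul_zero]

theorem multiplier_of_mem (D : IsIdealDecomposition C 𝔨ᵢ P) (x : Fin m → ℝ) {i : Fin m} {X : 𝔤}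
    (hX : X ∈ 𝔨ᵢ i) : multiplier P x X = x i • X := by
  rw [multiplier_apply, Finset.sum_eq_single i, D.proj_of_mem hX]
  · exact fun j _ hj => by rw [D.proj_of_mem_ne hj hX, smul_zero]
  · simp

theorem multiplier_symm (D : IsIdealDecomposition C 𝔨ᵢ P) (x : Fin m → ℝ) (X Y : 𝔤) :
    killingForm ℝ 𝔤 (multiplier P x X) Y = killingForm ℝ 𝔤 X (multiplier P x Y) := by
  simp [multiplier_apply, LinearMap.sum_apply, (D.isOrthProj _).symm]

theorem multiplier_lie (D : IsIdealDecomposition C 𝔨ᵢ P) (x : Fin m → ℝ) {Z : 𝔤} (hZ : Z ∈ C.𝔨)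
    (X : 𝔤) : multiplier P x ⁅Z, X⁆ = ⁅Z, multiplier P x X⁆ := by
  simp only [multiplier_apply, lie_sum, lie_smul]
  exact Finset.sum_congr rfl fun i _ =>
    congrArg _ (LinearMap.congr_fun (D.commute i hZ).eq X)

theorem lie_multiplier (D : IsIdealDecomposition C 𝔨ᵢ P) (x : Fin m → ℝ) (X : 𝔤) {Z : 𝔤}
    (hZ : Z ∈ C.𝔨) : ⁅multiplier P x X, Z⁆ = multiplier P x ⁅X, Z⁆ := by
  rw [← lie_skew, ← D.multiplier_lie x hZ, ← lie_skew X Z, map_neg]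

theorem sum_proj_apply (D : IsIdealDecomposition C 𝔨ᵢ P) (X : 𝔤) :
    ∑ i, P i X = C.proj𝔨 X := by
  rw [← D.sum_eq, LinearMap.sum_apply]

/-- The inner product `Q|_𝔭 + x₁ Q|_𝔨₁ + ⋯ + xₘ Q|_𝔨ₘ`. -/
noncomputable def metric (D : IsIdealDecomposition C 𝔨ᵢ P) (x : Fin m → ℝ) (hx : ∀ i, 0 < x i) :
    LeftInvariantMetric 𝔤 where
  -- B precomposed with Φ = proj𝔭 - M; the minus sign turns B into Q on 𝔨. Writing the metric
  -- through B makes the ad-invariance of B available in all later computations.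
  form := killingForm ℝ 𝔤 ∘ₗ (C.proj𝔭 - multiplier P x)
  symm X Y := by
    simp only [LinearMap.comp_apply, LinearMap.sub_apply, map_sub]
    rw [C.isOrthProj_proj𝔭.symm, D.multiplier_symm, killing_symm X, killing_symm X]
  pos X hX := by
    simp only [LinearMap.comp_apply, LinearMap.sub_apply, map_sub]
    have hp : killingForm ℝ 𝔤 (C.proj𝔭 X) X = killingForm ℝ 𝔤 (C.proj𝔭 X) (C.proj𝔭 X) := by
      rw [← C.isOrthProj_proj𝔭.symm, C.proj𝔭_of_mem (C.proj𝔭_mem X)]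
    have hk : killingForm ℝ 𝔤 (multiplier P x X) X
        = ∑ i, x i * killingForm ℝ 𝔤 (P i X) (P i X) := by
      rw [multiplier_apply, map_sum, LinearMap.sum_apply]
      refine Finset.sum_congr rfl fun i _ => ?_
      rw [map_smul, LinearMap.smul_apply, smul_eq_mul, ← (D.isOrthProj i).symm,
        D.proj_of_mem (D.proj_mem i X)]
    have hp0 : 0 ≤ killingForm ℝ 𝔤 (C.proj𝔭 X) (C.proj𝔭 X) := by
      rw [← C.Q_𝔭 (C.proj𝔭_mem X)]
      exact C.Q_self_nonneg _
    have hi0 (i) : x i * killingForm ℝ 𝔤 (P i X) (P i X) ≤ 0 := by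
      rw [← neg_nonneg, ← mul_neg, ← C.Q_𝔨 (D.le i (D.proj_mem i X))]
      exact mul_nonneg (hx i).le (C.Q_self_nonneg _)
    have hs0 := Finset.sum_nonpos fun i (_ : i ∈ Finset.univ) => hi0 i
    rw [hp, hk]
    by_contra hle
    have hpz : C.proj𝔭 X = 0 := C.eq_zero_of_killing_𝔭 (C.proj𝔭_mem X) (by linarith)
    have hsz : ∑ i, x i * killingForm ℝ 𝔤 (P i X) (P i X) = 0 := by linarith
    rw [Finset.sum_eq_zero_iff_of_nonpos fun i _ => hi0 i] at hsz
    have hiz (i) : P i X = 0 := by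
      refine C.eq_zero_of_killing_𝔨 (D.le i (D.proj_mem i X)) ?_
      exact (mul_eq_zero.1 (hsz i (Finset.mem_univ i))).resolve_left (hx i).ne'
    refine hX ?_
    rw [← C.proj_add_proj X, hpz, ← D.sum_proj_apply]
    simp [hiz]

theorem metric_form (D : IsIdealDecomposition C 𝔨ᵢ P) {x : Fin m → ℝ} (hx : ∀ i, 0 < x i)
    (X Y : 𝔤) : (D.metric x hx).form X Y
      = killingForm ℝ 𝔤 (C.proj𝔭 X) Y - killingForm ℝ 𝔤 (multiplier P x X) Y := by
  simp [metric]

theorem metric_form_𝔭 (D : IsIdealDecomposition C 𝔨ᵢ P) {x : Fin m → ℝ} (hx : ∀ i, 0 < x i)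
    {X : 𝔤} (hX : X ∈ C.𝔭) (Y : 𝔤) : (D.metric x hx).form X Y = killingForm ℝ 𝔤 X Y := by
  rw [metric_form, C.proj𝔭_of_mem hX, D.multiplier_𝔭 x hX]
  simp

theorem metric_form_𝔨 (D : IsIdealDecomposition C 𝔨ᵢ P) {x : Fin m → ℝ} (hx : ∀ i, 0 < x i)
    {X : 𝔤} (hX : X ∈ C.𝔨) (Y : 𝔤) :
    (D.metric x hx).form X Y = - killingForm ℝ 𝔤 (multiplier P x X) Y := by
  rw [metric_form, C.proj𝔭_of_mem_𝔨 hX]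
  simp

/-- The diagonal metrics are naturally reductive. -/
theorem metric_mem (D : IsIdealDecomposition C 𝔨ᵢ P) {x : Fin m → ℝ} (hx : ∀ i, 0 < x i) :
    D.metric x hx ∈ naturallyReductiveMetrics C.𝔨 := by
  set M := multiplier P x with hM
  have hMk (X : 𝔤) : M X ∈ C.𝔨 := D.multiplier_mem x X
  refine ⟨fun Z hZ X Y => ?_, ?_⟩
  · have hcomm : C.proj𝔭 ⁅Z, X⁆ = ⁅Z, C.proj𝔭 X⁆ := LinearMap.congr_fun
      (C.isOrthProj_proj𝔭.commute C (Z := Z) fun W hW => C.lie_𝔨_𝔭 hZ hW).eq X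
    rw [D.metric_form, D.metric_form, hcomm, D.multiplier_lie x hZ, killing_lie', killing_lie']
    ring
  -- The section of the orbit map sending X ∈ 𝔭 to (X, 0) and X ∈ 𝔨ᵢ to (-xᵢX, -(1+xᵢ)X). Its range
  -- is the complement of the isotropy algebra orthogonal for the invariant form B on 𝔤 and
  -- -xᵢ/(1+xᵢ)·B on each 𝔨ᵢ, a form that restricts to the given metric there.
  let φ : 𝔤 →ₗ[ℝ] 𝔤 × C.𝔨 := LinearMap.prod (C.proj𝔭 - M)
    (LinearMap.codRestrict C.𝔨.toSubmodule (-(M + C.proj𝔨))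
      fun X => C.𝔨.neg_mem (C.𝔨.add_mem (hMk X) (C.proj𝔨_mem X)))
  have hφ1 (X : 𝔤) : (φ X).1 = C.proj𝔭 X - M X := rfl
  have hφ2 (X : 𝔤) : ((φ X).2 : 𝔤) = -(M X + C.proj𝔨 X) := rfl
  have horb (u : 𝔤 × C.𝔨) : orbitMap C.𝔨 u = u.1 - u.2 := rfl
  have hiso (X : 𝔤) : orbitMap C.𝔨 (φ X) = X := by
    rw [horb, hφ1, hφ2]
    nth_rw 5 [← C.proj_add_proj X]
    abel
  refine ⟨LinearMap.range φ, ⟨?_, ?_⟩, ?_, ?_⟩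
  · rw [Submodule.disjoint_def]
    rintro _ ⟨Z, rfl⟩ ⟨X, hX⟩
    have h0 : X = 0 := by
      rw [← hiso X, hX, horb]
      exact sub_self _
    rw [← hX, h0, map_zero]
  · rw [codisjoint_iff, eq_top_iff]
    intro u _
    rw [Submodule.mem_sup]
    refine ⟨u - φ (orbitMap C.𝔨 u), ?_, _, ⟨_, rfl⟩, sub_add_cancel _ _⟩
    refine ⟨(u - φ (orbitMap C.𝔨 u)).2, Prod.ext ?_ rfl⟩
    have : orbitMap C.𝔨 (u - φ (orbitMap C.𝔨 u)) = 0 := by rw [map_sub, hiso, sub_self]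
    rw [horb] at this
    exact (sub_eq_zero.1 this).symm
  · rintro _ ⟨Z, rfl⟩ _ ⟨X, rfl⟩
    refine ⟨⁅(Z : 𝔤), X⁆, Prod.ext ?_ (Subtype.ext ?_)⟩
    · have hcomm : C.proj𝔭 ⁅(Z : 𝔤), X⁆ = ⁅(Z : 𝔤), C.proj𝔭 X⁆ := LinearMap.congr_fun
        (C.isOrthProj_proj𝔭.commute C (Z := Z) fun W hW => C.lie_𝔨_𝔭 Z.2 hW).eq X
      rw [hφ1, hcomm, D.multiplier_lie x Z.2]
      exact (lie_sub _ _ _).symm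
    · have hcomm : C.proj𝔨 ⁅(Z : 𝔤), X⁆ = ⁅(Z : 𝔤), C.proj𝔨 X⁆ := LinearMap.congr_fun
        (C.isOrthProj_proj𝔨.commute C (Z := Z) fun W hW => C.lie_𝔨_𝔨 Z.2 hW).eq X
      rw [hφ2, hcomm, D.multiplier_lie x Z.2, ← lie_add, ← lie_neg]
      rfl
  · rintro _ ⟨U, rfl⟩ _ ⟨V, rfl⟩ _ ⟨W, rfl⟩
    have hlie (V : 𝔤) : orbitMap C.𝔨 ⁅φ U, φ V⁆
        = ⁅C.proj𝔭 U - M U, C.proj𝔭 V - M V⁆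
          - ⁅M U + C.proj𝔨 U, M V + C.proj𝔨 V⁆ := by
      rw [horb]
      change ⁅(φ U).1, (φ V).1⁆ - ⁅((φ U).2 : 𝔤), ((φ V).2 : 𝔤)⁆ = _
      rw [hφ1, hφ1, hφ2, hφ2, neg_lie, lie_neg, neg_neg]
    rw [hiso, hiso, hlie, hlie, (D.metric x hx).symm V]
    have hMp {X : 𝔤} (hX : X ∈ C.𝔭) : M X = 0 := D.multiplier_𝔭 x hX
    have hsymm (X Y : 𝔤) : killingForm ℝ 𝔤 (M X) Y = killingForm ℝ 𝔤 X (M Y) :=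
      D.multiplier_symm x X Y
    have hUk := C.proj𝔨_mem U
    have hUp := C.proj𝔭_mem U
    have hlieM (V : 𝔤) : ⁅C.proj𝔨 U, M V⁆ = M ⁅C.proj𝔨 U, C.proj𝔨 V⁆ := by
      rw [← D.multiplier_lie x hUk V]
      nth_rw 1 [← C.proj_add_proj V]
      rw [lie_add, map_add, hMp (C.lie_𝔨_𝔭 hUk (C.proj𝔭_mem V)), zero_add]
    have hsplit (V : 𝔤) : ⁅C.proj𝔭 U - M U, C.proj𝔭 V - M V⁆ - ⁅M U + C.proj𝔨 U, M V + C.proj𝔨 V⁆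
        = -(⁅C.proj𝔭 U, M V⁆ + ⁅M U, C.proj𝔭 V⁆) + (⁅C.proj𝔭 U, C.proj𝔭 V⁆
          - (M ⁅C.proj𝔨 U, C.proj𝔨 V⁆ + M ⁅C.proj𝔨 U, C.proj𝔨 V⁆ + ⁅C.proj𝔨 U, C.proj𝔨 V⁆)) := by
      have e1 : ⁅M U, C.proj𝔨 V⁆ = M ⁅C.proj𝔨 U, C.proj𝔨 V⁆ := by
        rw [D.lie_multiplier x U (C.proj𝔨_mem V)]
        nth_rw 1 [← C.proj_add_proj U]
        rw [add_lie, map_add, hMp (C.lie_𝔭_𝔨 hUp (C.proj𝔨_mem V)), zero_add]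
      simp only [lie_sub, sub_lie, lie_add, add_lie, e1, hlieM]
      abel
    -- An expansion whose terms are skew under V ↔ W: the first two exchange, and the others change
    -- sign by `s1`, `s2`, `s3`.
    have hform (V W : 𝔤) : (D.metric x hx).form
          (⁅C.proj𝔭 U - M U, C.proj𝔭 V - M V⁆ - ⁅M U + C.proj𝔨 U, M V + C.proj𝔨 V⁆) W
        = killingForm ℝ 𝔤 (M V) ⁅C.proj𝔭 U, C.proj𝔭 W⁆
          - killingForm ℝ 𝔤 (M W) ⁅C.proj𝔭 U, C.proj𝔭 V⁆
          - killingForm ℝ 𝔤 ⁅M U, C.proj𝔭 V⁆ (C.proj𝔭 W)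
          + 2 * killingForm ℝ 𝔤 ⁅C.proj𝔨 U, M V⁆ (M W)
          + killingForm ℝ 𝔤 ⁅C.proj𝔨 U, M V⁆ (C.proj𝔨 W) := by
      have hp1 := C.lie_𝔭_𝔨 hUp (hMk V)
      have hp2 := C.lie_𝔨_𝔭 (hMk U) (C.proj𝔭_mem V)
      have hk1 := C.lie_𝔭_𝔭 hUp (C.proj𝔭_mem V)
      have hk2 := C.lie_𝔨_𝔨 hUk (C.proj𝔨_mem V)
      have hW : W = C.proj𝔭 W + C.proj𝔨 W := (C.proj_add_proj W).symm
      have t1 : killingForm ℝ 𝔤 ⁅C.proj𝔭 U, M V⁆ W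
          = - killingForm ℝ 𝔤 (M V) ⁅C.proj𝔭 U, C.proj𝔭 W⁆ := by
        rw [killing_lie', hW, lie_add, map_add,
          C.killing_𝔨_𝔭 (hMk V) (C.lie_𝔭_𝔨 hUp (C.proj𝔨_mem W)), add_zero, ← hW]
      have t2 : killingForm ℝ 𝔤 ⁅M U, C.proj𝔭 V⁆ W
          = killingForm ℝ 𝔤 ⁅M U, C.proj𝔭 V⁆ (C.proj𝔭 W) := by
        nth_rw 1 [hW]
        rw [map_add, C.killing_𝔭_𝔨 hp2 (C.proj𝔨_mem W), add_zero]
      have t3 : killingForm ℝ 𝔤 ⁅C.proj𝔨 U, M V⁆ W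
          = killingForm ℝ 𝔤 ⁅C.proj𝔨 U, M V⁆ (C.proj𝔨 W) := by
        nth_rw 1 [hW]
        rw [map_add, C.killing_𝔨_𝔭 (C.lie_𝔨_𝔨 hUk (hMk V)) (C.proj𝔭_mem W), zero_add]
      rw [hsplit, map_add, LinearMap.add_apply,
        D.metric_form_𝔭 hx (C.𝔭.neg_mem (C.𝔭.add_mem hp1 hp2)),
        D.metric_form_𝔨 hx (C.𝔨.sub_mem hk1 (C.𝔨.add_mem (C.𝔨.add_mem (hMk _) (hMk _)) hk2))]
      simp only [map_sub, map_add, map_neg, LinearMap.neg_apply, LinearMap.add_apply,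
        LinearMap.sub_apply, ← hM, ← hlieM]
      rw [hsymm ⁅C.proj𝔭 U, C.proj𝔭 V⁆, hsymm ⁅C.proj𝔨 U, M V⁆, t1, t2, t3,
        killing_symm (M W) ⁅C.proj𝔭 U, C.proj𝔭 V⁆]
      ring
    rw [hform V W, hform W V]
    have s1 : killingForm ℝ 𝔤 ⁅M U, C.proj𝔭 V⁆ (C.proj𝔭 W)
        = - killingForm ℝ 𝔤 ⁅M U, C.proj𝔭 W⁆ (C.proj𝔭 V) := by
      rw [killing_lie', killing_symm]
    have s2 : killingForm ℝ 𝔤 ⁅C.proj𝔨 U, M V⁆ (M W)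
        = - killingForm ℝ 𝔤 ⁅C.proj𝔨 U, M W⁆ (M V) := by
      rw [killing_lie', killing_symm]
    have s3 : killingForm ℝ 𝔤 ⁅C.proj𝔨 U, M V⁆ (C.proj𝔨 W)
        = - killingForm ℝ 𝔤 ⁅C.proj𝔨 U, M W⁆ (C.proj𝔨 V) := by
      rw [killing_lie', hsymm, ← hlieM, killing_symm]
      nth_rw 1 [← C.proj_add_proj V]
      rw [map_add, C.killing_𝔨_𝔭 (C.lie_𝔨_𝔨 hUk (hMk W)) (C.proj𝔭_mem V), zero_add]
    rw [s1, s2, s3]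
    ring

theorem sub_multiplier_𝔭 (D : IsIdealDecomposition C 𝔨ᵢ P) (x : Fin m → ℝ) {X : 𝔤}
    (hX : X ∈ C.𝔭) : C.proj𝔭 X - multiplier P x X = X := by
  rw [C.proj𝔭_of_mem hX, D.multiplier_𝔭 x hX, sub_zero]

theorem sub_multiplier_𝔨 (x : Fin m → ℝ) {X : 𝔤}
    (hX : X ∈ C.𝔨) : C.proj𝔭 X - multiplier P x X = -multiplier P x X := by
  rw [C.proj𝔭_of_mem_𝔨 hX, zero_sub]

theorem ext_of_isDiagonal (D : IsIdealDecomposition C 𝔨ᵢ P) {h h' : LinearMap.BilinForm ℝ 𝔤}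
    {γ : ℝ} {γᵢ : Fin m → ℝ} (hh : IsDiagonal C 𝔨ᵢ h γ γᵢ) (hh' : IsDiagonal C 𝔨ᵢ h' γ γᵢ) :
    h = h' := by
  refine LinearMap.ext fun X => LinearMap.ext fun Y => ?_
  rw [← C.proj_add_proj X, ← C.proj_add_proj Y, ← D.sum_proj_apply, ← D.sum_proj_apply]
  have hX := C.proj𝔭_mem X
  have hY := C.proj𝔭_mem Y
  have hXi (i) := D.proj_mem i X
  have hYi (i) := D.proj_mem i Y
  simp only [map_add, map_sum, LinearMap.add_apply, LinearMap.sum_apply]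
  rw [hh.on_𝔭 _ hX _ hY, hh'.on_𝔭 _ hX _ hY]
  congr 1
  · congr 1
    exact Finset.sum_congr rfl fun i _ => by
      rw [(hh.𝔭_𝔨 i _ hY _ (hXi i)).2, (hh'.𝔭_𝔨 i _ hY _ (hXi i)).2]
  · refine Finset.sum_congr rfl fun j _ => ?_
    rw [(hh.𝔭_𝔨 j _ hX _ (hYi j)).1, (hh'.𝔭_𝔨 j _ hX _ (hYi j)).1]
    congr 1
    refine Finset.sum_congr rfl fun i _ => ?_
    by_cases hij : i = j
    · subst hij
      rw [hh.on_𝔨 i _ (hXi i) _ (hYi i), hh'.on_𝔨 i _ (hXi i) _ (hYi i)]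
    · rw [hh.𝔨_𝔨 i j hij _ (hXi i) _ (hYi j), hh'.𝔨_𝔨 i j hij _ (hXi i) _ (hYi j)]

end IsIdealDecomposition

end DiagonalMetric

/-! ### Levi-Civita connection and Ricci curvature of diagonal metrics. -/

section Ricci

variable {𝔤 : Type*} [LieRing 𝔤] [LieAlgebra ℝ 𝔤]

theorem CartanDecomposition.trace_eq (C : CartanDecomposition 𝔤) {A A₁ A₂ : Module.End ℝ 𝔤}
    (h₁ : ∀ X ∈ C.𝔭, A X = A₁ X) (h₂ : ∀ X ∈ C.𝔨, A X = A₂ X) :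
    LinearMap.trace ℝ 𝔤 A
      = LinearMap.trace ℝ 𝔤 (C.proj𝔭 * A₁) + LinearMap.trace ℝ 𝔤 (C.proj𝔨 * A₂) := by
  have : A = A₁ * C.proj𝔭 + A₂ * C.proj𝔨 := by
    refine LinearMap.ext fun X => ?_
    nth_rw 1 [← C.proj_add_proj X]
    rw [map_add, h₁ _ (C.proj𝔭_mem X), h₂ _ (C.proj𝔨_mem X)]
    rfl
  rw [this, map_add, LinearMap.trace_mul_comm _ A₁, LinearMap.trace_mul_comm _ A₂]

theorem CartanDecomposition.trace_eq_zero (C : CartanDecomposition 𝔤) {A : Module.End ℝ 𝔤}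
    (h₁ : ∀ X ∈ C.𝔭, A X ∈ C.𝔨) (h₂ : ∀ X ∈ C.𝔨, A X ∈ C.𝔭) : LinearMap.trace ℝ 𝔤 A = 0 := by
  rw [C.trace_eq (A := A) (A₁ := C.proj𝔨 * A) (A₂ := C.proj𝔭 * A)
    (fun X hX => (C.proj𝔨_of_mem (h₁ X hX)).symm) (fun X hX => (C.proj𝔭_of_mem (h₂ X hX)).symm),
    ← mul_assoc, ← mul_assoc]
  have e₁ : C.proj𝔭 * C.proj𝔨 = 0 := LinearMap.ext fun X => C.proj𝔭_of_mem_𝔨 (C.proj𝔨_mem X)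
  have e₂ : C.proj𝔨 * C.proj𝔭 = 0 := LinearMap.ext fun X => C.proj𝔨_of_mem_𝔭 (C.proj𝔭_mem X)
  simp [e₁, e₂]

variable [FiniteDimensional ℝ 𝔤]

namespace IsIdealDecomposition

variable {C : CartanDecomposition 𝔤} {m : ℕ} {𝔨ᵢ : Fin m → LieSubalgebra ℝ 𝔤}
  {P : Fin m → Module.End ℝ 𝔤}

/-- With g = B(Φ·,·), ad-invariance of B turns the Koszul formula into 2Φ(∇_X Y) = Φ[X,Y] - [ΦX,Y] +
[X,ΦY]. The values of Φ are separate arguments so that each type of vector can supply its simplified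
form. -/
theorem nabla_eq (D : IsIdealDecomposition C 𝔨ᵢ P) {x : Fin m → ℝ} (hx : ∀ i, 0 < x i)
    {X Y W ΦX ΦY ΦW ΦXY : 𝔤} (hX : C.proj𝔭 X - multiplier P x X = ΦX)
    (hY : C.proj𝔭 Y - multiplier P x Y = ΦY) (hW : C.proj𝔭 W - multiplier P x W = ΦW)
    (hXY : C.proj𝔭 ⁅X, Y⁆ - multiplier P x ⁅X, Y⁆ = ΦXY)
    (h : (2 : ℝ) • ΦW = ΦXY - ⁅ΦX, Y⁆ + ⁅X, ΦY⁆) : (D.metric x hx).nabla X Y = W := by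
  set g := D.metric x hx
  have hform (A B : 𝔤) : g.form A B = killingForm ℝ 𝔤 (C.proj𝔭 A - multiplier P x A) B := rfl
  rw [← sub_eq_zero]
  by_contra h0
  refine (g.pos _ h0).ne' ?_
  set Z := g.nabla X Y - W with hZ
  have e : g.form Z Z = g.form (g.nabla X Y) Z - g.form W Z := by
    rw [← LinearMap.sub_apply, ← map_sub]
  clear_value Z
  have h₁ := g.form_nabla X Y Z
  have h₂ : 2 * g.form W Z = killingForm ℝ 𝔤 (ΦXY - ⁅ΦX, Y⁆ + ⁅X, ΦY⁆) Z := by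
    rw [hform, hW, ← h, map_smul, LinearMap.smul_apply, smul_eq_mul]
  rw [g.symm ⁅Y, Z⁆, g.symm ⁅Z, X⁆, hform ⁅X, Y⁆, hform X, hform Y,
    hX, hY, hXY] at h₁
  have e₃ : killingForm ℝ 𝔤 ⁅X, ΦY⁆ Z = killingForm ℝ 𝔤 ΦY ⁅Z, X⁆ := by
    rw [killing_lie', ← lie_skew X Z, map_neg, neg_neg]
  rw [map_add, map_sub, LinearMap.add_apply, LinearMap.sub_apply, killing_lie ΦX, e₃] at h₂
  linarith

theorem nabla_𝔭_𝔭 (D : IsIdealDecomposition C 𝔨ᵢ P) {x : Fin m → ℝ} (hx : ∀ i, 0 < x i)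
    {X Y : 𝔤} (hX : X ∈ C.𝔭) (hY : Y ∈ C.𝔭) :
    (D.metric x hx).nabla X Y = (1 / 2 : ℝ) • ⁅X, Y⁆ := by
  have hk := C.lie_𝔭_𝔭 hX hY
  refine D.nabla_eq hx (D.sub_multiplier_𝔭 x hX) (D.sub_multiplier_𝔭 x hY)
    (sub_multiplier_𝔨 x (C.𝔨.smul_mem _ hk)) (sub_multiplier_𝔨 x hk) ?_
  rw [map_smul, smul_neg, smul_smul]
  norm_num

theorem nabla_𝔨_𝔨 (D : IsIdealDecomposition C 𝔨ᵢ P) {x : Fin m → ℝ} (hx : ∀ i, 0 < x i)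
    {X Y : 𝔤} (hX : X ∈ C.𝔨) (hY : Y ∈ C.𝔨) :
    (D.metric x hx).nabla X Y = (1 / 2 : ℝ) • ⁅X, Y⁆ := by
  have hk := C.lie_𝔨_𝔨 hX hY
  refine D.nabla_eq hx (sub_multiplier_𝔨 x hX) (sub_multiplier_𝔨 x hY)
    (sub_multiplier_𝔨 x (C.𝔨.smul_mem _ hk)) (sub_multiplier_𝔨 x hk) ?_
  rw [map_smul, smul_neg, smul_smul, neg_lie, lie_neg, D.lie_multiplier x X hY,
    ← D.multiplier_lie x hX]
  norm_num

theorem nabla_𝔨_𝔭 (D : IsIdealDecomposition C 𝔨ᵢ P) {x : Fin m → ℝ} (hx : ∀ i, 0 < x i)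
    {X Y : 𝔤} (hX : X ∈ C.𝔨) (hY : Y ∈ C.𝔭) : (D.metric x hx).nabla X Y
      = ⁅X, Y⁆ + (1 / 2 : ℝ) • ⁅multiplier P x X, Y⁆ := by
  have hp := C.lie_𝔨_𝔭 hX hY
  have hp' := C.lie_𝔨_𝔭 (D.multiplier_mem x X) hY
  refine D.nabla_eq hx (sub_multiplier_𝔨 x hX) (D.sub_multiplier_𝔭 x hY)
    (D.sub_multiplier_𝔭 x (add_mem hp (C.𝔭.smul_mem _ hp'))) (D.sub_multiplier_𝔭 x hp) ?_
  rw [neg_lie]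
  module

theorem nabla_𝔭_𝔨 (D : IsIdealDecomposition C 𝔨ᵢ P) {x : Fin m → ℝ} (hx : ∀ i, 0 < x i)
    {X Y : 𝔤} (hX : X ∈ C.𝔭) (hY : Y ∈ C.𝔨) : (D.metric x hx).nabla X Y
      = (-(1 / 2) : ℝ) • ⁅X, multiplier P x Y⁆ := by
  have hp := C.lie_𝔭_𝔨 hX hY
  have hp' := C.lie_𝔭_𝔨 hX (D.multiplier_mem x Y)
  refine D.nabla_eq hx (D.sub_multiplier_𝔭 x hX) (sub_multiplier_𝔨 x hY)
    (D.sub_multiplier_𝔭 x (C.𝔭.smul_mem _ hp')) (D.sub_multiplier_𝔭 x hp) ?_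
  rw [lie_neg]
  module

/-- The connection respects the ℤ/2-grading of 𝔤 = 𝔨 ⊕ 𝔭. For Y, Z of different type, X ↦ R(X,Y)Z
therefore exchanges 𝔭 and 𝔨 and has no trace. -/
theorem nabla_mem (D : IsIdealDecomposition C 𝔨ᵢ P) {x : Fin m → ℝ} (hx : ∀ i, 0 < x i) :
    (∀ X ∈ C.𝔭, ∀ Y ∈ C.𝔭, (D.metric x hx).nabla X Y ∈ C.𝔨) ∧
    (∀ X ∈ C.𝔨, ∀ Y ∈ C.𝔨, (D.metric x hx).nabla X Y ∈ C.𝔨) ∧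
    (∀ X ∈ C.𝔨, ∀ Y ∈ C.𝔭, (D.metric x hx).nabla X Y ∈ C.𝔭) ∧
    (∀ X ∈ C.𝔭, ∀ Y ∈ C.𝔨, (D.metric x hx).nabla X Y ∈ C.𝔭) := by
  refine ⟨fun X hX Y hY => ?_, fun X hX Y hY => ?_, fun X hX Y hY => ?_, fun X hX Y hY => ?_⟩
  · rw [D.nabla_𝔭_𝔭 hx hX hY]
    exact C.𝔨.smul_mem _ (C.lie_𝔭_𝔭 hX hY)
  · rw [D.nabla_𝔨_𝔨 hx hX hY]
    exact C.𝔨.smul_mem _ (C.lie_𝔨_𝔨 hX hY)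
  · rw [D.nabla_𝔨_𝔭 hx hX hY]
    exact add_mem (C.lie_𝔨_𝔭 hX hY) (C.𝔭.smul_mem _ (C.lie_𝔨_𝔭 (D.multiplier_mem x X) hY))
  · rw [D.nabla_𝔭_𝔨 hx hX hY]
    exact C.𝔭.smul_mem _ (C.lie_𝔭_𝔨 hX (D.multiplier_mem x Y))

theorem ricci_𝔭_𝔨 (D : IsIdealDecomposition C 𝔨ᵢ P) {x : Fin m → ℝ} (hx : ∀ i, 0 < x i)
    {Y Z : 𝔤} (hY : Y ∈ C.𝔭) (hZ : Z ∈ C.𝔨) : (D.metric x hx).ricci Y Z = 0 := by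
  obtain ⟨hpp, hkk, hkp, hpk⟩ := D.nabla_mem hx
  refine C.trace_eq_zero (fun X hX => ?_) (fun X hX => ?_)
  · exact sub_mem (sub_mem (hpp X hX _ (hpk Y hY Z hZ)) (hpp Y hY _ (hpk X hX Z hZ)))
      (hkk _ (C.lie_𝔭_𝔭 hX hY) Z hZ)
  · exact sub_mem (sub_mem (hkp X hX _ (hpk Y hY Z hZ)) (hpk Y hY _ (hkk X hX Z hZ)))
      (hpk _ (C.lie_𝔨_𝔭 hX hY) Z hZ)

theorem ricci_𝔨_𝔭 (D : IsIdealDecomposition C 𝔨ᵢ P) {x : Fin m → ℝ} (hx : ∀ i, 0 < x i)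
    {Y Z : 𝔤} (hY : Y ∈ C.𝔨) (hZ : Z ∈ C.𝔭) : (D.metric x hx).ricci Y Z = 0 := by
  obtain ⟨hpp, hkk, hkp, hpk⟩ := D.nabla_mem hx
  refine C.trace_eq_zero (fun X hX => ?_) (fun X hX => ?_)
  · exact sub_mem (sub_mem (hpp X hX _ (hkp Y hY Z hZ)) (hkk Y hY _ (hpp X hX Z hZ)))
      (hpp _ (C.lie_𝔭_𝔨 hX hY) Z hZ)
  · exact sub_mem (sub_mem (hkp X hX _ (hkp Y hY Z hZ)) (hkp Y hY _ (hkp X hX Z hZ)))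
      (hkp _ (C.lie_𝔨_𝔨 hX hY) Z hZ)

theorem ricci_𝔨_𝔨 (D : IsIdealDecomposition C 𝔨ᵢ P) {x : Fin m → ℝ} (hx : ∀ i, 0 < x i)
    {Y Z : 𝔤} (hY : Y ∈ C.𝔨) (hZ : Z ∈ C.𝔨) : (D.metric x hx).ricci Y Z
      = -(1 / 4) * weightedKilling C.proj𝔭 (multiplier P x Y) (multiplier P x Z)
        - 1 / 4 * weightedKilling C.proj𝔨 Y Z := by
  set M := multiplier P x with hM
  have hMk (X : 𝔤) : M X ∈ C.𝔨 := D.multiplier_mem x X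
  change LinearMap.trace ℝ 𝔤 ((D.metric x hx).curvature Y Z) = _
  let a := LieAlgebra.ad ℝ 𝔤
  have hYZ := C.lie_𝔨_𝔨 hY hZ
  -- The curvature map written in adjoint maps, separately on 𝔭 and on 𝔨. Single adjoint maps have
  -- no projected trace, and on 𝔭 the two mixed products cancel by symmetry of the weighted form.
  rw [C.trace_eq (A₁ := (1 / 4 : ℝ) • a (M ⁅Y, Z⁆) - (1 / 2 : ℝ) • (a Y * a (M Z))
      - (1 / 4 : ℝ) • (a (M Y) * a (M Z)) + (1 / 2 : ℝ) • (a (M Z) * a Y))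
    (A₂ := -(1 / 4 : ℝ) • a ⁅Y, Z⁆ + (1 / 4 : ℝ) • (a Y * a Z) - (1 / 2 : ℝ) • (a Z * a Y))]
  · simp only [mul_add, mul_sub, mul_smul_comm, map_add, map_sub, map_smul]
    rw [trace_proj_mul_ad C C.isOrthProj_proj𝔭.symm, trace_proj_mul_ad C C.isOrthProj_proj𝔨.symm]
    simp only [a, ← weightedKilling_apply]
    rw [weightedKilling_symm C C.isOrthProj_proj𝔭.symm (M Z) Y,
      weightedKilling_symm C C.isOrthProj_proj𝔨.symm Z Y]
    simp only [smul_eq_mul]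
    ring
  · intro X hX
    change (D.metric x hx).nabla X ((D.metric x hx).nabla Y Z)
      - (D.metric x hx).nabla Y ((D.metric x hx).nabla X Z) - (D.metric x hx).nabla ⁅X, Y⁆ Z = _
    rw [D.nabla_𝔨_𝔨 hx hY hZ, D.nabla_𝔭_𝔨 hx hX hZ, D.nabla_𝔭_𝔨 hx (C.lie_𝔭_𝔨 hX hY) hZ,
      map_smul, map_smul, D.nabla_𝔭_𝔨 hx hX hYZ,
      D.nabla_𝔨_𝔭 hx hY (C.lie_𝔭_𝔨 hX (D.multiplier_mem x Z))]
    simp only [LinearMap.add_apply, LinearMap.sub_apply, LinearMap.smul_apply,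
      Module.End.mul_apply, a, LieAlgebra.ad_apply, ← hM]
    rw [← lie_skew X (M ⁅Y, Z⁆), ← lie_skew X (M Z), ← lie_skew ⁅X, Y⁆, ← lie_skew X Y]
    simp only [lie_neg]
    module
  · intro X hX
    change (D.metric x hx).nabla X ((D.metric x hx).nabla Y Z)
      - (D.metric x hx).nabla Y ((D.metric x hx).nabla X Z) - (D.metric x hx).nabla ⁅X, Y⁆ Z = _
    rw [D.nabla_𝔨_𝔨 hx hY hZ, D.nabla_𝔨_𝔨 hx hX hZ, D.nabla_𝔨_𝔨 hx (C.lie_𝔨_𝔨 hX hY) hZ,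
      map_smul, map_smul, D.nabla_𝔨_𝔨 hx hX hYZ, D.nabla_𝔨_𝔨 hx hY (C.lie_𝔨_𝔨 hX hZ)]
    simp only [LinearMap.add_apply, LinearMap.sub_apply, LinearMap.smul_apply,
      Module.End.mul_apply, a, LieAlgebra.ad_apply]
    rw [← lie_skew X ⁅Y, Z⁆, ← lie_skew X Z, ← lie_skew ⁅X, Y⁆, ← lie_skew X Y]
    simp only [lie_neg]
    module

theorem ricci_𝔭_𝔭 (D : IsIdealDecomposition C 𝔨ᵢ P) {x : Fin m → ℝ} (hx : ∀ i, 0 < x i)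
    {Y Z : 𝔤} (hY : Y ∈ C.𝔭) (hZ : Z ∈ C.𝔭) : (D.metric x hx).ricci Y Z
      = -(1 / 2) * killingForm ℝ 𝔤 Y Z - 1 / 2 * weightedKilling (multiplier P x) Y Z := by
  set M := multiplier P x with hM
  have hMk (X : 𝔤) : M X ∈ C.𝔨 := D.multiplier_mem x X
  change LinearMap.trace ℝ 𝔤 ((D.metric x hx).curvature Y Z) = _
  let a := LieAlgebra.ad ℝ 𝔤
  have hYZ := C.lie_𝔭_𝔭 hY hZ
  rw [C.trace_eq (A₁ := (1 / 4 : ℝ) • a (M ⁅Y, Z⁆) - (1 / 4 : ℝ) • (a Y * M * a Z)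
      - (a Z * a Y) - (1 / 2 : ℝ) • (a Z * M * a Y))
    (A₂ := -(1 / 4 : ℝ) • a ⁅Y, Z⁆ + (1 / 2 : ℝ) • (a Y * a Z) + (1 / 4 : ℝ) • (a Y * a Z * M)
      - (1 / 2 : ℝ) • (a Z * a Y))]
  -- The map ad Y ∘ M already takes values in 𝔭, so the projection can be dropped and the trace
  -- rotated to put M in front.
  · have hyMz {Y : 𝔤} (hY : Y ∈ C.𝔭) (Z : 𝔤) :
        LinearMap.trace ℝ 𝔤 (C.proj𝔭 * (a Y * M * a Z)) = weightedKilling M Z Y := by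
      have : C.proj𝔭 * (a Y * M) = a Y * M :=
        LinearMap.ext fun X => C.proj𝔭_of_mem (C.lie_𝔭_𝔨 hY (hMk X))
      rw [← mul_assoc, this, mul_assoc, LinearMap.trace_mul_comm, mul_assoc]
      rfl
    have hyzM : LinearMap.trace ℝ 𝔤 (C.proj𝔨 * (a Y * a Z * M)) = weightedKilling M Y Z := by
      have : M * C.proj𝔨 = M := by
        refine LinearMap.ext fun X => ?_
        change M (C.proj𝔨 X) = M X
        nth_rw 2 [← C.proj_add_proj X]
        rw [map_add, D.multiplier_𝔭 x (C.proj𝔭_mem X), zero_add]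
      rw [LinearMap.trace_mul_comm, mul_assoc, this, LinearMap.trace_mul_comm]
      rfl
    simp only [mul_add, mul_sub, mul_smul_comm, map_add, map_sub, map_smul]
    rw [trace_proj_mul_ad C C.isOrthProj_proj𝔭.symm, trace_proj_mul_ad C C.isOrthProj_proj𝔨.symm,
      hyMz hY, hyMz hZ, hyzM]
    simp only [a, ← weightedKilling_apply]
    rw [weightedKilling_symm C (D.multiplier_symm x) Z Y, (C.weightedKilling_proj𝔨_𝔭 hZ Y).1,
      (C.weightedKilling_proj𝔨_𝔭 hZ Y).2, (C.weightedKilling_proj𝔨_𝔭 hY Z).1, killing_symm Z Y]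
    simp only [smul_eq_mul]
    ring
  · intro X hX
    change (D.metric x hx).nabla X ((D.metric x hx).nabla Y Z)
      - (D.metric x hx).nabla Y ((D.metric x hx).nabla X Z) - (D.metric x hx).nabla ⁅X, Y⁆ Z = _
    rw [D.nabla_𝔭_𝔭 hx hY hZ, D.nabla_𝔭_𝔭 hx hX hZ, D.nabla_𝔨_𝔭 hx (C.lie_𝔭_𝔭 hX hY) hZ,
      map_smul, map_smul, D.nabla_𝔭_𝔨 hx hX hYZ, D.nabla_𝔭_𝔨 hx hY (C.lie_𝔭_𝔭 hX hZ)]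
    simp only [LinearMap.sub_apply, LinearMap.smul_apply,
      Module.End.mul_apply, a, LieAlgebra.ad_apply, ← hM]
    rw [← lie_skew X (M ⁅Y, Z⁆), ← lie_skew X Z, ← lie_skew ⁅X, Y⁆, ← lie_skew (M ⁅X, Y⁆),
      ← lie_skew X Y]
    simp only [lie_neg, map_neg]
    module
  · intro X hX
    change (D.metric x hx).nabla X ((D.metric x hx).nabla Y Z)
      - (D.metric x hx).nabla Y ((D.metric x hx).nabla X Z) - (D.metric x hx).nabla ⁅X, Y⁆ Z = _
    rw [D.nabla_𝔭_𝔭 hx hY hZ, D.nabla_𝔨_𝔭 hx hX hZ, D.nabla_𝔭_𝔭 hx (C.lie_𝔨_𝔭 hX hY) hZ,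
      map_add, map_smul, map_smul, D.nabla_𝔨_𝔨 hx hX hYZ, D.nabla_𝔭_𝔭 hx hY (C.lie_𝔨_𝔭 hX hZ),
      D.nabla_𝔭_𝔭 hx hY (C.lie_𝔨_𝔭 (D.multiplier_mem x X) hZ)]
    simp only [LinearMap.add_apply, LinearMap.sub_apply, LinearMap.smul_apply,
      Module.End.mul_apply, a, LieAlgebra.ad_apply, ← hM]
    rw [← lie_skew X ⁅Y, Z⁆, ← lie_skew X Z, ← lie_skew ⁅X, Y⁆, ← lie_skew X Y,
      ← lie_skew (M X) Z]
    simp only [lie_neg]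
    module

/-- The Ricci curvature of a diagonal metric is diagonal. -/
theorem ricci_isDiagonal [LieAlgebra.IsSimple ℝ 𝔤] (D : IsIdealDecomposition C 𝔨ᵢ P)
    {κ : Fin m → ℝ} (hκ : ∀ i, ∀ X ∈ 𝔨ᵢ i, ∀ Y ∈ 𝔨ᵢ i,
      weightedKilling (P i) X Y = κ i * killingForm ℝ 𝔤 X Y)
    {x : Fin m → ℝ} (hx : ∀ i, 0 < x i) :
    IsDiagonal C 𝔨ᵢ (D.metric x hx).ricci
      (-(1 / 2 + ∑ i, x i * (Module.finrank ℝ (𝔨ᵢ i) * (1 - κ i))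
        / (2 * Module.finrank ℝ C.𝔭)))
      (fun i => (κ i + (1 - κ i) * x i ^ 2) / 4) where
  on_𝔭 X hX Y hY := by
    rw [D.ricci_𝔭_𝔭 hx hX hY, C.Q_𝔭 hX, multiplier, weightedKilling_sum_smul]
    simp only [LinearMap.sum_apply, LinearMap.smul_apply, smul_eq_mul]
    rw [Finset.sum_congr rfl fun i _ => by rw [D.weightedKilling_𝔭 (hκ i) hX hY],
      Finset.mul_sum, neg_mul, ← neg_add', neg_mul, add_mul, Finset.sum_mul]
    congr 2
    exact Finset.sum_congr rfl fun i _ => by ring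
  on_𝔨 i X hX Y hY := by
    rw [D.ricci_𝔨_𝔨 hx (D.le i hX) (D.le i hY), C.Q_𝔨 (D.le i hX), D.multiplier_of_mem x hX,
      D.multiplier_of_mem x hY, map_smul, map_smul, LinearMap.smul_apply,
      D.weightedKilling_proj𝔭 (hκ i) hX hY, ← D.sum_eq, weightedKilling_sum, LinearMap.sum_apply,
      LinearMap.sum_apply, Finset.sum_eq_single i, hκ i X hX Y hY, smul_eq_mul, smul_eq_mul]
    · ring
    · exact fun j _ hj => D.weightedKilling_of_ne hj X hY
    · simp
  𝔭_𝔨 i X hX Y hY := ⟨D.ricci_𝔭_𝔨 hx hX (D.le i hY), D.ricci_𝔨_𝔭 hx (D.le i hY) hX⟩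
  𝔨_𝔨 i j hij X hX Y hY := by
    have h1 := D.weightedKilling_split X Y
    rw [D.weightedKilling_proj𝔭_of_ne hij hX hY, D.orth i j hij X hX Y hY, zero_add] at h1
    rw [D.ricci_𝔨_𝔨 hx (D.le i hX) (D.le j hY), D.multiplier_of_mem x hX,
      D.multiplier_of_mem x hY, map_smul, map_smul, LinearMap.smul_apply,
      D.weightedKilling_proj𝔭_of_ne hij hX hY, ← D.sum_eq, weightedKilling_sum,
      LinearMap.sum_apply, LinearMap.sum_apply, h1]
    simp

end IsIdealDecomposition

end Ricci

/-! ### The cubic and the case of two summands. -/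

section Scalar

/-- Division with remainder: 9aP = (3ax+b)P' - 2(b²-3ac)x + (9ad-bc). If b² ≠ 3ac, `cubicRd` is the
zero of the remainder, and D = 0 makes it a zero of P'. If b² = 3ac, the remainder is the constant
9ad-bc, which vanishes. All the conditions put this root beyond τ. -/
theorem CubicCondition.exists_double_root {a b c d τ : ℝ} (ha : a ≠ 0)
    (h : CubicCondition a b c d τ) :
    ∃ x, τ < x ∧ a * x ^ 3 + b * x ^ 2 + c * x + d = 0 ∧ 3 * a * x ^ 2 + 2 * b * x + c = 0 := by
  have hdouble (hD : cubicD a b c d = 0) (h0 : b ^ 2 ≠ 3 * a * c) :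
      a * cubicRd a b c d ^ 3 + b * cubicRd a b c d ^ 2 + c * cubicRd a b c d + d = 0 ∧
        3 * a * cubicRd a b c d ^ 2 + 2 * b * cubicRd a b c d + c = 0 := by
    have hΔ : b ^ 2 - 3 * a * c ≠ 0 := sub_ne_zero.2 h0
    have hR : 2 * (b ^ 2 - 3 * a * c) * cubicRd a b c d = 9 * a * d - b * c := by
      rw [cubicRd]
      field_simp
    generalize cubicRd a b c d = x at hR
    have h1 : 3 * a * x ^ 2 + 2 * b * x + c = 0 := by
      have h4 : 4 * (b ^ 2 - 3 * a * c) ^ 2 * (3 * a * x ^ 2 + 2 * b * x + c) = 0 := by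
        rw [cubicD] at hD
        linear_combination (3 * a * (2 * (b ^ 2 - 3 * a * c) * x + (9 * a * d - b * c))
          + 4 * b * (b ^ 2 - 3 * a * c)) * hR - 9 * a * hD
      exact (mul_eq_zero.1 h4).resolve_left (by positivity)
    refine ⟨mul_left_cancel₀ (mul_ne_zero (by norm_num : (9 : ℝ) ≠ 0) ha) ?_, h1⟩
    linear_combination (3 * a * x + b) * h1 - hR
  rcases h with ⟨hD, h0, hτ⟩ | ⟨hD, h0, _, hτ⟩ | ⟨hD, h0, h1, h2⟩ | ⟨hD, h0, hτ, _⟩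
  · refine ⟨_, hτ, ?_⟩
    have hR : 3 * a * cubicRt a b = -b := by
      rw [cubicRt]
      field_simp
    generalize cubicRt a b = x at hR
    have hN : 9 * a * d - b * c = 0 := by
      have : (9 * a * d - b * c) ^ 2 = 0 := by
        rw [cubicD] at hD
        linear_combination (-3) * hD + (4 * c ^ 2 - 12 * b * d) * h0
      exact pow_eq_zero_iff two_ne_zero |>.1 this
    have h1 : 3 * a * x ^ 2 + 2 * b * x + c = 0 := by
      refine mul_left_cancel₀ (mul_ne_zero (by norm_num : (3 : ℝ) ≠ 0) ha) ?_
      linear_combination (3 * a * x + b) * hR - h0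
    refine ⟨mul_left_cancel₀ (mul_ne_zero (by norm_num : (9 : ℝ) ≠ 0) ha) ?_, h1⟩
    linear_combination (3 * a * x + b) * h1 - 2 * x * h0 + hN
  · exact ⟨_, hτ, hdouble hD h0⟩
  · exact ⟨_, h1.trans h2, hdouble hD h0⟩
  · exact ⟨_, hτ, hdouble hD h0⟩

/-- The discriminant conditions give a solution of the prescribed Ricci curvature equations. -/
theorem TensorCubicCondition.exists_solution {n d₁ d₂ κ₁ κ₂ T𝔭 T₁ T₂ : ℝ} (hn : 0 < n)
    (hd₁ : 0 < d₁) (hd₂ : 0 < d₂) (hκ₂ : 0 ≤ κ₂ ∧ κ₂ < 1)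
    (hT𝔭 : 0 < T𝔭) (hT₁ : 0 < T₁) (hT₂ : 0 < T₂)
    (h : TensorCubicCondition n d₁ d₂ κ₁ κ₂ T𝔭 T₁ T₂) :
    ∃ c x₁ x₂ : ℝ, 0 < c ∧ 0 < x₁ ∧ 0 < x₂ ∧ (κ₁ + (1 - κ₁) * x₁ ^ 2) / 4 = c * T₁ ∧
      (κ₂ + (1 - κ₂) * x₂ ^ 2) / 4 = c * T₂ ∧
      1 / 2 + (x₁ * (d₁ * (1 - κ₁)) / (2 * n) + x₂ * (d₂ * (1 - κ₂)) / (2 * n)) = c * T𝔭 := by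
  have h₂ : 0 < 1 - κ₂ := by linarith [hκ₂.2]
  obtain ⟨x, hτ, hP, hP'⟩ := CubicCondition.exists_double_root (by positivity) h
  rw [div_lt_iff₀ (by positivity)] at hτ
  have hx : 0 < x := by
    by_contra hle
    have : x * (n * T𝔭) ≤ 0 := mul_nonpos_of_nonpos_of_nonneg (not_lt.1 hle) (by positivity)
    have : 0 < d₂ * T₂ := by positivity
    linarith
  -- The constraint tr_g T = 0 reads d₁T₁/x₁ + d₂T₂/x₂ = nT_𝔭. With x₂ = x it gives x₁ = d₁T₁x/w,
  -- and x > τ means w > 0.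
  obtain ⟨w, hw⟩ : ∃ w, w = n * T𝔭 * x - d₂ * T₂ := ⟨_, rfl⟩
  have hw0 : 0 < w := by rw [hw]; linarith
  -- Divided by xw, this is ∑(dᵢ(1-κᵢ)xᵢ - dᵢκᵢ/xᵢ) + 2n, which is -4 times the scalar curvature.
  have hP₂ : d₂ * (1 - κ₂) * x ^ 2 * w + d₁ ^ 2 * (1 - κ₁) * T₁ * x ^ 2 + 2 * n * x * w
      - d₂ * κ₂ * w - κ₁ * w ^ 2 / T₁ = 0 := by
    rw [hw, ← hP]
    field_simp
    ring
  have hP₃ : d₂ * (1 - κ₂) * (2 * x * w + x ^ 2 * (n * T𝔭)) + 2 * d₁ ^ 2 * (1 - κ₁) * T₁ * x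
      + 2 * n * (w + x * (n * T𝔭)) - d₂ * κ₂ * (n * T𝔭) - 2 * κ₁ * w * (n * T𝔭) / T₁ = 0 := by
    rw [hw, ← hP']
    field_simp
    ring
  -- The Lagrange condition for the scalar curvature on the constraint curve. It comes from (xw)'P -
  -- xwP' = 0, the numerator of the derivative of P/(xw) up to sign; the common ratio is 4c.
  have hE : (κ₁ + (1 - κ₁) * (d₁ * T₁ * x / w) ^ 2) / T₁ = (κ₂ + (1 - κ₂) * x ^ 2) / T₂ := by
    have h5 : d₂ * ((κ₁ * T₂ / T₁ - κ₂ - (1 - κ₂) * x ^ 2) * w ^ 2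
        + (1 - κ₁) * d₁ ^ 2 * T₁ * T₂ * x ^ 2) = 0 := by
      rw [hw] at hP₂ hP₃ ⊢
      linear_combination (n * T𝔭 * x - d₂ * T₂ + x * (n * T𝔭)) * hP₂
        - x * (n * T𝔭 * x - d₂ * T₂) * hP₃
    have h6 := (mul_eq_zero.1 h5).resolve_left hd₂.ne'
    field_simp at h6 ⊢
    linear_combination h6
  refine ⟨(κ₂ + (1 - κ₂) * x ^ 2) / (4 * T₂), d₁ * T₁ * x / w, x, ?_, by positivity, hx, ?_, ?_, ?_⟩
  · have := hκ₂.1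
    positivity
  · rw [eq_div_iff hT₂.ne'] at hE
    rw [← hE]
    field_simp
  · field_simp
  · obtain ⟨x₁, hx₁⟩ : ∃ x₁, x₁ = d₁ * T₁ * x / w := ⟨_, rfl⟩
    obtain ⟨q, hq⟩ : ∃ q, q = (κ₂ + (1 - κ₂) * x ^ 2) / T₂ := ⟨_, rfl⟩
    have e₁ : κ₁ + (1 - κ₁) * x₁ ^ 2 = q * T₁ := by
      rw [hx₁, hq, ← hE]
      field_simp
    have e₂ : κ₂ + (1 - κ₂) * x ^ 2 = q * T₂ := by
      rw [hq]
      field_simp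
    have e₃ : x₁ * w = d₁ * T₁ * x := by
      rw [hx₁]
      field_simp
    have e₄ : T₁ * (d₂ * (1 - κ₂) * x ^ 2 * w + d₁ ^ 2 * (1 - κ₁) * T₁ * x ^ 2 + 2 * n * x * w
        - d₂ * κ₂ * w) - κ₁ * w ^ 2 = 0 := by
      field_simp at hP₂
      linear_combination hP₂
    -- The equation on 𝔭 follows by tracing: Ric = cT holds on 𝔨, and both the scalar curvature and
    -- tr_g T vanish.
    have hG : x * w * T₁ * (2 * n + 2 * x₁ * d₁ * (1 - κ₁) + 2 * x * d₂ * (1 - κ₂)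
        - q * n * T𝔭) = 0 := by
      linear_combination e₄ + w * d₂ * T₁ * e₂ + w ^ 2 * e₁ + q * w * T₁ * hw
        + (d₁ * (1 - κ₁) * x * T₁ - (1 - κ₁) * x₁ * w) * e₃
    have hG' := (mul_eq_zero.1 hG).resolve_left (by positivity)
    have hc : (κ₂ + (1 - κ₂) * x ^ 2) / (4 * T₂) = q / 4 := by
      rw [hq]
      field_simp
    rw [hc, ← hx₁]
    field_simp
    linear_combination 2 * hG'

end Scalar

/-! ### The scalar equation in c. -/

section Equation

/-- The value of `xᵢ` forced by the equation `Ric = c T` on `𝔨ᵢ`. -/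
noncomputable def ratio (κ T c : ℝ) : ℝ := √((4 * c * T - κ) / (1 - κ))

/-- The defect of the equation `Ric = c T` on `𝔭` for the metric with coefficients `ratio`. -/
noncomputable def defect {m : ℕ} (n : ℝ) (d κ : Fin m → ℝ) (T𝔭 : ℝ) (T : Fin m → ℝ) (c : ℝ) : ℝ :=
  1 / 2 + ∑ i, ratio (κ i) (T i) c * (d i * (1 - κ i)) / (2 * n) - c * T𝔭

theorem ratio_pos {κ T c : ℝ} (hκ : κ < 1) (h : κ < 4 * c * T) : 0 < ratio κ T c :=
  Real.sqrt_pos.2 (div_pos (by linarith) (by linarith))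

theorem ratio_sq {κ T c : ℝ} (hκ : κ < 1) (h : κ ≤ 4 * c * T) :
    (1 - κ) * ratio κ T c ^ 2 = 4 * c * T - κ := by
  have : 1 - κ ≠ 0 := by linarith
  rw [ratio, Real.sq_sqrt (div_nonneg (by linarith) (by linarith))]
  field_simp

theorem continuous_defect {m : ℕ} (n : ℝ) (d κ : Fin m → ℝ) (T𝔭 : ℝ) (T : Fin m → ℝ) :
    Continuous (defect n d κ T𝔭 T) := by
  unfold defect ratio
  fun_prop

variable {m : ℕ} {n : ℝ} {d κ : Fin m → ℝ} {T𝔭 : ℝ} {T : Fin m → ℝ}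

theorem exists_defect_neg (hn : 0 < n) (hd : ∀ i, 0 < d i) (hκ₀ : ∀ i, 0 ≤ κ i)
    (hκ₁ : ∀ i, κ i < 1) (hT𝔭 : 0 < T𝔭) (c₀ : ℝ) :
    ∃ c, c₀ ≤ c ∧ defect n d κ T𝔭 T c < 0 := by
  obtain ⟨A, hA⟩ : ∃ A, A = ∑ i, √(4 * T i / (1 - κ i)) * (d i * (1 - κ i)) / (2 * n) := ⟨_, rfl⟩
  have hA0 : 0 ≤ A := by
    rw [hA]
    refine Finset.sum_nonneg fun i _ => ?_
    have := hd i
    have : 0 < 1 - κ i := by linarith [hκ₁ i]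
    positivity
  -- For c = t² the sum of square roots is at most tA, while the linear term is t²T_𝔭. The summand
  -- (A+1)/T_𝔭 makes the latter win, and 1 + |c₀| ensures t² ≥ c₀.
  obtain ⟨t, ht⟩ : ∃ t, t = (A + 1) / T𝔭 + 1 + |c₀| := ⟨_, rfl⟩
  have hq : 0 < (A + 1) / T𝔭 := by positivity
  have hc₀ := abs_nonneg c₀
  have ht1 : 1 ≤ t := by linarith
  refine ⟨t ^ 2, ?_, ?_⟩
  · have := le_abs_self c₀
    nlinarith
  · have hle : ∑ i, ratio (κ i) (T i) (t ^ 2) * (d i * (1 - κ i)) / (2 * n) ≤ t * A := by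
      rw [hA, Finset.mul_sum]
      refine Finset.sum_le_sum fun i _ => ?_
      have h1 : 0 < 1 - κ i := by linarith [hκ₁ i]
      have h2 := hd i
      have h3 : ratio (κ i) (T i) (t ^ 2) ≤ t * √(4 * T i / (1 - κ i)) := by
        rw [ratio, ← Real.sqrt_sq (by linarith : 0 ≤ t), ← Real.sqrt_mul (sq_nonneg t),
          Real.sqrt_sq (by linarith : 0 ≤ t)]
        refine Real.sqrt_le_sqrt ?_
        rw [← mul_div_assoc]
        refine div_le_div_of_nonneg_right ?_ h1.le
        linarith [hκ₀ i]
      rw [← mul_div_assoc, ← mul_assoc t]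
      gcongr
    have h4 : A + 1 ≤ t * T𝔭 := by
      rw [← div_le_iff₀ hT𝔭]
      linarith
    have h5 : t * (A + 1) ≤ t ^ 2 * T𝔭 := by nlinarith
    rw [defect]
    linarith

/-- Trial values yᵢ = dᵢTᵢ/(nT_𝔭): the equation on 𝔨ᵢ with xᵢ = yᵢ would need cT_𝔭 = fᵢ + eᵢ/2,
where eᵢ is the contribution of yᵢ to the defect. Taking the largest of these c gives xᵢ ≥ yᵢ for
every i, and bounding the maximum by the sum gives defect ≥ 1/2 - ∑(fᵢ - eᵢ/2), which is positive
exactly by (A). -/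
theorem exists_defect_pos (hn : 0 < n) (hd : ∀ i, 0 < d i) (hκ₀ : ∀ i, 0 ≤ κ i)
    (hκ₁ : ∀ i, κ i < 1) (hT𝔭 : 0 < T𝔭) (hT : ∀ i, 0 < T i)
    (hA : ∑ i, (n ^ 2 * κ i * T𝔭 ^ 2 - d i ^ 2 * (1 - κ i) * T i ^ 2) / (n * T𝔭 * T i)
      - 2 * n < 0) :
    ∃ c, 0 < c ∧ (∀ i, κ i < 4 * c * T i) ∧ 0 < defect n d κ T𝔭 T c := by
  -- Without summands there is no maximum to take; any c < 1/(2T_𝔭) would do.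
  rcases isEmpty_or_nonempty (Fin m) with hm | hm
  · refine ⟨1 / (4 * T𝔭), by positivity, fun i => hm.elim i, ?_⟩
    have : 1 / (4 * T𝔭) * T𝔭 = 1 / 4 := by field_simp
    simp only [defect, Finset.univ_eq_empty, Finset.sum_empty, this]
    norm_num
  let e (i : Fin m) : ℝ := d i ^ 2 * (1 - κ i) * T i / (2 * n ^ 2 * T𝔭)
  let f (i : Fin m) : ℝ := κ i * T𝔭 / (4 * T i)
  have he (i) : 0 < e i := by
    have := hd i
    have := hT i
    have : 0 < 1 - κ i := by linarith [hκ₁ i]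
    positivity
  have hf (i) : 0 ≤ f i := by
    have := hκ₀ i
    have := hT i
    positivity
  have hA' : ∑ i, (f i - e i / 2) < 1 / 2 := by
    have : ∑ i, (n ^ 2 * κ i * T𝔭 ^ 2 - d i ^ 2 * (1 - κ i) * T i ^ 2) / (n * T𝔭 * T i)
        = 4 * n * ∑ i, (f i - e i / 2) := by
      rw [Finset.mul_sum]
      refine Finset.sum_congr rfl fun i _ => ?_
      have := (hT i).ne'
      simp only [e, f]
      field_simp
      ring
    rw [this] at hA
    nlinarith
  obtain ⟨i₀, hi₀⟩ := Finite.exists_max fun i => f i + e i / 2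
  have hc (i) : f i + e i / 2 ≤ (f i₀ + e i₀ / 2) / T𝔭 * T𝔭 := by
    rw [div_mul_cancel₀ _ hT𝔭.ne']
    exact hi₀ i
  generalize hcd : (f i₀ + e i₀ / 2) / T𝔭 = c at hc
  have hc4 (i) : κ i + (1 - κ i) * (d i * T i / (n * T𝔭)) ^ 2 ≤ 4 * c * T i := by
    have h1 := hT i
    have h2 : κ i + (1 - κ i) * (d i * T i / (n * T𝔭)) ^ 2
        = (f i + e i / 2) * (4 * T i / T𝔭) := by
      simp only [e, f]
      field_simp
      ring
    have h3 : 4 * c * T i = c * T𝔭 * (4 * T i / T𝔭) := by field_simp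
    rw [h2, h3]
    exact mul_le_mul_of_nonneg_right (hc i) (by positivity)
  have hlt (i) : κ i < 4 * c * T i := by
    refine lt_of_lt_of_le ?_ (hc4 i)
    have := hd i
    have := hT i
    have : 0 < 1 - κ i := by linarith [hκ₁ i]
    have : 0 < (1 - κ i) * (d i * T i / (n * T𝔭)) ^ 2 := by positivity
    linarith
  refine ⟨c, ?_, hlt, ?_⟩
  · rw [← hcd]
    have := he i₀
    have := hf i₀
    positivity
  · have hsum : ∑ i, e i ≤ ∑ i, ratio (κ i) (T i) c * (d i * (1 - κ i)) / (2 * n) := by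
      refine Finset.sum_le_sum fun i _ => ?_
      have h0 := hd i
      have h1 : 0 < 1 - κ i := by linarith [hκ₁ i]
      have h2 : d i * T i / (n * T𝔭) ≤ ratio (κ i) (T i) c := by
        refine Real.le_sqrt_of_sq_le ?_
        rw [le_div_iff₀ h1]
        linarith [hc4 i]
      have h3 : e i = d i * T i / (n * T𝔭) * (d i * (1 - κ i)) / (2 * n) := by
        simp only [e]
        field_simp
      rw [h3]
      gcongr
    have hcT : c * T𝔭 = f i₀ + e i₀ / 2 := by
      rw [← hcd, div_mul_cancel₀ _ hT𝔭.ne']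
    have hsingle : f i₀ + e i₀ / 2 ≤ ∑ i, (f i + e i / 2) :=
      Finset.single_le_sum (f := fun i => f i + e i / 2)
        (fun i _ => add_nonneg (hf i) (by linarith [he i])) (Finset.mem_univ i₀)
    have hsplit : ∑ i, (f i + e i / 2) = ∑ i, (f i - e i / 2) + ∑ i, e i := by
      rw [← Finset.sum_add_distrib]
      exact Finset.sum_congr rfl fun i _ => by ring
    rw [defect]
    linarith

/-- At this c the coefficient x_l is zero, and the others are estimated by 2x ≤ 1 + x², where x² is
known from the equation on 𝔨ᵢ. Summing with ∑dᵢ(1-κᵢ) = n/2 yields (B); the term d_l(1-κ_l) there is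
what the estimate would have wasted on index `l`. -/
theorem defect_neg_of_max (hn : 0 < n) (hd : ∀ i, 0 < d i)
    (hκ₁ : ∀ i, κ i < 1) (hT : ∀ i, 0 < T i) (hsum : ∑ i, d i * (1 - κ i) = n / 2) {l : Fin m}
    (hl : ∀ i, κ i / T i ≤ κ l / T l)
    (hB : κ l * (-(T𝔭 * n) + ∑ i, T i * d i) / T l < ∑ i, d i + d l * (1 - κ l) - 3 * n) :
    defect n d κ T𝔭 T (κ l / (4 * T l)) < 0 := by
  obtain ⟨q, hq⟩ : ∃ q, q = κ l / T l := ⟨_, rfl⟩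
  have hc : κ l / (4 * T l) = q / 4 := by
    rw [hq, div_div, mul_comm]
  have hle (i) : κ i ≤ 4 * (q / 4) * T i := by
    have := hl i
    rw [div_le_iff₀ (hT i), ← hq] at this
    linarith
  have hterm (i) : 2 * (ratio (κ i) (T i) (q / 4) * (d i * (1 - κ i)))
      ≤ d i * (1 - 2 * κ i + q * T i) - if i = l then d l * (1 - κ l) else 0 := by
    have h1 : 0 < 1 - κ i := by linarith [hκ₁ i]
    have h2 := ratio_sq (hκ₁ i) (hle i)
    split_ifs with h
    · subst h
      have hql : q * T i = κ i := by
        rw [hq]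
        have := (hT i).ne'
        field_simp
      have h0 : ratio (κ i) (T i) (q / 4) = 0 := by
        rw [ratio]
        have : 4 * (q / 4) * T i - κ i = 0 := by linarith
        rw [this]
        simp
      rw [h0, hql]
      apply le_of_eq
      ring
    · have h3 : 0 ≤ (1 - κ i) * (ratio (κ i) (T i) (q / 4) - 1) ^ 2 := by positivity
      have h4 : 2 * (ratio (κ i) (T i) (q / 4) * (1 - κ i)) ≤ 1 - 2 * κ i + q * T i := by
        nlinarith
      have := mul_le_mul_of_nonneg_left h4 (hd i).le
      linarith
  have hS := Finset.sum_le_sum fun i (_ : i ∈ Finset.univ) => hterm i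
  rw [Finset.sum_sub_distrib, Finset.sum_ite_eq' Finset.univ l, if_pos (Finset.mem_univ l),
    ← Finset.mul_sum] at hS
  have hexp : ∑ i, d i * (1 - 2 * κ i + q * T i)
      = 2 * ∑ i, d i * (1 - κ i) - ∑ i, d i + q * ∑ i, T i * d i := by
    rw [Finset.mul_sum, Finset.mul_sum, ← Finset.sum_sub_distrib, ← Finset.sum_add_distrib]
    exact Finset.sum_congr rfl fun i _ => by ring
  have hB' : q * (-(T𝔭 * n) + ∑ i, T i * d i) < ∑ i, d i + d l * (1 - κ l) - 3 * n := by
    rwa [hq, div_mul_eq_mul_div]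
  have hdef : 4 * n * defect n d κ T𝔭 T (κ l / (4 * T l))
      = 2 * n + 2 * ∑ i, ratio (κ i) (T i) (q / 4) * (d i * (1 - κ i)) - q * (T𝔭 * n) := by
    rw [hc, defect, ← Finset.sum_div]
    field_simp
    ring
  have : 4 * n * defect n d κ T𝔭 T (κ l / (4 * T l)) < 0 := by
    rw [hdef]
    rw [hexp, hsum] at hS
    linarith
  exact (pos_iff_neg_of_mul_neg this).1 (by positivity)

end Equation

/-! ### From solutions of the scalar equations to metrics. -/

section Existence

variable {𝔤 : Type*} [LieRing 𝔤] [LieAlgebra ℝ 𝔤]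

theorem IsDiagonal.smul {C : CartanDecomposition 𝔤} {m : ℕ} {𝔨ᵢ : Fin m → LieSubalgebra ℝ 𝔤}
    {h : LinearMap.BilinForm ℝ 𝔤} {γ : ℝ} {γᵢ : Fin m → ℝ} (hh : IsDiagonal C 𝔨ᵢ h γ γᵢ) (c : ℝ) :
    IsDiagonal C 𝔨ᵢ (c • h) (c * γ) (fun i => c * γᵢ i) where
  on_𝔭 X hX Y hY := by simp [hh.on_𝔭 X hX Y hY, mul_assoc]
  on_𝔨 i X hX Y hY := by simp [hh.on_𝔨 i X hX Y hY, mul_assoc]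
  𝔭_𝔨 i X hX Y hY := by simp [hh.𝔭_𝔨 i X hX Y hY]
  𝔨_𝔨 i j hij X hX Y hY := by simp [hh.𝔨_𝔨 i j hij X hX Y hY]

theorem IsIdealDecomposition.eq_top_of_𝔭_eq_bot [LieAlgebra.IsSimple ℝ 𝔤] {C : CartanDecomposition 𝔤}
    {m : ℕ} {𝔨ᵢ : Fin m → LieSubalgebra ℝ 𝔤} {P : Fin m → Module.End ℝ 𝔤}
    (D : IsIdealDecomposition C 𝔨ᵢ P) (hp : C.𝔭 = ⊥) (i : Fin m) (X : 𝔤) :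
    X ∈ 𝔨ᵢ i := by
  have hk (X : 𝔤) : X ∈ C.𝔨 := by
    have := C.proj𝔭_mem X
    rw [hp, Submodule.mem_bot] at this
    rw [← C.proj_add_proj X, this, zero_add]
    exact C.proj𝔨_mem X
  let I : LieIdeal ℝ 𝔤 :=
    { (𝔨ᵢ i).toSubmodule with lie_mem := fun {Y Z} hZ => D.lie_mem i Y (hk Y) Z hZ }
  rcases LieAlgebra.IsSimple.eq_bot_or_eq_top I with hI | hI
  · refine absurd ((Submodule.eq_bot_iff _).2 fun Y hY => ?_) (D.ne_bot i)
    rw [← LieSubmodule.mem_bot (R := ℝ) (L := 𝔤), ← hI]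
    exact hY
  · have : X ∈ I := hI ▸ LieSubmodule.mem_top X
    exact this

/-- If 𝔭 = 0, each summand is a nonzero ideal of the simple algebra 𝔤, hence all of it, so two
summands could not be orthogonal. -/
theorem IsIdealDecomposition.𝔭_ne_bot [LieAlgebra.IsSimple ℝ 𝔤] {C : CartanDecomposition 𝔤}
    {m : ℕ} {𝔨ᵢ : Fin m → LieSubalgebra ℝ 𝔤} {P : Fin m → Module.End ℝ 𝔤}
    (D : IsIdealDecomposition C 𝔨ᵢ P) {i j : Fin m} (hij : i ≠ j) : C.𝔭 ≠ ⊥ := by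
  intro hp
  obtain ⟨X, hX, hX0⟩ := (Submodule.ne_bot_iff _).1 (D.ne_bot i)
  exact (C.neg X (D.le i hX) hX0).ne (D.orth i j hij X hX X (D.eq_top_of_𝔭_eq_bot hp j X))

variable [FiniteDimensional ℝ 𝔤]

/-- The constant `κ` of the centre vanishes. -/
theorem IsIdealList.kappa_natAdd {C : CartanDecomposition 𝔤} {r s : ℕ}
    {𝔨ᵢ : Fin (r + s) → LieSubalgebra ℝ 𝔤} (h : IsIdealList C.𝔨 r s 𝔨ᵢ)
    {P : Fin (r + s) → Module.End ℝ 𝔤} (D : IsIdealDecomposition C 𝔨ᵢ P) (j : Fin s) :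
    kappa (𝔨ᵢ (j.natAdd r)) = 0 := by
  obtain ⟨X, hX, hX0⟩ := (Submodule.ne_bot_iff _).1 (D.ne_bot (j.natAdd r))
  have hk := h.weightedKilling_eq_kappa D (j.natAdd r) hX hX
  have hz : LieAlgebra.ad ℝ 𝔤 X * P (j.natAdd r) = 0 := by
    refine LinearMap.ext fun Z => ?_
    have hZ := D.proj_mem (j.natAdd r) Z
    rw [h.eq_centre] at hZ
    exact (mem_centre.1 hZ).2 X (D.le _ hX)
  rw [weightedKilling_apply, LinearMap.trace_mul_comm, mul_assoc, hz, mul_zero, map_zero] at hk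
  exact (mul_eq_zero.1 hk.symm).resolve_right (C.neg X (D.le _ hX) hX0).ne

namespace IsIdealDecomposition

variable {C : CartanDecomposition 𝔤} {m : ℕ} {𝔨ᵢ : Fin m → LieSubalgebra ℝ 𝔤}
  {P : Fin m → Module.End ℝ 𝔤}

theorem traceWith_Q (D : IsIdealDecomposition C 𝔨ᵢ P) {T : LinearMap.BilinForm ℝ 𝔤} {γ : ℝ}
    {γᵢ : Fin m → ℝ} (hT : IsDiagonal C 𝔨ᵢ T γ γᵢ) :
    traceWith C.Q T
      = γ * Module.finrank ℝ C.𝔭 + ∑ i, γᵢ i * (Module.finrank ℝ (𝔨ᵢ i) : ℝ) := by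
  -- The endomorphism representing T with respect to Q; its trace is a combination of the ranks of
  -- the projections.
  let A : Module.End ℝ 𝔤 := γ • C.proj𝔭 + multiplier P γᵢ
  have hAp {X : 𝔤} (hX : X ∈ C.𝔭) : A X = γ • X := by
    simp [A, C.proj𝔭_of_mem hX, D.multiplier_𝔭 γᵢ hX]
  have hAk {i : Fin m} {X : 𝔤} (hX : X ∈ 𝔨ᵢ i) : A X = γᵢ i • X := by
    simp [A, C.proj𝔭_of_mem_𝔨 (D.le i hX), D.multiplier_of_mem γᵢ hX]
  have hQA : IsDiagonal C 𝔨ᵢ (C.Q ∘ₗ A) γ γᵢ :=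
    { on_𝔭 := fun X hX Y _ => by simp [hAp hX]
      on_𝔨 := fun i X hX Y _ => by simp [hAk hX]
      𝔭_𝔨 := fun i X hX Y hY => by
        simp [hAp hX, hAk hY, C.Q_𝔭 hX, C.Q_𝔨 (D.le i hY), C.killing_𝔭_𝔨 hX (D.le i hY),
          C.killing_𝔨_𝔭 (D.le i hY) hX]
      𝔨_𝔨 := fun i j hij X hX Y hY => by
        simp [hAk hX, C.Q_𝔨 (D.le i hX), D.orth i j hij X hX Y hY] }
  have hAT : T.symmCompOfNondegenerate C.Q C.Q_nondegenerate = A := by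
    refine LinearMap.ext fun X => ?_
    have h (Z : 𝔤) : C.Q (T.symmCompOfNondegenerate C.Q C.Q_nondegenerate X - A X) Z = 0 := by
      rw [map_sub, LinearMap.sub_apply,
        LinearMap.BilinForm.symmCompOfNondegenerate_left_apply T C.Q_nondegenerate,
        ← D.ext_of_isDiagonal hQA hT, LinearMap.comp_apply, sub_self]
    rw [← sub_eq_zero]
    by_contra h0
    exact (C.Q_pos _ h0).ne' (h _)
  rw [traceWith, dif_pos C.Q_nondegenerate, hAT]
  simp only [A, multiplier, map_add, map_smul, map_sum, smul_eq_mul]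
  rw [C.isOrthProj_proj𝔭.isProj.trace]
  simp only [D.trace_proj]

variable {κ : Fin m → ℝ} {T : LinearMap.BilinForm ℝ 𝔤} {T𝔭 : ℝ} {Tᵢ : Fin m → ℝ}

/-- Metrics of the form `Q|_𝔭 + x₁ Q|_𝔨₁ + ⋯` with different constants `c` in `Ric = c T` are not
homothetic. -/
theorem not_homothetic (D : IsIdealDecomposition C 𝔨ᵢ P) (hp : C.𝔭 ≠ ⊥) (hT𝔭 : 0 < T𝔭)
    (hT : IsDiagonal C 𝔨ᵢ T (-T𝔭) Tᵢ) {x y : Fin m → ℝ} (hx : ∀ i, 0 < x i) (hy : ∀ i, 0 < y i)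
    {c₁ c₂ : ℝ} (hc : c₁ ≠ c₂) (h₁ : (D.metric x hx).ricci = c₁ • T)
    (h₂ : (D.metric y hy).ricci = c₂ • T) : ¬ Homothetic (D.metric x hx) (D.metric y hy) := by
  rintro ⟨a, _, ha⟩
  obtain ⟨X, hX, hX0⟩ := (Submodule.ne_bot_iff _).1 hp
  have hB := C.pos X hX hX0
  -- Both metrics equal B on 𝔭 ≠ 0, so the homothety factor is 1. The metrics then coincide, and
  -- comparing Ricci curvatures on 𝔭, where T ≠ 0, would force equal constants.
  have ha1 : a = 1 := by
    have := LinearMap.congr_fun (LinearMap.congr_fun ha X) X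
    rw [LinearMap.smul_apply, LinearMap.smul_apply, D.metric_form_𝔭 hx hX, D.metric_form_𝔭 hy hX,
      smul_eq_mul] at this
    exact mul_right_cancel₀ hB.ne' (by rw [← this, one_mul])
  rw [ha1, one_smul] at ha
  have heq : D.metric x hx = D.metric y hy := by
    cases hgx : D.metric x hx
    cases hgy : D.metric y hy
    rw [hgx, hgy] at ha
    congr
  rw [heq, h₂] at h₁
  have := LinearMap.congr_fun (LinearMap.congr_fun h₁ X) X
  simp only [LinearMap.smul_apply, smul_eq_mul, hT.on_𝔭 X hX X hX, C.Q_𝔭 hX] at this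
  exact hc (mul_right_cancel₀ (mul_ne_zero (neg_ne_zero.2 hT𝔭.ne') hB.ne') this).symm

section Simple

variable [LieAlgebra.IsSimple ℝ 𝔤]

theorem ricci_eq_smul (D : IsIdealDecomposition C 𝔨ᵢ P)
    (hκ : ∀ i, ∀ X ∈ 𝔨ᵢ i, ∀ Y ∈ 𝔨ᵢ i, weightedKilling (P i) X Y = κ i * killingForm ℝ 𝔤 X Y)
    (hT : IsDiagonal C 𝔨ᵢ T (-T𝔭) Tᵢ) {x : Fin m → ℝ} (hx : ∀ i, 0 < x i) {c : ℝ}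
    (hk : ∀ i, (κ i + (1 - κ i) * x i ^ 2) / 4 = c * Tᵢ i)
    (hp : 1 / 2 + ∑ i, x i * (Module.finrank ℝ (𝔨ᵢ i) * (1 - κ i))
      / (2 * Module.finrank ℝ C.𝔭) = c * T𝔭) :
    (D.metric x hx).ricci = c • T := by
  have h := D.ricci_isDiagonal hκ hx
  simp only [hk, hp, neg_mul_eq_mul_neg] at h
  exact D.ext_of_isDiagonal h (hT.smul c)

theorem ricci_eq_smul_of_defect (D : IsIdealDecomposition C 𝔨ᵢ P)
    (hκ : ∀ i, ∀ X ∈ 𝔨ᵢ i, ∀ Y ∈ 𝔨ᵢ i, weightedKilling (P i) X Y = κ i * killingForm ℝ 𝔤 X Y)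
    (hκ₁ : ∀ i, κ i < 1) (hT : IsDiagonal C 𝔨ᵢ T (-T𝔭) Tᵢ) {c : ℝ}
    (hc : ∀ i, κ i < 4 * c * Tᵢ i)
    (h0 : defect (Module.finrank ℝ C.𝔭) (fun i => Module.finrank ℝ (𝔨ᵢ i)) κ T𝔭 Tᵢ c = 0) :
    (D.metric (fun i => ratio (κ i) (Tᵢ i) c) (fun i => ratio_pos (hκ₁ i) (hc i))).ricci
      = c • T := by
  refine D.ricci_eq_smul hκ hT _ (fun i => ?_) ?_
  · have := ratio_sq (hκ₁ i) (hc i).le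
    linarith
  · rw [defect] at h0
    linarith

theorem exists_of_cubic (D : IsIdealDecomposition C 𝔨ᵢ P)
    (hκ : ∀ i, ∀ X ∈ 𝔨ᵢ i, ∀ Y ∈ 𝔨ᵢ i, weightedKilling (P i) X Y = κ i * killingForm ℝ 𝔤 X Y)
    (hT𝔭 : 0 < T𝔭) (hTᵢ : ∀ i, 0 < Tᵢ i) (hT : IsDiagonal C 𝔨ᵢ T (-T𝔭) Tᵢ) (h2 : m = 2)
    (h : TensorCubicCondition (Module.finrank ℝ C.𝔭)
      (Module.finrank ℝ (𝔨ᵢ (Fin.cast h2.symm 0))) (Module.finrank ℝ (𝔨ᵢ (Fin.cast h2.symm 1)))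
      (κ (Fin.cast h2.symm 0)) (κ (Fin.cast h2.symm 1))
      T𝔭 (Tᵢ (Fin.cast h2.symm 0)) (Tᵢ (Fin.cast h2.symm 1))) :
    ∃ g ∈ naturallyReductiveMetrics C.𝔨, ∃ c : ℝ, 0 < c ∧ g.ricci = c • T := by
  subst h2
  simp only [Fin.cast_eq_self] at h
  have hp : C.𝔭 ≠ ⊥ := D.𝔭_ne_bot (i := 0) (j := 1) (by simp)
  have : Nontrivial C.𝔭 := Submodule.nontrivial_iff_ne_bot.2 hp
  have hn : (0 : ℝ) < Module.finrank ℝ C.𝔭 := by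
    exact_mod_cast Module.finrank_pos (R := ℝ) (M := C.𝔭)
  obtain ⟨c, x₁, x₂, hc, hx₁, hx₂, h₁, h₂, h₃⟩ := h.exists_solution hn (D.finrank_pos 0)
    (D.finrank_pos 1) ⟨D.kappa_nonneg (hκ 1), D.kappa_lt_one hp (hκ 1)⟩ hT𝔭 (hTᵢ 0) (hTᵢ 1)
  have hx : ∀ i, 0 < ![x₁, x₂] i := by
    intro i
    fin_cases i
    · exact hx₁
    · exact hx₂
  refine ⟨D.metric _ hx, D.metric_mem hx, c, hc, D.ricci_eq_smul hκ hT hx (fun i => ?_) ?_⟩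
  · fin_cases i
    · exact h₁
    · exact h₂
  · rw [Fin.sum_univ_two]
    exact h₃

end Simple

end IsIdealDecomposition

end Existence

/-! ### Assembling the three existence statements. -/

section Main

variable {𝔤 : Type*} [LieRing 𝔤] [LieAlgebra ℝ 𝔤] [FiniteDimensional ℝ 𝔤]
  [LieAlgebra.IsSimple ℝ 𝔤]

/-- The existence results at the level of Lie algebras. -/
theorem exists_prescribed_ricci (C : CartanDecomposition 𝔤)
    (r s : ℕ) (𝔨ᵢ : Fin (r + s) → LieSubalgebra ℝ 𝔤) (h𝔨 : IsIdealList C.𝔨 r s 𝔨ᵢ)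
    (n : ℝ) (hn : n = Module.finrank ℝ C.𝔭)
    (d κ : Fin (r + s) → ℝ) (hd : ∀ i, d i = Module.finrank ℝ (𝔨ᵢ i))
    (hκ : ∀ i, κ i = kappa (𝔨ᵢ i))
    (T : LinearMap.BilinForm ℝ 𝔤)
    (T𝔭 : ℝ) (Tᵢ : Fin (r + s) → ℝ) (hT𝔭 : 0 < T𝔭) (hTᵢ : ∀ i, 0 < Tᵢ i)
    (hT : IsDiagonal C 𝔨ᵢ T (-T𝔭) Tᵢ) :
    (∑ i, (n ^ 2 * κ i * T𝔭 ^ 2 - d i ^ 2 * (1 - κ i) * Tᵢ i ^ 2) / (n * T𝔭 * Tᵢ i) - 2 * n < 0 →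
      ∃ g ∈ naturallyReductiveMetrics C.𝔨, ∃ c : ℝ, 0 < c ∧ g.ricci = c • T) ∧
    (∀ m : Fin r,
      (∀ i : Fin r, κ (i.castAdd s) / Tᵢ (i.castAdd s) ≤ κ (m.castAdd s) / Tᵢ (m.castAdd s)) →
      κ (m.castAdd s) * traceWith C.Q T / Tᵢ (m.castAdd s)
        < Module.finrank ℝ C.𝔨 + d (m.castAdd s) * (1 - κ (m.castAdd s)) - 3 * n →
      ∑ i, (n ^ 2 * κ i * T𝔭 ^ 2 - d i ^ 2 * (1 - κ i) * Tᵢ i ^ 2) / (n * T𝔭 * Tᵢ i) - 2 * n < 0 →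
      ∃ g₁ ∈ naturallyReductiveMetrics C.𝔨, ∃ g₂ ∈ naturallyReductiveMetrics C.𝔨,
        ∃ c₁ c₂ : ℝ, 0 < c₁ ∧ 0 < c₂ ∧
        g₁.ricci = c₁ • T ∧ g₂.ricci = c₂ • T ∧ ¬ Homothetic g₁ g₂) ∧
    (∀ h2 : r + s = 2,
      TensorCubicCondition n
        (d (Fin.cast h2.symm 0)) (d (Fin.cast h2.symm 1))
        (κ (Fin.cast h2.symm 0)) (κ (Fin.cast h2.symm 1))
        T𝔭 (Tᵢ (Fin.cast h2.symm 0)) (Tᵢ (Fin.cast h2.symm 1)) →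
      ∃ g ∈ naturallyReductiveMetrics C.𝔨, ∃ c : ℝ, 0 < c ∧ g.ricci = c • T) := by
  obtain ⟨P, D⟩ := h𝔨.exists_isIdealDecomposition
  obtain rfl : d = fun i => (Module.finrank ℝ (𝔨ᵢ i) : ℝ) := funext hd
  have hκW (i) : ∀ X ∈ 𝔨ᵢ i, ∀ Y ∈ 𝔨ᵢ i,
      weightedKilling (P i) X Y = κ i * killingForm ℝ 𝔤 X Y := fun X hX Y hY => by
    rw [hκ i]
    exact h𝔨.weightedKilling_eq_kappa D i hX hY
  have hκ₀ (i) : 0 ≤ κ i := D.kappa_nonneg (hκW i)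
  -- For n = 0 every quotient in (A) is a division by zero, with value 0, so (A) would read 0 < 0.
  -- Hence (A) itself excludes 𝔭 = 0.
  have hn_pos (hA : ∑ i, (n ^ 2 * κ i * T𝔭 ^ 2
      - (Module.finrank ℝ (𝔨ᵢ i) : ℝ) ^ 2 * (1 - κ i) * Tᵢ i ^ 2) / (n * T𝔭 * Tᵢ i)
        - 2 * n < 0) : 0 < n ∧ C.𝔭 ≠ ⊥ := by
    have hn0 : n ≠ 0 := by
      rintro rfl
      simp at hA
    have hn1 : 0 ≤ n := by rw [hn]; positivity
    refine ⟨lt_of_le_of_ne hn1 hn0.symm, fun hp => hn0 ?_⟩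
    rw [hn, hp]
    simp
  refine ⟨fun hA => ?_, fun m hm hB hA => ?_, fun h2 h => ?_⟩
  · obtain ⟨hn0, hp⟩ := hn_pos hA
    have hκ₁ (i) : κ i < 1 := D.kappa_lt_one hp (hκW i)
    obtain ⟨c₀, hc₀, hlt, hpos⟩ := exists_defect_pos hn0 D.finrank_pos hκ₀ hκ₁ hT𝔭 hTᵢ hA
    obtain ⟨c₁, hc₁, hneg⟩ := exists_defect_neg (T := Tᵢ) hn0 D.finrank_pos hκ₀ hκ₁ hT𝔭 c₀
    obtain ⟨c, hc, h0⟩ := intermediate_value_Icc' hc₁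
      (continuous_defect n _ κ T𝔭 Tᵢ).continuousOn ⟨hneg.le, hpos.le⟩
    rw [hn] at h0
    have hlt' (i) : κ i < 4 * c * Tᵢ i := (hlt i).trans_le
      (mul_le_mul_of_nonneg_right (by linarith [hc.1]) (hTᵢ i).le)
    exact ⟨_, D.metric_mem _, c, hc₀.trans_le hc.1,
      D.ricci_eq_smul_of_defect hκW hκ₁ hT hlt' h0⟩
  · obtain ⟨hn0, hp⟩ := hn_pos hA
    have hκ₁ (i) : κ i < 1 := D.kappa_lt_one hp (hκW i)
    obtain ⟨c₀, hc₀, hlt, hpos⟩ := exists_defect_pos hn0 D.finrank_pos hκ₀ hκ₁ hT𝔭 hTᵢ hA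
    obtain ⟨b, hb, hneg⟩ := exists_defect_neg (T := Tᵢ) hn0 D.finrank_pos hκ₀ hκ₁ hT𝔭 c₀
    -- The centre has κ = 0, so a maximum over the simple ideals is a maximum over all summands.
    have hmax (i) : κ i / Tᵢ i ≤ κ (m.castAdd s) / Tᵢ (m.castAdd s) := by
      refine Fin.addCases hm (fun j => ?_) i
      rw [hκ, h𝔨.kappa_natAdd D j, zero_div]
      exact div_nonneg (hκ₀ _) (hTᵢ _).le
    have hsum := D.sum_casimir hp hκW
    rw [← hn] at hsum
    rw [D.traceWith_Q hT, D.finrank_𝔨, neg_mul, ← hn] at hB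
    have hneg' := defect_neg_of_max hn0 D.finrank_pos hκ₁ hTᵢ hsum hmax hB
    have hlm : κ (m.castAdd s) / (4 * Tᵢ (m.castAdd s)) < c₀ := by
      have := hTᵢ (m.castAdd s)
      rw [div_lt_iff₀ (by positivity)]
      linarith [hlt (m.castAdd s)]
    -- Open intervals on the two sides of c₀ give c₁ < c₀ < c₂. Openness at the left end also keeps
    -- every xᵢ strictly positive.
    obtain ⟨c₁, hc₁, h₁⟩ := intermediate_value_Ioo hlm.le
      (continuous_defect n _ κ T𝔭 Tᵢ).continuousOn ⟨hneg', hpos⟩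
    obtain ⟨c₂, hc₂, h₂⟩ := intermediate_value_Ioo' hb
      (continuous_defect n _ κ T𝔭 Tᵢ).continuousOn ⟨hneg, hpos⟩
    rw [hn] at h₁ h₂
    have hlt₁ (i) : κ i < 4 * c₁ * Tᵢ i := by
      have h3 := hmax i
      have h4 : κ (m.castAdd s) / Tᵢ (m.castAdd s) < 4 * c₁ := by
        have := hc₁.1
        rw [mul_comm 4, ← div_div] at this
        linarith
      exact (div_lt_iff₀ (hTᵢ i)).1 (h3.trans_lt h4)
    have hlt₂ (i) : κ i < 4 * c₂ * Tᵢ i := (hlt i).trans_le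
      (mul_le_mul_of_nonneg_right (by linarith [hc₂.1]) (hTᵢ i).le)
    have hr₁ := D.ricci_eq_smul_of_defect hκW hκ₁ hT hlt₁ h₁
    have hr₂ := D.ricci_eq_smul_of_defect hκW hκ₁ hT hlt₂ h₂
    have hpos₁ : 0 < c₁ := by
      refine lt_of_le_of_lt ?_ hc₁.1
      have := hκ₀ (m.castAdd s)
      have := hTᵢ (m.castAdd s)
      positivity
    exact ⟨_, D.metric_mem _, _, D.metric_mem _, c₁, c₂, hpos₁, hc₀.trans hc₂.1, hr₁, hr₂,
      D.not_homothetic hp hT𝔭 hT _ _ (hc₁.2.trans hc₂.1).ne hr₁ hr₂⟩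
  · rw [hn] at h
    exact D.exists_of_cubic hκW hT𝔭 hTᵢ hT h2 h

end Main

end PrescribedRicci

theorem mainTheorem2
    -- `G` is a connected non-compact simple Lie group with Lie algebra `𝔤`
    {E : Type*} [NormedAddCommGroup E] [NormedSpace ℝ E] [FiniteDimensional ℝ E] [CompleteSpace E]
    {G : Type*} [TopologicalSpace G] [ChartedSpace E G] [Group G]
    [LieGroup 𝓘(ℝ, E) (minSmoothness ℝ 3) G] [T2Space G] [ConnectedSpace G] [NoncompactSpace G]
    [LieAlgebra.IsSimple ℝ (GroupLieAlgebra 𝓘(ℝ, E) G)]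
    -- `K` is a maximal compact subgroup, `𝔤 = 𝔭 ⊕ 𝔨` the corresponding Cartan decomposition
    (K : Subgroup G) (_hK : Maximal (fun L : Subgroup G => IsCompact (L : Set G)) K)
    (C : PrescribedRicci.CartanDecomposition (GroupLieAlgebra 𝓘(ℝ, E) G))
    (_hKC : PrescribedRicci.IsLieAlgebraOf K C.𝔨)
    -- the simple ideals of `[𝔨,𝔨]` and the centre of `𝔨`
    (r s : ℕ) (𝔨ᵢ : Fin (r + s) → LieSubalgebra ℝ (GroupLieAlgebra 𝓘(ℝ, E) G))
    (_h𝔨 : PrescribedRicci.IsIdealList C.𝔨 r s 𝔨ᵢ)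
    -- the numerical invariants of the pair `(𝔤, 𝔨)`
    (n : ℝ) (_hn : n = Module.finrank ℝ C.𝔭)
    (d κ : Fin (r + s) → ℝ) (_hd : ∀ i, d i = Module.finrank ℝ (𝔨ᵢ i))
    (_hκ : ∀ i, κ i = PrescribedRicci.kappa (𝔨ᵢ i))
    -- the tensor field `T`
    (T : LinearMap.BilinForm ℝ (GroupLieAlgebra 𝓘(ℝ, E) G))
    (T𝔭 : ℝ) (Tᵢ : Fin (r + s) → ℝ) (_hT𝔭 : 0 < T𝔭) (_hTᵢ : ∀ i, 0 < Tᵢ i)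
    (_hT : PrescribedRicci.IsDiagonal C 𝔨ᵢ T (-T𝔭) Tᵢ) :
    (∑ i, (n ^ 2 * κ i * T𝔭 ^ 2 - d i ^ 2 * (1 - κ i) * Tᵢ i ^ 2) / (n * T𝔭 * Tᵢ i) - 2 * n < 0 →
      ∃ g ∈ PrescribedRicci.naturallyReductiveMetrics C.𝔨, ∃ c : ℝ, 0 < c ∧ g.ricci = c • T) ∧
    (∀ m : Fin r,
      (∀ i : Fin r, κ (i.castAdd s) / Tᵢ (i.castAdd s) ≤ κ (m.castAdd s) / Tᵢ (m.castAdd s)) →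
      κ (m.castAdd s) * PrescribedRicci.traceWith C.Q T / Tᵢ (m.castAdd s)
        < Module.finrank ℝ C.𝔨 + d (m.castAdd s) * (1 - κ (m.castAdd s)) - 3 * n →
      ∑ i, (n ^ 2 * κ i * T𝔭 ^ 2 - d i ^ 2 * (1 - κ i) * Tᵢ i ^ 2) / (n * T𝔭 * Tᵢ i) - 2 * n < 0 →
      ∃ g₁ ∈ PrescribedRicci.naturallyReductiveMetrics C.𝔨,
      ∃ g₂ ∈ PrescribedRicci.naturallyReductiveMetrics C.𝔨, ∃ c₁ c₂ : ℝ, 0 < c₁ ∧ 0 < c₂ ∧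
        g₁.ricci = c₁ • T ∧ g₂.ricci = c₂ • T ∧ ¬ PrescribedRicci.Homothetic g₁ g₂) ∧
    (∀ h2 : r + s = 2,
      PrescribedRicci.TensorCubicCondition n
        (d (Fin.cast h2.symm 0)) (d (Fin.cast h2.symm 1))
        (κ (Fin.cast h2.symm 0)) (κ (Fin.cast h2.symm 1))
        T𝔭 (Tᵢ (Fin.cast h2.symm 0)) (Tᵢ (Fin.cast h2.symm 1)) →
      ∃ g ∈ PrescribedRicci.naturallyReductiveMetrics C.𝔨, ∃ c : ℝ, 0 < c ∧ g.ricci = c • T) := by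
  exact PrescribedRicci.exists_prescribed_ricci C r s 𝔨ᵢ _h𝔨 n _hn d κ _hd _hκ T T𝔭 Tᵢ _hT𝔭 _hTᵢ _hT
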